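/- **Model.** Algorithms are finite programs on a unit-cost machine over exact real numbers: values are real numbers and ordered pairs of values (lists are nested pairs; there is no array access and no rounding), programs consist of finitely many, possibly recursive, functions and may contain fixed real constants, and each of the operations $+,-,\times,\div,\sqrt{\phantom{x}}$, comparison with $0$, forming or projecting a pair, testing whether a value is a pair, local binding, variable access and function call costs one step. (Every such step takes $O(1)$ time on the usual real RAM.) Running time means worst-case number of steps, and outputs are exact. **Definitions.** Let $f$ be a real function with domain $D\subseteq\mathbb{R}$, and let $d\ge 0$ be real. We say that $f$ is *$d$-cordial* if there are a single program and a constant $C$ such that for all $a,b\ge 1$, all $x\in\mathbb{R}^a$, $y\in\mathbb{R}^b$ with $x_i+y_j\in D$ for all $i,j$, and all $v\in\mathbb{R}^b$, the program computes from $(x,y,v)$ the product $\mathbf{M}v$, where $\mathbf{M}=[f(x_i+y_j)]_{i,j}\in\mathbb{R}^{a\times b}$, in at most $C\,(a+b)\log^{d}(a+b)$ steps. For a tree $\mathcal{T}$ on the vertices $0,\dots,N-1$ with arbitrary real edge weights, let $\mathrm{dist}(u,v)$ be the total weight of the path from $u$ to $v$. *$f$-integration* of a field $X\in\mathbb{R}^{N\times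 m}$ (a tensor field of shape $N\times d_1\times\dots\times d_s$ has $m=d_1\cdots d_s$) is the computation of the field $u\mapsto\sum_{v} f(\mathrm{dist}(u,v))\,X[v]$ from $X$ and a list of the weighted edges of $\mathcal{T}$; it is defined if all $\mathrm{dist}(u,v)$ lie in $D$. **Theorem.** Let $f=p/q$ be a rational function, with $p,q\in\mathbb{R}[x]$ and $q\neq 0$, on the domain $D=\{x\in\mathbb{R}: q(x)\neq 0\}$, and let $\varepsilon>0$. Then: 1. $f$ is $(2+\varepsilon)$-cordial. 2. For every fixed $m$, there are a single program and a constant $C$ such that the program performs exact $f$-integration of fields in $\mathbb{R}^{N\times m}$ on all weighted trees with $N$ vertices for which it is defined, for all $N\ge1$, in at most $C\,N\log^{3+\varepsilon}N$ steps whenever $N\ge 2$. -/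

import Mathlib

/-! ### Model of computation

Algorithms are finite programs in a first-order language over exact real numbers, with pairs as the
only data structure and a unit charge for every elementary operation.  Each construct costs `O(1)`
instructions on a real random access machine: local variables sit at offsets fixed by the program,
a value is one real number or a pointer to an immutable pair of values, and the real instructions
are `+`, `-`, `*`, `/`, square root and comparison with `0`.  Hence an upper bound on the
running time here is also one, up to a constant factor, on the usual real RAM.  There is no rounding
function and no array access; vertex names and indices are real numbers as well. -/

/-- Data: a real number, or an ordered pair of data. -/
inductive Val : Type
  | num : ℝ → Val
  | pair : Val → Val → Val

/-- A list as data: the empty list is the number `0`, and `a :: l` is the pair of `a` and `l`. -/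
noncomputable def Val.ofList : List Val → Val
  | [] => .num 0
  | a :: l => .pair a (Val.ofList l)

/-- A finite sequence of data as a list, in increasing order of the index. -/
noncomputable def Val.ofFn {n : ℕ} (g : Fin n → Val) : Val := Val.ofList (List.ofFn g)

/-- A real vector as the list of its coordinates. -/
noncomputable def Val.vec {n : ℕ} (x : Fin n → ℝ) : Val := Val.ofFn fun i => .num (x i)

/-- A real matrix as the list of its rows. -/
noncomputable def Val.mat {n m : ℕ} (X : Matrix (Fin n) (Fin m) ℝ) : Val :=
  Val.ofFn fun i => Val.vec (X i)

/-- Expressions.  Variables are de Bruijn indices: `var 0` is the most recently bound one. -/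
inductive Expr : Type
  | var : ℕ → Expr
  /-- a real constant of the program -/
  | const : ℝ → Expr
  | add : Expr → Expr → Expr
  | sub : Expr → Expr → Expr
  | mul : Expr → Expr → Expr
  | div : Expr → Expr → Expr
  | sqrt : Expr → Expr
  | pair : Expr → Expr → Expr
  | fst : Expr → Expr
  | snd : Expr → Expr
  /-- `ifPos c e₁ e₂`: evaluate `e₁` if the number `c` is positive, and `e₂` otherwise -/
  | ifPos : Expr → Expr → Expr → Expr
  /-- `ifPair c e₁ e₂`: evaluate `e₁` if `c` is a pair, and `e₂` if it is a number -/
  | ifPair : Expr → Expr → Expr → Expr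
  /-- `letIn e b`: evaluate `e`, bind its value to a new variable, and evaluate `b` -/
  | letIn : Expr → Expr → Expr
  /-- `call k e`: apply the `k`-th (possibly recursive) function of the program to the value
  of `e` -/
  | call : ℕ → Expr → Expr

/-- A program: the bodies of its finitely many functions of one variable, and the expression that
is evaluated, with the input as its only variable. -/
structure Program : Type where
  funs : List Expr
  main : Expr

/-- `Eval F E e r t`: with the functions `F` and the local variables `E`, the evaluation of the
expression `e` terminates with the value `r` after `t` elementary steps.  Division by zero, the
square root of a negative number, arithmetic on pairs and projections of numbers have no value. -/
inductive Eval (F : List Expr) : List Val → Expr → Val → ℕ → Prop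
  | var {E : List Val} {i : ℕ} {r : Val} : E[i]? = some r → Eval F E (.var i) r 1
  | const {E : List Val} {c : ℝ} : Eval F E (.const c) (.num c) 1
  | add {E : List Val} {e₁ e₂ : Expr} {x y : ℝ} {s t : ℕ} :
      Eval F E e₁ (.num x) s → Eval F E e₂ (.num y) t →
      Eval F E (.add e₁ e₂) (.num (x + y)) (s + t + 1)
  | sub {E : List Val} {e₁ e₂ : Expr} {x y : ℝ} {s t : ℕ} :
      Eval F E e₁ (.num x) s → Eval F E e₂ (.num y) t →
      Eval F E (.sub e₁ e₂) (.num (x - y)) (s + t + 1)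
  | mul {E : List Val} {e₁ e₂ : Expr} {x y : ℝ} {s t : ℕ} :
      Eval F E e₁ (.num x) s → Eval F E e₂ (.num y) t →
      Eval F E (.mul e₁ e₂) (.num (x * y)) (s + t + 1)
  | div {E : List Val} {e₁ e₂ : Expr} {x y : ℝ} {s t : ℕ} :
      Eval F E e₁ (.num x) s → Eval F E e₂ (.num y) t → y ≠ 0 →
      Eval F E (.div e₁ e₂) (.num (x / y)) (s + t + 1)
  | sqrt {E : List Val} {e : Expr} {x : ℝ} {s : ℕ} :
      Eval F E e (.num x) s → 0 ≤ x →
      Eval F E (.sqrt e) (.num (Real.sqrt x)) (s + 1)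
  | pair {E : List Val} {e₁ e₂ : Expr} {a b : Val} {s t : ℕ} :
      Eval F E e₁ a s → Eval F E e₂ b t →
      Eval F E (.pair e₁ e₂) (.pair a b) (s + t + 1)
  | fst {E : List Val} {e : Expr} {a b : Val} {s : ℕ} :
      Eval F E e (.pair a b) s → Eval F E (.fst e) a (s + 1)
  | snd {E : List Val} {e : Expr} {a b : Val} {s : ℕ} :
      Eval F E e (.pair a b) s → Eval F E (.snd e) b (s + 1)
  | ifPos_true {E : List Val} {c e₁ e₂ : Expr} {x : ℝ} {r : Val} {s t : ℕ} :
      Eval F E c (.num x) s → 0 < x → Eval F E e₁ r t →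
      Eval F E (.ifPos c e₁ e₂) r (s + t + 1)
  | ifPos_false {E : List Val} {c e₁ e₂ : Expr} {x : ℝ} {r : Val} {s t : ℕ} :
      Eval F E c (.num x) s → x ≤ 0 → Eval F E e₂ r t →
      Eval F E (.ifPos c e₁ e₂) r (s + t + 1)
  | ifPair_true {E : List Val} {c e₁ e₂ : Expr} {a b : Val} {r : Val} {s t : ℕ} :
      Eval F E c (.pair a b) s → Eval F E e₁ r t →
      Eval F E (.ifPair c e₁ e₂) r (s + t + 1)
  | ifPair_false {E : List Val} {c e₁ e₂ : Expr} {x : ℝ} {r : Val} {s t : ℕ} :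
      Eval F E c (.num x) s → Eval F E e₂ r t →
      Eval F E (.ifPair c e₁ e₂) r (s + t + 1)
  | letIn {E : List Val} {e b : Expr} {a r : Val} {s t : ℕ} :
      Eval F E e a s → Eval F (a :: E) b r t →
      Eval F E (.letIn e b) r (s + t + 1)
  | call {E : List Val} {k : ℕ} {e body : Expr} {a r : Val} {s t : ℕ} :
      F[k]? = some body → Eval F E e a s → Eval F [a] body r t →
      Eval F E (.call k e) r (s + t + 1)

/-- The program `P`, run on `input`, halts after exactly `t` steps and returns `output`. -/
def Program.Runs (P : Program) (input output : Val) (t : ℕ) : Prop :=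
  Eval P.funs [input] P.main output t

/-! ### Cordial functions -/

/-- `f`, a real function with domain `D`, is `d`-cordial (`d` real): a single program multiplies
every matrix `M = [f (x i + y j)]` (of any size `a × b` with `a, b ≥ 1`, and with all its entries
defined) with every vector, given `x`, `y` and the vector, in time
`O((a + b) * (log (a + b)) ^ d)`. -/
def IsCordialOn (f : ℝ → ℝ) (D : Set ℝ) (d : ℝ) : Prop :=
  ∃ (P : Program) (C : ℝ), ∀ (a b : ℕ), 1 ≤ a → 1 ≤ b →
    ∀ (x : Fin a → ℝ) (y : Fin b → ℝ) (v : Fin b → ℝ), (∀ i j, x i + y j ∈ D) →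
      ∃ t : ℕ,
        P.Runs (.pair (Val.vec x) (.pair (Val.vec y) (Val.vec v)))
          (Val.vec (Matrix.mulVec (Matrix.of fun i j => f (x i + y j)) v)) t ∧
        (t : ℝ) ≤ C * ((a + b : ℝ) * Real.log (a + b : ℝ) ^ d)

/-! ### Integration of fields on weighted trees -/

/-- The shortest-path distance in a finite connected graph with edge weights `w`: the least total
weight of a path.  (In a tree there is exactly one path from `u` to `v`.) -/
noncomputable def weightedDist {V : Type*} (G : SimpleGraph V) (w : Sym2 V → ℝ) (u v : V) : ℝ :=
  ⨅ p : G.Path u v, ((p : G.Walk u v).edges.map w).sum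

/-- The `f`-distance matrix `[f (dist (u, v))]` of a weighted graph. -/
noncomputable def distMatrix {V : Type*} (f : ℝ → ℝ) (G : SimpleGraph V) (w : Sym2 V → ℝ) :
    Matrix V V ℝ :=
  Matrix.of fun u v => f (weightedDist G w u v)

/-- `l` lists every edge of `G` exactly once, in any order and with its ends in any order. -/
def IsEdgeList {V : Type*} (G : SimpleGraph V) (l : List (V × V)) : Prop :=
  (l.map fun e => s(e.1, e.2)).Nodup ∧ ∀ e : Sym2 V, e ∈ l.map (fun e => s(e.1, e.2)) ↔ e ∈ G.edgeSet

/-- A weighted edge list as data: the list of the triples `(u, (v, weight of uv))`, with the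
vertices written as the numbers `0, …, N - 1`. -/
noncomputable def Val.edges {N : ℕ} (w : Sym2 (Fin N) → ℝ) (l : List (Fin N × Fin N)) : Val :=
  Val.ofList (l.map fun e =>
    .pair (.num ((e.1 : ℕ) : ℝ)) (.pair (.num ((e.2 : ℕ) : ℝ)) (.num (w s(e.1, e.2)))))

/-- For a real function `f` with domain `D`, exact `f`-integration of fields with `m` real
components (tensor fields of shape `N × d₁ × ⋯ × dₛ` have `m = d₁ ⋯ dₛ`) on weighted `N`-vertex
trees takes time `O(N * (log N) ^ d)`: a single program returns the product of the `f`-distance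
matrix with the field, given any edge list of any weighted tree whose distances all lie in `D`, and
any field.  (The time bound is asked for when `N ≥ 2`, as `log 1 = 0`; the program has to be correct
for `N = 1` too.) -/
def TreeIntegrationInTime (f : ℝ → ℝ) (D : Set ℝ) (m : ℕ) (d : ℝ) : Prop :=
  ∃ (P : Program) (C : ℝ), ∀ (N : ℕ) (G : SimpleGraph (Fin N)), G.IsTree →
    ∀ (w : Sym2 (Fin N) → ℝ) (l : List (Fin N × Fin N)), IsEdgeList G l →
      (∀ u v, weightedDist G w u v ∈ D) →
      ∀ X : Matrix (Fin N) (Fin m) ℝ,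
        ∃ t : ℕ,
          P.Runs (.pair (Val.edges w l) (Val.mat X)) (Val.mat (distMatrix f G w * X)) t ∧
          (2 ≤ N → (t : ℝ) ≤ C * ((N : ℝ) * Real.log (N : ℝ) ^ d))

/-! ### Reasoning about programs -/

/-! Cordiality. For fixed y and v, the sum of v_j p(x + y_j) / q(x + y_j) over j is a single
rational function N/D of x. N and D are found by adding the fractions pairwise along a perfect
binary tree (`fn_fracSum`), evaluated at all x_i by fast multipoint evaluation (`fn_eval`), and
divided. D is a product of factors q(x + y_j), so it does not vanish at the x_i. Polynomial products
of length n take O(n log n) steps, so both phases take O(n log² n).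

Products come from a Fourier transform over ℂ: when |c| = 1 and s² = c, the polynomial X^(2n) - c
splits into X^n - s and X^n + s (`fn_mulMod`). The half-angle formulas give s by real square roots,
so no roots of unity have to be stored. Power series are inverted by Newton's iteration
(`newton_step`, `fn_inv`).

Multipoint evaluation is done in transposed form, without remainders. Polynomials act on sequences
through the shift. Let h be the sequence annihilated by the product of all X - x_j and starting with
0, …, 0, 1. The product over j ≠ i turns h into the geometric sequence of ratio x_i and first term
1, so a further action of P makes the first term P(x_i) (`aeval_prodExcept_fundSeq`). All these
products with one factor left out are applied simultaneously by descending the product tree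
(`fn_down`).

Trees. The rooted tree is stored as a first-child/next-sibling structure (`Forest`). Descending into
the larger subforest until at most 2/3 of the vertices remain cuts off a forest S, and S and the
rest both have at most 5/6 of the vertices (`size_split_le`). The path from S to the rest runs
through the root point of S, so these distances are sums a_i + b_j (`pairs_split`), and the mutual
contributions of the two parts are two products with matrices [f(a_i + b_j)]. There are O(log N)
levels, each with at most N vertices in total, whence N log³ N (`fn_solve`). In an acyclic graph the
walks without backtracking are the unique paths, which identifies the recorded numbers with
distances (`exists_pairs_eq`).

Without arrays and rounding, arrays become perfect binary trees with logarithmic access, and sizes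
are powers of two so that they can be halved exactly. Correctness and cost are proved together, by
induction, as statements `Fn F k a r T`. -/

/-- Whether a value is a pair. -/
def Val.isPair : Val → Bool
  | .num _ => false
  | .pair _ _ => true

/-- The value is a number, and this number has the property `Q`. -/
def Val.OnNum : Val → (ℝ → Prop) → Prop
  | .num x, Q => Q x
  | .pair _ _, _ => False

/-- The value is a pair, and its components have the property `Q`. -/
def Val.OnPair : Val → (Val → Val → Prop) → Prop
  | .num _, _ => False
  | .pair a b, Q => Q a b

/-- The `k`-th function maps `a` to `r` in `t` steps. -/
def Call (F : List Expr) (k : ℕ) (a r : Val) (t : ℕ) : Prop :=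
  ∃ body, F[k]? = some body ∧ Eval F [a] body r t

/-- The `k`-th function maps `a` to `r` in at most `T` steps. -/
def Fn (F : List Expr) (k : ℕ) (a r : Val) (T : ℕ) : Prop :=
  ∃ t ≤ T, Call F k a r t

/-- The evaluation of `e` terminates, and its result and time have the property `Q`. -/
def W (F : List Expr) (E : List Val) (e : Expr) (Q : Val → ℕ → Prop) : Prop :=
  ∃ r t, Eval F E e r t ∧ Q r t

/-! ### Weakest preconditions for values and running times -/

section
variable {F : List Expr} {E : List Val} {Q : Val → ℕ → Prop}

/-- Evaluation is directed by syntax, so this rule and the following ones are equivalences, and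
rewriting with them executes a program symbolically. -/
theorem W_var {i : ℕ} : W F E (.var i) Q ↔ ∃ r, E[i]? = some r ∧ Q r 1 := by
  constructor
  · rintro ⟨r, t, h, hQ⟩
    cases h with
    | var h => exact ⟨_, h, hQ⟩
  · rintro ⟨r, h, hQ⟩
    exact ⟨_, _, .var h, hQ⟩

theorem W_var0 {a : Val} : W F (a :: E) (.var 0) Q ↔ Q a 1 := by simp [W_var]
theorem W_var1 {a b : Val} : W F (a :: b :: E) (.var 1) Q ↔ Q b 1 := by simp [W_var]
theorem W_var2 {a b c : Val} : W F (a :: b :: c :: E) (.var 2) Q ↔ Q c 1 := by simp [W_var]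
theorem W_var3 {a b c d : Val} : W F (a :: b :: c :: d :: E) (.var 3) Q ↔ Q d 1 := by
  simp [W_var]
theorem W_var4 {a b c d e : Val} : W F (a :: b :: c :: d :: e :: E) (.var 4) Q ↔ Q e 1 := by
  simp [W_var]
theorem W_var5 {a b c d e f : Val} :
    W F (a :: b :: c :: d :: e :: f :: E) (.var 5) Q ↔ Q f 1 := by
  simp [W_var]

theorem W_var6 {a b c d e f g : Val} :
    W F (a :: b :: c :: d :: e :: f :: g :: E) (.var 6) Q ↔ Q g 1 := by
  simp [W_var]
theorem W_var7 {a b c d e f g h : Val} :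
    W F (a :: b :: c :: d :: e :: f :: g :: h :: E) (.var 7) Q ↔ Q h 1 := by
  simp [W_var]

theorem W_const {c : ℝ} : W F E (.const c) Q ↔ Q (.num c) 1 := by
  constructor
  · rintro ⟨r, t, h, hQ⟩
    cases h
    exact hQ
  · exact fun h => ⟨_, _, .const, h⟩

theorem W_add {e₁ e₂ : Expr} : W F E (.add e₁ e₂) Q ↔
    W F E e₁ fun r s => r.OnNum fun x => W F E e₂ fun r t => r.OnNum fun y =>
      Q (.num (x + y)) (s + t + 1) := by
  constructor
  · rintro ⟨r, t, h, hQ⟩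
    cases h with
    | add h₁ h₂ => exact ⟨_, _, h₁, _, _, h₂, hQ⟩
  · rintro ⟨_ | _, s, h₁, H⟩
    · obtain ⟨_ | _, t, h₂, H⟩ := H
      · exact ⟨_, _, .add h₁ h₂, H⟩
      · exact H.elim
    · exact H.elim

theorem W_sub {e₁ e₂ : Expr} : W F E (.sub e₁ e₂) Q ↔
    W F E e₁ fun r s => r.OnNum fun x => W F E e₂ fun r t => r.OnNum fun y =>
      Q (.num (x - y)) (s + t + 1) := by
  constructor
  · rintro ⟨r, t, h, hQ⟩
    cases h with
    | sub h₁ h₂ => exact ⟨_, _, h₁, _, _, h₂, hQ⟩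
  · rintro ⟨_ | _, s, h₁, H⟩
    · obtain ⟨_ | _, t, h₂, H⟩ := H
      · exact ⟨_, _, .sub h₁ h₂, H⟩
      · exact H.elim
    · exact H.elim

theorem W_mul {e₁ e₂ : Expr} : W F E (.mul e₁ e₂) Q ↔
    W F E e₁ fun r s => r.OnNum fun x => W F E e₂ fun r t => r.OnNum fun y =>
      Q (.num (x * y)) (s + t + 1) := by
  constructor
  · rintro ⟨r, t, h, hQ⟩
    cases h with
    | mul h₁ h₂ => exact ⟨_, _, h₁, _, _, h₂, hQ⟩
  · rintro ⟨_ | _, s, h₁, H⟩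
    · obtain ⟨_ | _, t, h₂, H⟩ := H
      · exact ⟨_, _, .mul h₁ h₂, H⟩
      · exact H.elim
    · exact H.elim

theorem W_div {e₁ e₂ : Expr} : W F E (.div e₁ e₂) Q ↔
    W F E e₁ fun r s => r.OnNum fun x => W F E e₂ fun r t => r.OnNum fun y =>
      y ≠ 0 ∧ Q (.num (x / y)) (s + t + 1) := by
  constructor
  · rintro ⟨r, t, h, hQ⟩
    cases h with
    | div h₁ h₂ hy => exact ⟨_, _, h₁, _, _, h₂, hy, hQ⟩
  · rintro ⟨_ | _, s, h₁, H⟩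
    · obtain ⟨_ | _, t, h₂, H⟩ := H
      · exact ⟨_, _, .div h₁ h₂ H.1, H.2⟩
      · exact H.elim
    · exact H.elim

theorem W_sqrt {e : Expr} : W F E (.sqrt e) Q ↔
    W F E e fun r s => r.OnNum fun x => 0 ≤ x ∧ Q (.num (Real.sqrt x)) (s + 1) := by
  constructor
  · rintro ⟨r, t, h, hQ⟩
    cases h with
    | sqrt h hx => exact ⟨_, _, h, hx, hQ⟩
  · rintro ⟨_ | _, s, h, H⟩
    · exact ⟨_, _, .sqrt h H.1, H.2⟩
    · exact H.elim

theorem W_pair {e₁ e₂ : Expr} : W F E (.pair e₁ e₂) Q ↔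
    W F E e₁ fun a s => W F E e₂ fun b t => Q (.pair a b) (s + t + 1) := by
  constructor
  · rintro ⟨r, t, h, hQ⟩
    cases h with
    | pair h₁ h₂ => exact ⟨_, _, h₁, _, _, h₂, hQ⟩
  · rintro ⟨a, s, h₁, b, t, h₂, H⟩
    exact ⟨_, _, .pair h₁ h₂, H⟩

theorem W_fst {e : Expr} : W F E (.fst e) Q ↔
    W F E e fun r s => r.OnPair fun a _ => Q a (s + 1) := by
  constructor
  · rintro ⟨r, t, h, hQ⟩
    cases h with
    | fst h => exact ⟨_, _, h, hQ⟩
  · rintro ⟨_ | _, s, h, H⟩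
    · exact H.elim
    · exact ⟨_, _, .fst h, H⟩

theorem W_snd {e : Expr} : W F E (.snd e) Q ↔
    W F E e fun r s => r.OnPair fun _ b => Q b (s + 1) := by
  constructor
  · rintro ⟨r, t, h, hQ⟩
    cases h with
    | snd h => exact ⟨_, _, h, hQ⟩
  · rintro ⟨_ | _, s, h, H⟩
    · exact H.elim
    · exact ⟨_, _, .snd h, H⟩

theorem W_ifPos {c e₁ e₂ : Expr} : W F E (.ifPos c e₁ e₂) Q ↔
    W F E c fun r s => r.OnNum fun x =>
      if 0 < x then W F E e₁ fun r t => Q r (s + t + 1)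
      else W F E e₂ fun r t => Q r (s + t + 1) := by
  constructor
  · rintro ⟨r, t, h, hQ⟩
    cases h with
    | ifPos_true h hx h₁ => exact ⟨_, _, h, (if_pos hx).mpr ⟨_, _, h₁, hQ⟩⟩
    | ifPos_false h hx h₁ =>
      exact ⟨_, _, h, (if_neg hx.not_gt).mpr ⟨_, _, h₁, hQ⟩⟩
  · rintro ⟨_ | _, s, h, H⟩
    · change ite _ _ _ at H
      split_ifs at H with hx
      · obtain ⟨r, t, h₁, H⟩ := H
        exact ⟨_, _, .ifPos_true h hx h₁, H⟩
      · obtain ⟨r, t, h₁, H⟩ := H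
        exact ⟨_, _, .ifPos_false h (not_lt.1 hx) h₁, H⟩
    · exact H.elim

theorem W_ifPair {c e₁ e₂ : Expr} : W F E (.ifPair c e₁ e₂) Q ↔
    W F E c fun r s => bif r.isPair then W F E e₁ fun r t => Q r (s + t + 1)
      else W F E e₂ fun r t => Q r (s + t + 1) := by
  constructor
  · rintro ⟨r, t, h, hQ⟩
    cases h with
    | ifPair_true h h₁ => exact ⟨_, _, h, _, _, h₁, hQ⟩
    | ifPair_false h h₁ => exact ⟨_, _, h, _, _, h₁, hQ⟩
  · rintro ⟨_ | _, s, h, r, t, h₁, H⟩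
    · exact ⟨_, _, .ifPair_false h h₁, H⟩
    · exact ⟨_, _, .ifPair_true h h₁, H⟩

theorem W_letIn {e b : Expr} : W F E (.letIn e b) Q ↔
    W F E e fun a s => W F (a :: E) b fun r t => Q r (s + t + 1) := by
  constructor
  · rintro ⟨r, t, h, hQ⟩
    cases h with
    | letIn h₁ h₂ => exact ⟨_, _, h₁, _, _, h₂, hQ⟩
  · rintro ⟨a, s, h₁, b, t, h₂, H⟩
    exact ⟨_, _, .letIn h₁ h₂, H⟩

/-- Symbolic execution stops at a call; the remaining existential is discharged by `Fn.use`, with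
the lemma on the called function or the induction hypothesis. -/
theorem W_call {k : ℕ} {e : Expr} : W F E (.call k e) Q ↔
    W F E e fun a s => ∃ r t, Call F k a r t ∧ Q r (s + t + 1) := by
  constructor
  · rintro ⟨r, t, h, hQ⟩
    cases h with
    | call h₁ h₂ h₃ => exact ⟨_, _, h₂, _, _, ⟨_, h₁, h₃⟩, hQ⟩
  · rintro ⟨a, s, h₂, r, t, ⟨_, h₁, h₃⟩, H⟩
    exact ⟨_, _, .call h₁ h₂ h₃, H⟩

theorem onNum_num {x : ℝ} {P : ℝ → Prop} : (Val.num x).OnNum P ↔ P x := Iff.rfl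
theorem onPair_pair {a b : Val} {P : Val → Val → Prop} :
    (Val.pair a b).OnPair P ↔ P a b := Iff.rfl
theorem isPair_pair {a b : Val} : (Val.pair a b).isPair = true := rfl
theorem isPair_num {x : ℝ} : (Val.num x).isPair = false := rfl

theorem Fn.mono {k : ℕ} {a r : Val} {s t : ℕ} (h : Fn F k a r s) (hst : s ≤ t) : Fn F k a r t :=
  h.imp fun _ h => ⟨h.1.trans hst, h.2⟩

/-- Only an upper bound for the time of the call is kept, so costs are added as inequalities and
exact step counts are never needed. -/
theorem Fn.use {k : ℕ} {a r : Val} {T : ℕ} (h : Fn F k a r T) (H : ∀ t ≤ T, Q r t) :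
    ∃ r t, Call F k a r t ∧ Q r t := by
  obtain ⟨t, ht, h⟩ := h
  exact ⟨r, t, h, H t ht⟩

theorem Fn.of_W {k : ℕ} {a r : Val} {T : ℕ} {body : Expr} (hF : F[k]? = some body)
    (h : W F [a] body fun r' t => r' = r ∧ t ≤ T) : Fn F k a r T := by
  obtain ⟨_, t, h, rfl, ht⟩ := h
  exact ⟨t, ht, body, hF, h⟩

end

/-- The rules for all constructs of the language, as one set of rewriting rules. -/
theorem wp :
    type_of% @W_var0 ∧ type_of% @W_var1 ∧ type_of% @W_var2 ∧ type_of% @W_var3 ∧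
    type_of% @W_var4 ∧ type_of% @W_var5 ∧ type_of% @W_var6 ∧ type_of% @W_var7 ∧
    type_of% @W_const ∧ type_of% @W_add ∧ type_of% @W_sub ∧ type_of% @W_mul ∧ type_of% @W_div ∧
    type_of% @W_sqrt ∧ type_of% @W_pair ∧ type_of% @W_fst ∧ type_of% @W_snd ∧ type_of% @W_ifPos ∧
    type_of% @W_ifPair ∧ type_of% @W_letIn ∧ type_of% @W_call ∧ type_of% @onNum_num ∧
    type_of% @onPair_pair ∧ type_of% @isPair_pair ∧ type_of% @isPair_num :=
  ⟨W_var0, W_var1, W_var2, W_var3, W_var4, W_var5, W_var6, W_var7, W_const, W_add, W_sub, W_mul,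
    W_div, W_sqrt, W_pair, W_fst, W_snd, W_ifPos, W_ifPair, W_letIn, W_call, onNum_num,
    onPair_pair, isPair_pair, isPair_num⟩

/-! ### Perfect binary trees as data -/

/-- The perfect binary tree of depth `k` with the leaves `g 0, …, g (2 ^ k - 1)`. -/
def treeVal : ℕ → (ℕ → Val) → Val
  | 0, g => g 0
  | k + 1, g => .pair (treeVal k g) (treeVal k fun i => g (i + 2 ^ k))

/-- A complex number as data. -/
noncomputable def cVal (z : ℂ) : Val := .pair (.num z.re) (.num z.im)

/-- The first `2 ^ k` terms of a complex sequence, as a perfect binary tree. -/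
noncomputable def seqVal (k : ℕ) (a : ℕ → ℂ) : Val := treeVal k fun i => cVal (a i)

theorem cVal_neg (z : ℂ) : cVal (-z) = .pair (.num (0 - z.re)) (.num (0 - z.im)) := by
  simp [cVal]

theorem treeVal_congr {k : ℕ} {g h : ℕ → Val} (H : ∀ i < 2 ^ k, g i = h i) :
    treeVal k g = treeVal k h := by
  induction k generalizing g h with
  | zero => exact H 0 (by simp)
  | succ k ih =>
    rw [treeVal, treeVal, ih fun i hi => H i (by rw [pow_succ]; omega),
      ih fun i hi => H (i + 2 ^ k) (by rw [pow_succ]; omega)]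

theorem seqVal_congr {k : ℕ} {a b : ℕ → ℂ} (H : ∀ i < 2 ^ k, a i = b i) :
    seqVal k a = seqVal k b :=
  treeVal_congr fun i hi => by rw [H i hi]

theorem seqVal_zero (a : ℕ → ℂ) : seqVal 0 a = .pair (.num (a 0).re) (.num (a 0).im) := rfl

theorem seqVal_succ (k : ℕ) (a : ℕ → ℂ) :
    seqVal (k + 1) a = .pair (seqVal k a) (seqVal k fun i => a (i + 2 ^ k)) := rfl

/-- A complex number is itself a pair; this is why the sequence programs recognise a leaf by its
first component being a number. -/
theorem isPair_seqVal (k : ℕ) (a : ℕ → ℂ) : (seqVal k a).isPair = true := by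
  cases k <;> rfl

/-- Every function of the list `A` occurs in `F` at the same place. -/
def Extends (A F : List Expr) : Prop := ∀ (i : ℕ) (b : Expr), A[i]? = some b → F[i]? = some b

namespace Expr

/-- The argument of a function. -/
abbrev arg : Expr := var 0

/-! ### Arithmetic of sequences -/

/-- `(α, (β, (a, b))) ↦ α a + β b` for sequences `a` and `b`. -/
noncomputable def linBody : Expr :=
  ifPair (fst (fst (snd (snd arg))))
    (pair (call 0 (pair (fst arg) (pair (fst (snd arg))
        (pair (fst (fst (snd (snd arg)))) (fst (snd (snd (snd arg))))))))
      (call 0 (pair (fst arg) (pair (fst (snd arg))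
        (pair (snd (fst (snd (snd arg)))) (snd (snd (snd (snd arg)))))))))
    (letIn (fst arg) (letIn (fst (snd (var 1))) (letIn (fst (snd (snd (var 2))))
      (letIn (snd (snd (snd (var 3))))
        (pair
          (add (sub (mul (fst (var 3)) (fst (var 1))) (mul (snd (var 3)) (snd (var 1))))
            (sub (mul (fst (var 2)) (fst (var 0))) (mul (snd (var 2)) (snd (var 0)))))
          (add (add (mul (fst (var 3)) (snd (var 1))) (mul (snd (var 3)) (fst (var 1))))
            (add (mul (fst (var 2)) (snd (var 0))) (mul (snd (var 2)) (fst (var 0))))))))))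

/-- A complex constant. -/
noncomputable def cconst (z : ℂ) : Expr := pair (const z.re) (const z.im)

/-- `α a + β b`. -/
noncomputable def lin (α β a b : Expr) : Expr := call 0 (pair α (pair β (pair a b)))

/-- A square root of a complex number of absolute value `1`. -/
noncomputable def csqrtBody : Expr :=
  letIn (sqrt (mul (add (const 1) (fst arg)) (const (1 / 2))))
    (letIn (sqrt (mul (sub (const 1) (fst (var 1))) (const (1 / 2))))
      (ifPos (snd (var 2)) (pair (var 1) (var 0)) (pair (var 1) (sub (const 0) (var 0)))))

/-- `(c, (a, b)) ↦ a * b` for polynomials `a` and `b` modulo `X ^ 2 ^ k - c`, where `|c| = 1`. -/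
noncomputable def mulModBody : Expr :=
  ifPair (fst (fst (snd arg)))
    (letIn (call 1 (fst arg))
      (letIn (call 2 (pair (var 0) (pair
          (lin (cconst 1) (var 0) (fst (fst (snd (var 1)))) (snd (fst (snd (var 1)))))
          (lin (cconst 1) (var 0) (fst (snd (snd (var 1)))) (snd (snd (snd (var 1))))))))
        (letIn (pair (sub (const 0) (fst (var 1))) (sub (const 0) (snd (var 1))))
          (letIn (call 2 (pair (var 0) (pair
              (lin (cconst 1) (var 0) (fst (fst (snd (var 3)))) (snd (fst (snd (var 3)))))
              (lin (cconst 1) (var 0) (fst (snd (snd (var 3)))) (snd (snd (snd (var 3))))))))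
            (pair (lin (cconst (1 / 2)) (cconst (1 / 2)) (var 2) (var 0))
              (letIn (pair (mul (const (1 / 2)) (fst (var 3))) (mul (const (-1 / 2)) (snd (var 3))))
                (letIn (pair (sub (const 0) (fst (var 0))) (sub (const 0) (snd (var 0))))
                  (lin (var 1) (var 0) (var 4) (var 2)))))))))
    (pair (sub (mul (fst (fst (snd arg))) (fst (snd (snd arg))))
        (mul (snd (fst (snd arg))) (snd (snd (snd arg)))))
      (add (mul (fst (fst (snd arg))) (snd (snd (snd arg))))
        (mul (snd (fst (snd arg))) (fst (snd (snd arg))))))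

/-- The product of two polynomials. -/
noncomputable def mulBody : Expr :=
  letIn (lin (cconst 0) (cconst 0) (fst arg) (fst arg))
    (call 2 (pair (cconst 1) (pair (pair (fst (var 1)) (var 0)) (pair (snd (var 1)) (var 0)))))

/-- The inverse of a power series with constant coefficient `1`. -/
noncomputable def invBody : Expr :=
  ifPair (fst arg)
    (letIn (call 4 (fst arg))
      (letIn (lin (cconst 1) (cconst 1) (snd (call 3 (pair (fst (var 1)) (var 0))))
          (fst (call 3 (pair (snd (var 1)) (var 0)))))
        (letIn (fst (call 3 (pair (var 0) (var 1))))
          (pair (var 2) (lin (cconst (-1)) (cconst 0) (var 0) (var 0))))))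
    (cconst 1)

/-- A finite sequence in reverse order. -/
noncomputable def revBody : Expr :=
  ifPair (fst arg) (pair (call 5 (snd arg)) (call 5 (fst arg))) arg

/-- The functions for the arithmetic of sequences. -/
noncomputable def seqFuns : List Expr :=
  [linBody, csqrtBody, mulModBody, mulBody, invBody, revBody]

end Expr

open Expr

/-! ### Correctness and cost of linear combinations, square roots and modular products -/

section
variable {F : List Expr} (hF : Extends seqFuns F)
include hF

/-- The term -150 pays for the overhead: doubling the bound gives 300 * 2 ^ (k + 1) - 300, which
leaves 150 steps for the node itself. -/
theorem fn_lin (k : ℕ) (α β : ℂ) (a b : ℕ → ℂ) :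
    Fn F 0 (.pair (cVal α) (.pair (cVal β) (.pair (seqVal k a) (seqVal k b))))
      (seqVal k fun i => α * a i + β * b i) (300 * 2 ^ k - 150) := by
  induction k generalizing a b with
  | zero =>
    refine Fn.of_W (hF 0 linBody rfl) ?_
    simp only [wp, linBody, cVal, seqVal_zero]
    constructor
    · congr 2
    · norm_num
  | succ k ih =>
    refine Fn.of_W (hF 0 linBody rfl) ?_
    simp only [wp, linBody, seqVal_succ, isPair_seqVal]
    refine (ih _ _).use fun t₁ h₁ => (ih _ _).use fun t₂ h₂ => ⟨rfl, ?_⟩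
    have := Nat.one_le_two_pow (n := k)
    rw [pow_succ]
    omega

/-- Half-angle formulas: the real and imaginary parts of s are square roots of (1 ± re c) / 2, with
the sign of im c on the second. Their product is |im c| / 2 because |c| = 1. The root again has
absolute value 1, so the recursion stays on the unit circle. -/
theorem fn_csqrt (c : ℂ) (hc : Complex.normSq c = 1) :
    ∃ s, s ^ 2 = c ∧ Complex.normSq s = 1 ∧ Fn F 1 (cVal c) (cVal s) 40 := by
  rw [Complex.normSq_apply] at hc
  have h₁ : 0 ≤ (1 + c.re) * (1 / 2) := by nlinarith [mul_self_nonneg c.im]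
  have h₂ : 0 ≤ (1 - c.re) * (1 / 2) := by nlinarith [mul_self_nonneg c.im]
  have hm : √((1 + c.re) * (1 / 2)) * √((1 - c.re) * (1 / 2)) = |c.im| / 2 := by
    rw [← Real.sqrt_mul h₁, ← Real.sqrt_sq (show 0 ≤ |c.im| / 2 by positivity), div_pow, sq_abs]
    congr 1
    linarith
  have hs₁ := Real.mul_self_sqrt h₁
  have hs₂ := Real.mul_self_sqrt h₂
  by_cases hy : 0 < c.im
  · refine ⟨⟨√((1 + c.re) * (1 / 2)), √((1 - c.re) * (1 / 2))⟩, ?_, ?_, ?_⟩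
    · rw [abs_of_pos hy] at hm
      apply Complex.ext
      · rw [pow_two, Complex.mul_re]
        linarith
      · rw [pow_two, Complex.mul_im]
        linarith
    · rw [Complex.normSq_apply]
      linarith
    · refine Fn.of_W (hF 1 csqrtBody rfl) ?_
      simp only [wp, csqrtBody, cVal, if_pos hy]
      exact ⟨h₁, h₂, trivial, by norm_num⟩
  · refine ⟨⟨√((1 + c.re) * (1 / 2)), 0 - √((1 - c.re) * (1 / 2))⟩, ?_, ?_, ?_⟩
    · rw [abs_of_nonpos (not_lt.1 hy)] at hm
      apply Complex.ext
      · rw [pow_two, Complex.mul_re]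
        linarith
      · rw [pow_two, Complex.mul_im]
        linarith
    · rw [Complex.normSq_apply]
      linarith
    · refine Fn.of_W (hF 1 csqrtBody rfl) ?_
      simp only [wp, csqrtBody, cVal, if_neg hy]
      exact ⟨h₁, h₂, trivial, by norm_num⟩

/-- The recursive function computes products of polynomials modulo `X ^ 2 ^ k - c`. -/
theorem fn_mulMod (k : ℕ) (c : ℂ) (hc : Complex.normSq c = 1) (a b : ℕ → ℂ) :
    ∃ r : ℕ → ℂ, (∀ z : ℂ, z ^ 2 ^ k = c → ∑ i ∈ Finset.range (2 ^ k), r i * z ^ i =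
        (∑ i ∈ Finset.range (2 ^ k), a i * z ^ i) * ∑ i ∈ Finset.range (2 ^ k), b i * z ^ i) ∧
      Fn F 2 (.pair (cVal c) (.pair (seqVal k a) (seqVal k b))) (seqVal k r)
        (1000 * (k + 1) * 2 ^ k - 400) := by
  -- Only values at the roots of X ^ 2 ^ k - c are tracked, not a congruence of polynomials; for c =
  -- 1 these values determine the product.
  induction k generalizing a b c with
  | zero =>
    refine ⟨fun _ => a 0 * b 0, by simp, ?_⟩
    refine Fn.of_W (hF 2 mulModBody rfl) ?_
    simp only [wp, mulModBody, seqVal_zero, cVal]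
    constructor
    · rw [Complex.mul_re, Complex.mul_im]
    · norm_num
  | succ k ih =>
    obtain ⟨s, hs, hn, hsq⟩ := fn_csqrt hF c hc
    have hs0 : s ≠ 0 := by
      rintro rfl
      simp at hn
    -- Since X ^ 2 ^ k = s in this factor, reduction adds s times the upper half of the coefficients
    -- to the lower half; the factor 1 is the first coefficient given to `lin`.
    obtain ⟨A, hA, fA⟩ := ih s hn (fun i => 1 * a i + s * a (i + 2 ^ k))
      (fun i => 1 * b i + s * b (i + 2 ^ k))
    obtain ⟨B, hB, fB⟩ := ih (-s) (by rw [Complex.normSq_neg, hn])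
      (fun i => 1 * a i + (-s) * a (i + 2 ^ k)) (fun i => 1 * b i + (-s) * b (i + 2 ^ k))
    -- As |s| = 1, the inverse of 2s is half the conjugate of s, which the program gets without a
    -- complex division.
    have hinv : cVal (1 / (2 * s)) = .pair (.num (1 / 2 * s.re)) (.num (-1 / 2 * s.im)) := by
      have : 1 / (2 * s) = (1 / 2 : ℝ) * (starRingEnd ℂ) s := by
        have : s * (starRingEnd ℂ) s = 1 := by rw [Complex.mul_conj, hn, Complex.ofReal_one]
        rw [div_eq_iff (by simpa using hs0)]
        push_cast
        linear_combination -this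
      rw [this, cVal, Complex.re_ofReal_mul, Complex.im_ofReal_mul]
      simp
      ring
    have hinv' : cVal (-(1 / (2 * s))) =
        .pair (.num (0 - 1 / 2 * s.re)) (.num (0 - -1 / 2 * s.im)) := by
      rw [cVal, Val.pair.injEq, Val.num.injEq, Val.num.injEq] at hinv
      rw [cVal_neg, hinv.1, hinv.2]
    -- Chinese remaindering: the lower half is (A + B) / 2 and the upper half is (A - B) / (2s).
    refine ⟨fun i => if i < 2 ^ k then 1 / 2 * A i + 1 / 2 * B i else
      1 / (2 * s) * A (i - 2 ^ k) + -(1 / (2 * s)) * B (i - 2 ^ k), ?_, ?_⟩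
    · intro z hz
      have split : ∀ f : ℕ → ℂ, ∑ i ∈ Finset.range (2 ^ (k + 1)), f i * z ^ i =
          ∑ i ∈ Finset.range (2 ^ k), (f i + z ^ 2 ^ k * f (i + 2 ^ k)) * z ^ i := by
        intro f
        rw [pow_succ, mul_two, Finset.sum_range_add, ← Finset.sum_add_distrib]
        refine Finset.sum_congr rfl fun i _ => ?_
        rw [add_comm (2 ^ k) i, pow_add]
        ring
      -- A root belongs to one of the two factors, and there the recombined polynomial takes the
      -- value of A or of B.
      have hz' : z ^ 2 ^ k = s ∨ z ^ 2 ^ k = -s := by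
        rw [← sq_eq_sq_iff_eq_or_eq_neg, hs, ← hz, ← pow_mul, pow_succ]
      rw [split, split, split]
      rcases hz' with h | h
      · have := hA z h
        simp only [one_mul] at this
        rw [h, ← this]
        refine Finset.sum_congr rfl fun i hi => ?_
        rw [if_pos (Finset.mem_range.1 hi), if_neg (by omega), Nat.add_sub_cancel]
        field_simp
        ring
      · have := hB z h
        simp only [one_mul] at this
        rw [h, ← this]
        refine Finset.sum_congr rfl fun i hi => ?_
        rw [if_pos (Finset.mem_range.1 hi), if_neg (by omega), Nat.add_sub_cancel]
        field_simp
        ring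
    · refine Fn.of_W (hF 2 mulModBody rfl) ?_
      simp only [wp, mulModBody, lin, cconst, seqVal_succ, isPair_seqVal]
      refine hsq.use fun t₁ h₁ => (fn_lin hF k 1 s _ _).use fun t₂ h₂ =>
        (fn_lin hF k 1 s _ _).use fun t₃ h₃ => fA.use fun t₄ h₄ => ?_
      simp only [wp, cVal]
      simp only [← cVal_neg]
      refine (fn_lin hF k 1 (-s) _ _).use fun t₅ h₅ =>
        (fn_lin hF k 1 (-s) _ _).use fun t₆ h₆ => fB.use fun t₇ h₇ =>
        (fn_lin hF k (1 / 2) (1 / 2) _ _).use fun t₈ h₈ => ?_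
      simp only [← hinv, ← hinv']
      refine (fn_lin hF k _ _ _ _).use fun t₉ h₉ => ⟨?_, ?_⟩
      · congr 1
        · refine seqVal_congr fun i hi => ?_
          rw [if_pos hi]
        · refine seqVal_congr fun i hi => ?_
          rw [if_neg (by omega), Nat.add_sub_cancel]
      · have := Nat.one_le_two_pow (n := k)
        have e₁ : 1000 * (k + 1) * 2 ^ k = 1000 * (k * 2 ^ k) + 1000 * 2 ^ k := by ring
        -- Compared with two recursive calls there are 2000 * 2 ^ k steps to spare, enough for six
        -- linear combinations of 300 * 2 ^ k steps.
        have e₂ : 1000 * (k + 1 + 1) * 2 ^ (k + 1) = 2000 * (k * 2 ^ k) + 4000 * 2 ^ k := by ring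
        rw [e₁] at h₄ h₇
        rw [e₂]
        omega

end

/-! ### Products and inverses of sequences -/

open Polynomial in
/-- The polynomial with the coefficients `a 0, …, a (2 ^ k - 1)`. -/
noncomputable def truncPoly (k : ℕ) (a : ℕ → ℂ) : ℂ[X] :=
  ∑ i ∈ Finset.range (2 ^ k), monomial i (a i)

theorem coeff_truncPoly (k : ℕ) (a : ℕ → ℂ) (n : ℕ) :
    (truncPoly k a).coeff n = if n < 2 ^ k then a n else 0 := by
  simp [truncPoly, Polynomial.finsetSum_coeff, Polynomial.coeff_monomial]

theorem truncPoly_coeff {k : ℕ} {A : Polynomial ℂ} (hA : A.natDegree < 2 ^ k) :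
    truncPoly k A.coeff = A := by
  ext n
  rw [coeff_truncPoly]
  split_ifs with h
  · rfl
  · rw [Polynomial.coeff_eq_zero_of_natDegree_lt (by omega)]

theorem natDegree_truncPoly_lt (k : ℕ) (a : ℕ → ℂ) : (truncPoly k a).natDegree < 2 ^ k := by
  have h : (truncPoly k a).natDegree ≤ 2 ^ k - 1 := by
    rw [Polynomial.natDegree_le_iff_coeff_eq_zero]
    intro n hn
    rw [coeff_truncPoly, if_neg (by omega)]
  have := Nat.one_le_two_pow (n := k)
  omega

theorem eval_truncPoly (k : ℕ) (a : ℕ → ℂ) (z : ℂ) :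
    (truncPoly k a).eval z = ∑ i ∈ Finset.range (2 ^ k), a i * z ^ i := by
  simp [truncPoly, Polynomial.eval_finsetSum]

/-- The n-th roots of unity are n distinct points, more than the degree of the difference. -/
theorem eq_of_eval_roots_of_unity {n : ℕ} (hn : n ≠ 0) {A B : Polynomial ℂ}
    (hA : A.natDegree < n) (hB : B.natDegree < n) (H : ∀ z : ℂ, z ^ n = 1 → A.eval z = B.eval z) :
    A = B := by
  have hcard := (Complex.isPrimitiveRoot_exp n hn).card_nthRootsFinset
  rw [← sub_eq_zero]
  refine Polynomial.eq_zero_of_natDegree_lt_card_of_eval_eq_zero' _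
    (Polynomial.nthRootsFinset n (1 : ℂ)) (fun z hz => ?_) ?_
  · rw [Polynomial.eval_sub, H z ((Polynomial.mem_nthRootsFinset (by omega) _).1 hz), sub_self]
  · rw [hcard]
    exact (Polynomial.natDegree_sub_le _ _).trans_lt (max_lt hA hB)

open Polynomial in
-- Write h = 2 ^ k, a = A₀ + X^h A₁ and g = g₀ + X^h g₁. If A₀ g₀ = 1 + X^h U, then a g ≡ 1 modulo
-- X^(2h) says U + A₁ g₀ + A₀ g₁ ≡ 0 modulo X^h. Multiplying by g₀, which inverts A₀ there, gives g₁
-- ≡ -(U + A₁ g₀) g₀.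
theorem newton_step {k : ℕ} {a g : ℕ → ℂ}
    (H : (X : ℂ[X]) ^ 2 ^ (k + 1) ∣ truncPoly (k + 1) a * truncPoly (k + 1) g - 1) {n : ℕ}
    (hn : n < 2 ^ k) :
    g (n + 2 ^ k) = -(truncPoly k (fun i =>
      (truncPoly k a * truncPoly k g).coeff (i + 2 ^ k) +
        (truncPoly k (fun i => a (i + 2 ^ k)) * truncPoly k g).coeff i) *
      truncPoly k g).coeff n := by
  have split : ∀ b : ℕ → ℂ, truncPoly (k + 1) b =
      truncPoly k b + X ^ 2 ^ k * truncPoly k (fun i => b (i + 2 ^ k)) := by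
    intro b
    ext n
    rw [coeff_add, coeff_X_pow_mul', coeff_truncPoly, coeff_truncPoly, coeff_truncPoly, pow_succ]
    by_cases h : 2 ^ k ≤ n
    · rw [if_pos h, if_neg (not_lt.2 h), zero_add, Nat.sub_add_cancel h]
      exact if_congr (by omega) rfl rfl
    · rw [if_neg h, if_pos (not_le.1 h), if_pos (by omega), add_zero]
  rw [split, split, pow_succ, mul_two, pow_add] at H
  set A₀ := truncPoly k a
  set A₁ := truncPoly k (fun i => a (i + 2 ^ k))
  set g₀ := truncPoly k g
  set g₁ := truncPoly k (fun i => g (i + 2 ^ k)) with hg₁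
  have h1 : (X : ℂ[X]) ^ 2 ^ k ∣ A₀ * g₀ - 1 := by
    have := (dvd_mul_right ((X : ℂ[X]) ^ 2 ^ k) _).trans H
    rw [← dvd_sub_left (dvd_mul_right _ (A₀ * g₁ + A₁ * g₀ + X ^ 2 ^ k * (A₁ * g₁)))] at this
    convert this using 1
    ring
  obtain ⟨U, hU⟩ := h1
  have h2 : (X : ℂ[X]) ^ 2 ^ k ∣ U + A₁ * g₀ + A₀ * g₁ := by
    have h0 : (X : ℂ[X]) ^ 2 ^ k ≠ 0 := pow_ne_zero _ X_ne_zero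
    have e : (A₀ + X ^ 2 ^ k * A₁) * (g₀ + X ^ 2 ^ k * g₁) - 1 =
        X ^ 2 ^ k * ((U + A₁ * g₀ + A₀ * g₁) + X ^ 2 ^ k * (A₁ * g₁)) := by
      linear_combination hU
    rw [e, mul_dvd_mul_iff_left h0] at H
    exact (dvd_add_left (dvd_mul_right _ _)).1 H
  have h3 : (X : ℂ[X]) ^ 2 ^ k ∣ (U + A₁ * g₀) * g₀ + g₁ := by
    have e : (U + A₁ * g₀) * g₀ + g₁ =
        g₀ * (U + A₁ * g₀ + A₀ * g₁) - X ^ 2 ^ k * (U * g₁) := by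
      linear_combination -g₁ * hU
    rw [e]
    exact dvd_sub (h2.mul_left _) (dvd_mul_right _ _)
  set V := truncPoly k (fun i => (A₀ * g₀).coeff (i + 2 ^ k) + (A₁ * g₀).coeff i) with hV
  -- Modulo X^h the polynomial U may be read off as the upper half of A₀ g₀, because the constant 1
  -- has no coefficient there.
  have h4 : (X : ℂ[X]) ^ 2 ^ k ∣ U + A₁ * g₀ - V := by
    rw [X_pow_dvd_iff]
    intro i hi
    rw [coeff_sub, coeff_add, hV, coeff_truncPoly, if_pos hi, eq_add_of_sub_eq hU, coeff_add,
      coeff_X_pow_mul, coeff_one, if_neg (by have := Nat.one_le_two_pow (n := k); omega)]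
    ring
  have h5 : (X : ℂ[X]) ^ 2 ^ k ∣ V * g₀ + g₁ := by
    have e : V * g₀ + g₁ = (U + A₁ * g₀) * g₀ + g₁ - (U + A₁ * g₀ - V) * g₀ := by ring
    rw [e]
    exact dvd_sub h3 (h4.mul_right _)
  have h6 := X_pow_dvd_iff.1 h5 n hn
  rw [coeff_add, hg₁, coeff_truncPoly, if_pos hn] at h6
  exact eq_neg_of_add_eq_zero_right h6

open PowerSeries in
-- Coefficients below 2 ^ k do not see the truncation of the factors.
theorem coeff_truncPoly_mul {k n : ℕ} (hn : n < 2 ^ k) (a b : ℕ → ℂ) :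
    (truncPoly k a * truncPoly k b).coeff n = coeff n (mk a * mk b) := by
  rw [Polynomial.coeff_mul, coeff_mul]
  refine Finset.sum_congr rfl fun x hx => ?_
  rw [Finset.HasAntidiagonal.mem_antidiagonal] at hx
  rw [coeff_truncPoly, coeff_truncPoly, coeff_mk, coeff_mk, if_pos (by omega), if_pos (by omega)]

/-- The coefficients of the inverse of the power series with the coefficients `a`. -/
noncomputable def invSeq (a : ℕ → ℂ) (n : ℕ) : ℂ := PowerSeries.coeff n (PowerSeries.mk a)⁻¹

theorem mk_mul_mk_invSeq {a : ℕ → ℂ} (ha : a 0 = 1) :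
    PowerSeries.mk a * PowerSeries.mk (invSeq a) = 1 := by
  have : PowerSeries.mk (invSeq a) = (PowerSeries.mk a)⁻¹ := by
    ext n
    rw [PowerSeries.coeff_mk, invSeq]
  rw [this, PowerSeries.mul_inv_cancel _ (by simp [ha])]

theorem invSeq_zero {a : ℕ → ℂ} (ha : a 0 = 1) : invSeq a 0 = 1 := by
  simp [invSeq, ha]

/-! ### Correctness and cost of products, inverses and reversal -/

section
variable {F : List Expr} (hF : Extends seqFuns F)
include hF

/-- Padding to length 2 ^ (k + 1) leaves no wrap-around modulo X ^ 2 ^ (k + 1) - 1, so the cyclic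
product is the true one. -/
theorem fn_mul (k : ℕ) (a b : ℕ → ℂ) :
    Fn F 3 (.pair (seqVal k a) (seqVal k b))
      (seqVal (k + 1) (truncPoly k a * truncPoly k b).coeff) (5000 * (k + 1) * 2 ^ k) := by
  -- The program makes the zero padding as 0 * a + 0 * a, which yields a tree of zeros of the right
  -- shape.
  have pad : ∀ c : ℕ → ℂ, seqVal (k + 1) (truncPoly k c).coeff =
      .pair (seqVal k c) (seqVal k fun i => 0 * a i + 0 * a i) := by
    intro c
    rw [seqVal_succ]
    congr 1
    · refine seqVal_congr fun i hi => ?_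
      rw [coeff_truncPoly, if_pos hi]
    · refine seqVal_congr fun i hi => ?_
      rw [coeff_truncPoly, if_neg (by omega)]
      ring
  obtain ⟨r, hr, fr⟩ := fn_mulMod hF (k + 1) 1 (by simp) (truncPoly k a).coeff (truncPoly k b).coeff
  have hlt : ∀ c, (truncPoly k c).natDegree < 2 ^ (k + 1) := fun c =>
    (natDegree_truncPoly_lt k c).trans_le (by rw [pow_succ]; omega)
  have hr' : truncPoly (k + 1) r = truncPoly k a * truncPoly k b := by
    refine eq_of_eval_roots_of_unity (by positivity) (natDegree_truncPoly_lt _ _) ?_ ?_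
    · refine Polynomial.natDegree_mul_le.trans_lt ?_
      have h₁ := natDegree_truncPoly_lt k a
      have h₂ := natDegree_truncPoly_lt k b
      rw [pow_succ]
      omega
    · intro z hz
      rw [eval_truncPoly, hr z hz, ← eval_truncPoly, ← eval_truncPoly, Polynomial.eval_mul,
        truncPoly_coeff (hlt a), truncPoly_coeff (hlt b)]
  have hr'' : seqVal (k + 1) r = seqVal (k + 1) (truncPoly k a * truncPoly k b).coeff := by
    rw [← hr']
    refine seqVal_congr fun i hi => ?_
    rw [coeff_truncPoly, if_pos hi]
  rw [← hr'']
  rw [pad, pad] at fr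
  refine Fn.of_W (hF 3 mulBody rfl) ?_
  simp only [wp, mulBody, lin, cconst]
  refine (fn_lin hF k 0 0 _ _).use fun t₁ h₁ => fr.use fun t₂ h₂ => ⟨rfl, ?_⟩
  have := Nat.one_le_two_pow (n := k)
  have e₁ : 1000 * (k + 1 + 1) * 2 ^ (k + 1) = 2000 * (k * 2 ^ k) + 4000 * 2 ^ k := by ring
  have e₂ : 5000 * (k + 1) * 2 ^ k = 5000 * (k * 2 ^ k) + 5000 * 2 ^ k := by ring
  rw [e₁] at h₂
  rw [e₂]
  omega

theorem fn_mul_poly {k : ℕ} {A B : Polynomial ℂ} (hA : A.natDegree < 2 ^ k)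
    (hB : B.natDegree < 2 ^ k) :
    Fn F 3 (.pair (seqVal k A.coeff) (seqVal k B.coeff)) (seqVal (k + 1) (A * B).coeff)
      (5000 * (k + 1) * 2 ^ k) := by
  have := fn_mul hF k A.coeff B.coeff
  rwa [truncPoly_coeff hA, truncPoly_coeff hB] at this

/-- Each doubling of the precision costs three products of the current length; these costs grow
geometrically, so there is no second logarithm. -/
theorem fn_inv (k : ℕ) (a : ℕ → ℂ) (ha : a 0 = 1) :
    Fn F 4 (seqVal k a) (seqVal k (invSeq a)) (20000 * (k + 1) * 2 ^ k) := by
  induction k with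
  | zero =>
    refine Fn.of_W (hF 4 invBody rfl) ?_
    simp only [wp, invBody, seqVal_zero, cconst, invSeq_zero ha]
    exact ⟨trivial, by norm_num⟩
  | succ k ih =>
    refine Fn.of_W (hF 4 invBody rfl) ?_
    simp only [wp, invBody, seqVal_succ, isPair_seqVal, lin, cconst]
    refine ih.use fun t₁ h₁ => (fn_mul hF k _ _).use fun t₂ h₂ => ?_
    simp only [wp, seqVal_succ]
    refine (fn_mul hF k _ _).use fun t₃ h₃ => ?_
    simp only [wp, seqVal_succ]
    refine (fn_lin hF k 1 1 _ _).use fun t₄ h₄ => (fn_mul hF k _ _).use fun t₅ h₅ => ?_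
    simp only [wp, seqVal_succ]
    refine (fn_lin hF k (-1) 0 _ _).use fun t₆ h₆ => ⟨?_, ?_⟩
    · congr 1
      refine seqVal_congr fun n hn => ?_
      rw [newton_step (k := k) (a := a) (g := invSeq a) ?_ hn]
      · simp only [one_mul, neg_mul, zero_mul, add_zero]
      · rw [Polynomial.X_pow_dvd_iff]
        intro i hi
        rw [Polynomial.coeff_sub, coeff_truncPoly_mul hi, mk_mul_mk_invSeq ha]
        simp [PowerSeries.coeff_one, Polynomial.coeff_one]
    · have := Nat.one_le_two_pow (n := k)
      have e₁ : 5000 * (k + 1) * 2 ^ k = 5000 * (k * 2 ^ k) + 5000 * 2 ^ k := by ring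
      have e₂ : 20000 * (k + 1) * 2 ^ k = 20000 * (k * 2 ^ k) + 20000 * 2 ^ k := by ring
      have e₃ : 20000 * (k + 1 + 1) * 2 ^ (k + 1) = 40000 * (k * 2 ^ k) + 80000 * 2 ^ k := by ring
      rw [e₁] at h₂ h₃ h₅
      rw [e₂] at h₁
      rw [e₃]
      omega

theorem fn_rev (k : ℕ) (a : ℕ → ℂ) :
    Fn F 5 (seqVal k a) (seqVal k fun i => a (2 ^ k - 1 - i)) (20 * 2 ^ k - 10) := by
  induction k generalizing a with
  | zero =>
    refine Fn.of_W (hF 5 revBody rfl) ?_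
    simp only [wp, revBody, seqVal_zero]
    exact ⟨rfl, by norm_num⟩
  | succ k ih =>
    refine Fn.of_W (hF 5 revBody rfl) ?_
    simp only [wp, revBody, seqVal_succ, isPair_seqVal]
    refine (ih _).use fun t₁ h₁ => (ih _).use fun t₂ h₂ => ⟨?_, ?_⟩
    · congr 1
      · refine seqVal_congr fun n hn => ?_
        congr 1
        rw [pow_succ]
        omega
      · refine seqVal_congr fun n hn => ?_
        congr 1
        rw [pow_succ]
        omega
    · have := Nat.one_le_two_pow (n := k)
      rw [pow_succ]
      omega

end

open Polynomial

/-! ### Polynomials acting on sequences by the shift -/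

/-- The shift of sequences. -/
noncomputable def shift : Module.End ℂ (ℕ → ℂ) where
  toFun u n := u (n + 1)
  map_add' _ _ := rfl
  map_smul' _ _ := rfl

theorem shift_pow_apply (i : ℕ) (u : ℕ → ℂ) (n : ℕ) : (shift ^ i) u n = u (n + i) := by
  induction i generalizing n with
  | zero => rfl
  | succ i ih =>
    rw [pow_succ', Module.End.mul_apply]
    change (shift ^ i) u (n + 1) = _
    rw [ih, add_right_comm, add_assoc]

theorem aeval_shift_apply {M : ℂ[X]} {N : ℕ} (hM : M.natDegree < N) (u : ℕ → ℂ) (n : ℕ) :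
    aeval shift M u n = ∑ i ∈ Finset.range N, M.coeff i * u (n + i) := by
  rw [aeval_eq_sum_range' hM, LinearMap.sum_apply, Finset.sum_apply]
  refine Finset.sum_congr rfl fun i _ => ?_
  rw [LinearMap.smul_apply, Pi.smul_apply, shift_pow_apply, smul_eq_mul]

/-- Geometric sequences are the eigenvectors of the shift, and a polynomial in an operator acts on
an eigenvector by its value at the eigenvalue. -/
theorem aeval_shift_of_geometric {w : ℕ → ℂ} {x : ℂ} (h : shift w = x • w) (P : ℂ[X]) :
    aeval shift P w = P.eval x • w := by
  induction P using Polynomial.induction_on' with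
  | add p q hp hq => rw [map_add, LinearMap.add_apply, hp, hq, eval_add, add_smul]
  | monomial n a =>
    have hn : (shift ^ n) w = x ^ n • w := by
      induction n with
      | zero => simp
      | succ n ih => rw [pow_succ, Module.End.mul_apply, h, map_smul, ih, smul_smul, pow_succ']
    rw [aeval_monomial, eval_monomial, Module.End.mul_apply, hn, Module.algebraMap_end_apply,
      smul_smul]

theorem natDegree_prod_X_sub_C (n : ℕ) (x : ℕ → ℂ) :
    (∏ i ∈ Finset.range n, (X - C (x i))).natDegree = n := by
  rw [natDegree_prod_of_monic _ _ fun i _ => monic_X_sub_C _]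
  simp

theorem natDegree_prod_one_sub_le (n : ℕ) (x : ℕ → ℂ) :
    (∏ i ∈ Finset.range n, (1 - C (x i) * X)).natDegree ≤ n := by
  refine (natDegree_prod_le _ _).trans ?_
  refine (Finset.sum_le_card_nsmul _ _ 1 fun i _ => ?_).trans (by simp)
  compute_degree

/-- Reversal of coefficients is multiplicative and turns X - x into 1 - x X. The product trees store
the reversed products, whose constant coefficient 1 makes them invertible power series. -/
theorem coeff_prod_X_sub_C {n j : ℕ} (x : ℕ → ℂ) (hj : j ≤ n) :
    (∏ i ∈ Finset.range n, (X - C (x i))).coeff j =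
      (∏ i ∈ Finset.range n, (1 - C (x i) * X)).coeff (n - j) := by
  have : reflect n (∏ i ∈ Finset.range n, (X - C (x i))) =
      ∏ i ∈ Finset.range n, (1 - C (x i) * X) := by
    clear hj
    induction n with
    | zero => simp
    | succ n ih =>
      rw [Finset.prod_range_succ, Finset.prod_range_succ, reflect_mul _ _
        (natDegree_prod_X_sub_C n x).le (natDegree_X_sub_C_le _), ih]
      congr 1
      rw [reflect_sub]
      simp [reflect_C]
  rw [← this, coeff_reflect, revAt_le (Nat.sub_le _ _), Nat.sub_sub_self hj]

theorem coeff_zero_prod_one_sub (n : ℕ) (x : ℕ → ℂ) :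
    (∏ i ∈ Finset.range n, (1 - C (x i) * X)).coeff 0 = 1 := by
  rw [coeff_zero_eq_eval_zero, eval_prod]
  simp

/-- `∏ i < 2 ^ k, (1 - x i * X)`. -/
noncomputable def revProd (k : ℕ) (x : ℕ → ℂ) : ℂ[X] :=
  ∏ i ∈ Finset.range (2 ^ k), (1 - C (x i) * X)

/-- The degree can equal 2 ^ k, one too much for a sequence of that length, so these products are
stored with length 2 ^ (k + 1). -/
theorem natDegree_revProd_lt (k : ℕ) (x : ℕ → ℂ) : (revProd k x).natDegree < 2 ^ (k + 1) := by
  refine (natDegree_prod_one_sub_le _ x).trans_lt ?_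
  have := Nat.one_le_two_pow (n := k)
  rw [pow_succ]
  omega

theorem prod_range_two_pow_succ {M : Type*} [CommMonoid M] (k : ℕ) (f : ℕ → M) :
    ∏ i ∈ Finset.range (2 ^ (k + 1)), f i =
      (∏ i ∈ Finset.range (2 ^ k), f i) * ∏ i ∈ Finset.range (2 ^ k), f (i + 2 ^ k) := by
  rw [pow_succ, mul_two, Finset.prod_range_add]
  simp_rw [add_comm]

theorem revProd_succ (k : ℕ) (x : ℕ → ℂ) :
    revProd (k + 1) x = revProd k x * revProd k fun i => x (i + 2 ^ k) :=
  prod_range_two_pow_succ _ _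

theorem sum_reflect_eq_coeff_mul {n N : ℕ} (a b : ℕ → ℂ) (hn : n < N) :
    ∑ i ∈ Finset.range N, (if i ≤ n then a i * b (n - i) else 0) =
      PowerSeries.coeff n (PowerSeries.mk a * PowerSeries.mk b) := by
  rw [PowerSeries.coeff_mul, Finset.Nat.sum_antidiagonal_eq_sum_range_succ_mk, ← Finset.sum_filter]
  refine Finset.sum_congr ?_ fun i _ => by rw [PowerSeries.coeff_mk, PowerSeries.coeff_mk]
  ext i
  simp
  omega

/-- The middle coefficients of a product are given by the action of a polynomial. -/
theorem coeff_revProd_mul {k n : ℕ} (hn : n < 2 ^ k) (x u : ℕ → ℂ) :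
    (truncPoly (k + 1) (revProd k x).coeff * truncPoly (k + 1) u).coeff (n + 2 ^ k) =
      aeval shift (∏ i ∈ Finset.range (2 ^ k), (X - C (x i))) u n := by
  rw [coeff_truncPoly_mul (by rw [pow_succ]; omega), aeval_shift_apply (N := 2 ^ k + 1)
    (by rw [natDegree_prod_X_sub_C]; omega), ← sum_reflect_eq_coeff_mul (N := n + 2 ^ k + 1) _ _
    (by omega)]
  rw [add_right_comm, add_comm (n + 1), ← add_assoc, add_right_comm, Finset.sum_range_add]
  -- The last n summands involve coefficients above the degree 2 ^ k; the others, reversed, form the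
  -- sum for the shift action.
  rw [Finset.sum_eq_zero (s := Finset.range n), add_zero]
  · rw [← Finset.sum_range_reflect]
    refine Finset.sum_congr rfl fun i hi => ?_
    rw [Finset.mem_range] at hi
    rw [coeff_prod_X_sub_C x (by omega), if_pos (by omega)]
    congr 2
    omega
  · intro i hi
    split_ifs
    · rw [coeff_eq_zero_of_natDegree_lt, zero_mul]
      exact (natDegree_prod_one_sub_le _ x).trans_lt (by omega)
    · rfl

/-! ### Evaluation of polynomials through linear recurrences -/

/-- The sequence which is annihilated by `∏ i < N, (X - x i)`, and starts with `0, …, 0, 1`. -/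
noncomputable def fundSeq (N : ℕ) (x : ℕ → ℂ) (n : ℕ) : ℂ :=
  if N ≤ n + 1 then invSeq (∏ i ∈ Finset.range N, (1 - C (x i) * X)).coeff (n + 1 - N) else 0

/-- Term n of the transformed sequence is the coefficient of index n + 1 in the reversed product
times its inverse series, hence 0. -/
theorem aeval_prod_fundSeq (N : ℕ) (x : ℕ → ℂ) :
    aeval shift (∏ i ∈ Finset.range N, (X - C (x i))) (fundSeq N x) = 0 := by
  ext n
  have h := congrArg (PowerSeries.coeff (n + 1))
    (mk_mul_mk_invSeq (coeff_zero_prod_one_sub N x))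
  rw [← sum_reflect_eq_coeff_mul (N := N + 1 + (n + 1)) _ _ (by omega), PowerSeries.coeff_one,
    if_neg (by omega), Finset.sum_range_add, Finset.sum_eq_zero (s := Finset.range (n + 1)),
    add_zero] at h
  · rw [aeval_shift_apply (N := N + 1) (by rw [natDegree_prod_X_sub_C]; omega), Pi.zero_apply, ← h,
      ← Finset.sum_range_reflect]
    refine Finset.sum_congr rfl fun i hi => ?_
    rw [Finset.mem_range] at hi
    rw [coeff_prod_X_sub_C x (by omega), fundSeq]
    have e : N - (N + 1 - 1 - i) = i := by omega
    rw [e]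
    by_cases hin : i ≤ n + 1
    · rw [if_pos hin, if_pos (by omega)]
      congr 2
      omega
    · rw [if_neg hin, if_neg (by omega), mul_zero]
  · intro i hi
    split_ifs
    · rw [coeff_eq_zero_of_natDegree_lt, zero_mul]
      exact (natDegree_prod_one_sub_le _ x).trans_lt (by omega)
    · rfl

/-- The product of the `X - x j` with `j < N` and `j ≠ i`. -/
noncomputable def prodExcept (N : ℕ) (x : ℕ → ℂ) (i : ℕ) : ℂ[X] :=
  ∏ j ∈ Finset.range N, if j = i then 1 else X - C (x j)

theorem prodExcept_mul {N i : ℕ} (x : ℕ → ℂ) (hi : i < N) :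
    (X - C (x i)) * prodExcept N x i = ∏ j ∈ Finset.range N, (X - C (x j)) := by
  have h := Finset.mem_range.2 hi
  rw [prodExcept, ← Finset.mul_prod_erase _ _ h, ← Finset.mul_prod_erase _ _ h, if_pos rfl, one_mul]
  congr 1
  refine Finset.prod_congr rfl fun j hj => ?_
  rw [if_neg (Finset.ne_of_mem_erase hj)]

/-- The factor X - x_i annihilates `prodExcept` applied to `fundSeq`, which is therefore geometric
of ratio x_i. Its first term is 1, since `prodExcept` is monic of degree N - 1 and meets 0, …, 0, 1.
Acting by P multiplies it by P(x_i). Repeated points are allowed. -/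
theorem aeval_prodExcept_fundSeq {N i : ℕ} (x : ℕ → ℂ) (hi : i < N) (P : ℂ[X]) :
    aeval shift (prodExcept N x i) (aeval shift P (fundSeq N x)) 0 = P.eval (x i) := by
  have hm := prodExcept_mul x hi
  have hmonic : (prodExcept N x i).Monic := by
    refine monic_prod_of_monic _ _ fun j _ => ?_
    split_ifs
    · exact monic_one
    · exact monic_X_sub_C _
  have hdeg : (prodExcept N x i).natDegree + 1 = N := by
    have := congrArg natDegree hm
    rw [natDegree_prod_X_sub_C, (monic_X_sub_C _).natDegree_mul hmonic, natDegree_X_sub_C] at this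
    omega
  have hgeo : shift (aeval shift (prodExcept N x i) (fundSeq N x)) =
      x i • aeval shift (prodExcept N x i) (fundSeq N x) := by
    have h := aeval_prod_fundSeq N x
    rw [← hm, map_mul, Module.End.mul_apply, map_sub, aeval_X, aeval_C, LinearMap.sub_apply,
      Module.algebraMap_end_apply, sub_eq_zero] at h
    exact h
  rw [← Module.End.mul_apply, ← map_mul, mul_comm, map_mul, Module.End.mul_apply,
    aeval_shift_of_geometric hgeo, Pi.smul_apply, smul_eq_mul,
    aeval_shift_apply (N := N) (by omega), Finset.sum_eq_single (N - 1)]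
  · rw [fundSeq, if_pos (by omega)]
    have h1 : (prodExcept N x i).coeff (N - 1) = 1 := by
      rw [show N - 1 = (prodExcept N x i).natDegree by omega]
      exact hmonic
    have e : 0 + (N - 1) + 1 - N = 0 := by omega
    rw [e, invSeq_zero (coeff_zero_prod_one_sub N x), h1]
    ring
  · intro j hj hj'
    rw [Finset.mem_range] at hj
    rw [fundSeq, if_neg (by omega), mul_zero]
  · intro h
    rw [Finset.mem_range] at h
    omega

/-- The initial zeros of `fundSeq` cut the sum to a convolution of the reversed coefficients of P
with the inverse series, so the needed terms come from one truncated product. -/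
theorem aeval_fundSeq_apply {k n : ℕ} (x : ℕ → ℂ) {P : ℂ[X]} (hP : P.natDegree < 2 ^ k)
    (hn : n < 2 ^ k) :
    aeval shift P (fundSeq (2 ^ k) x) n =
      (truncPoly k (fun i => P.coeff (2 ^ k - 1 - i)) *
        truncPoly k (invSeq (revProd k x).coeff)).coeff n := by
  rw [coeff_truncPoly_mul hn, ← sum_reflect_eq_coeff_mul (N := 2 ^ k) _ _ hn,
    aeval_shift_apply hP, ← Finset.sum_range_reflect]
  refine Finset.sum_congr rfl fun i hi => ?_
  rw [Finset.mem_range] at hi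
  rw [fundSeq]
  by_cases hin : i ≤ n
  · rw [if_pos hin, if_pos (by omega), revProd]
    congr 2
    omega
  · rw [if_neg hin, if_neg (by omega), mul_zero]

namespace Expr

/-! ### Lists, perfect trees and multipoint evaluation -/

/-- `(l, (s, d)) ↦ (t, l')`: the first `s = 2 ^ k` entries of the list `l`, padded by `d`, as a
perfect tree `t`, and the list `l'` of the other entries. -/
noncomputable def buildBody : Expr :=
  ifPos (sub (fst (snd arg)) (const 1))
    (letIn (call 6 (pair (fst arg) (pair (mul (fst (snd arg)) (const (1 / 2))) (snd (snd arg)))))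
      (letIn (call 6 (pair (snd (var 0))
          (pair (mul (fst (snd (var 1))) (const (1 / 2))) (snd (snd (var 1))))))
        (pair (pair (fst (var 1)) (fst (var 0))) (snd (var 0)))))
    (ifPair (fst arg) (fst arg) (pair (snd (snd arg)) (const 0)))

/-- `(n, s) ↦ s * 2 ^ j` with the least `j` for which this is at least `n`. -/
noncomputable def growBody : Expr :=
  ifPos (sub (fst arg) (snd arg)) (call 7 (pair (fst arg) (add (snd arg) (snd arg)))) (snd arg)

/-- The length of a list. -/
noncomputable def lenBody : Expr :=
  ifPair arg (add (call 8 (snd arg)) (const 1)) (const 0)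

/-- `(t, (i, s))` is mapped to the leaf with the index `i` of the tree `t` with `s` leaves. -/
noncomputable def lookupBody : Expr :=
  ifPos (sub (snd (snd arg)) (const 1))
    (letIn (mul (snd (snd arg)) (const (1 / 2)))
      (ifPos (sub (var 0) (fst (snd (var 1))))
        (call 9 (pair (fst (fst (var 1))) (pair (fst (snd (var 1))) (var 0))))
        (call 9 (pair (snd (fst (var 1))) (pair (sub (fst (snd (var 1))) (var 0)) (var 0))))))
    (fst arg)

/-- The tree of the products of the polynomials `1 - x * X`, where `x` runs through the leaves of
a perfect tree. -/
noncomputable def prodTreeBody : Expr :=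
  ifPair arg
    (letIn (call 10 (fst arg)) (letIn (call 10 (snd (var 1)))
      (pair (call 3 (pair (fst (var 1)) (fst (var 0)))) (pair (var 1) (var 0)))))
    (pair (pair (cconst 1) (pair (sub (const 0) arg) (const 0))) (const 0))

/-- The passage from the root of a product tree to the leaves. -/
noncomputable def downBody : Expr :=
  ifPair (snd (fst arg))
    (pair
      (call 11 (pair (fst (snd (fst arg)))
        (snd (fst (call 3 (pair (fst (snd (snd (fst arg)))) (snd arg)))))))
      (call 11 (pair (snd (snd (fst arg)))
        (snd (fst (call 3 (pair (fst (fst (snd (fst arg)))) (snd arg))))))))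
    (snd arg)

/-- The values of a polynomial at the points of a product tree. -/
noncomputable def evalBody : Expr :=
  call 11 (pair (fst arg)
    (fst (call 3 (pair (call 5 (snd arg)) (call 4 (fst (fst (fst arg))))))))

/-- Two lists of equal lengths are joined to a list of pairs. -/
noncomputable def zipBody : Expr :=
  ifPair (fst arg)
    (pair (pair (fst (fst arg)) (fst (snd arg))) (call 13 (pair (snd (fst arg)) (snd (snd arg)))))
    (const 0)

/-- The functions for multipoint evaluation, lists and trees. -/
noncomputable def treeFuns : List Expr :=
  seqFuns ++ [buildBody, growBody, lenBody, lookupBody, prodTreeBody, downBody, evalBody, zipBody]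

end Expr

theorem extends_seqFuns {F : List Expr} (hF : Extends treeFuns F) : Extends seqFuns F :=
  fun i b h => hF i b (by
    rw [treeFuns, List.getElem?_append_left (List.getElem?_eq_some_iff.1 h).1]
    exact h)

/-- The data structure of a product tree. -/
noncomputable def prodTreeVal : ℕ → (ℕ → ℂ) → Val
  | 0, x => .pair (seqVal 1 (revProd 0 x).coeff) (.num 0)
  | k + 1, x => .pair (seqVal (k + 2) (revProd (k + 1) x).coeff)
      (.pair (prodTreeVal k x) (prodTreeVal k fun i => x (i + 2 ^ k)))

theorem prodTreeVal_eq (k : ℕ) (x : ℕ → ℂ) :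
    ∃ v, prodTreeVal k x = .pair (seqVal (k + 1) (revProd k x).coeff) v := by
  cases k <;> exact ⟨_, rfl⟩

theorem ofList_cons (a : Val) (l : List Val) : Val.ofList (a :: l) = .pair a (Val.ofList l) := rfl

theorem ofList_nil : Val.ofList [] = .num 0 := rfl

theorem two_pow_half (k : ℕ) : (2 : ℝ) ^ (k + 1) * (1 / 2) = 2 ^ k := by
  rw [pow_succ]
  ring

theorem two_pow_succ_pos (k : ℕ) : (0 : ℝ) < 2 ^ (k + 1) - 1 :=
  sub_pos.2 (one_lt_pow₀ one_lt_two (Nat.succ_ne_zero k))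

/-! ### Correctness and cost of list and tree operations and of multipoint evaluation -/

section
variable {F : List Expr} (hF : Extends treeFuns F)
include hF

theorem fn_build (k : ℕ) (l : List Val) (d : Val) :
    Fn F 6 (.pair (Val.ofList l) (.pair (.num (2 ^ k)) d))
      (.pair (treeVal k fun i => l.getD i d) (Val.ofList (l.drop (2 ^ k)))) (100 * 2 ^ k - 50) := by
  induction k generalizing l with
  | zero =>
    refine Fn.of_W (hF 6 buildBody rfl) ?_
    simp only [wp, buildBody, pow_zero, sub_self, lt_irrefl, if_false]
    cases l with
    | nil =>
      simp only [ofList_nil, wp]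
      exact ⟨rfl, by norm_num⟩
    | cons a l =>
      simp only [ofList_cons, wp]
      exact ⟨rfl, by norm_num⟩
  | succ k ih =>
    refine Fn.of_W (hF 6 buildBody rfl) ?_
    simp only [wp, buildBody, if_pos (two_pow_succ_pos k), two_pow_half]
    refine (ih _).use fun t₁ h₁ => ?_
    simp only [wp]
    refine (ih _).use fun t₂ h₂ => ?_
    simp only [wp]
    refine ⟨?_, ?_⟩
    · rw [treeVal, List.drop_drop, ← two_mul, ← pow_succ']
      simp only [List.getD_eq_getElem?_getD, List.getElem?_drop, add_comm]
    · have := Nat.one_le_two_pow (n := k)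
      rw [pow_succ]
      omega

/-- A doubling takes place only if 2 ^ j < n, so it preserves 2 ^ j ≤ 2 * n, and the result exceeds
n by at most a factor 2. -/
theorem fn_grow {n : ℕ} (j : ℕ) (hj : 2 ^ j ≤ 2 * n) :
    ∃ k, n ≤ 2 ^ k ∧ 2 ^ k ≤ 2 * n ∧
      Fn F 7 (.pair (.num n) (.num (2 ^ j))) (.num (2 ^ k)) (20 * (k + 1 - j)) := by
  -- A crude bound for the number of remaining doublings, used only as an induction measure.
  obtain ⟨m, hm⟩ : ∃ m, n ≤ 2 ^ (j + m) := ⟨n, Nat.lt_two_pow_self.le.trans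
    (Nat.pow_le_pow_right two_pos (by omega))⟩
  induction m generalizing j with
  | zero =>
    refine ⟨j, hm, hj, ?_⟩
    refine Fn.of_W (hF 7 growBody rfl) ?_
    have : ¬ (0 : ℝ) < n - 2 ^ j := by
      rw [sub_pos, not_lt]
      exact_mod_cast hm
    simp only [wp, growBody, if_neg this]
    exact ⟨trivial, by omega⟩
  | succ m ih =>
    by_cases h : n ≤ 2 ^ j
    · refine ⟨j, h, hj, ?_⟩
      refine Fn.of_W (hF 7 growBody rfl) ?_
      have : ¬ (0 : ℝ) < n - 2 ^ j := by
        rw [sub_pos, not_lt]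
        exact_mod_cast h
      simp only [wp, growBody, if_neg this]
      exact ⟨trivial, by omega⟩
    · obtain ⟨k, h₁, h₂, h₃⟩ := ih (j + 1) (by rw [pow_succ]; omega)
        (by rwa [add_right_comm, add_assoc])
      refine ⟨k, h₁, h₂, ?_⟩
      refine Fn.of_W (hF 7 growBody rfl) ?_
      have h' : (0 : ℝ) < n - 2 ^ j := by
        rw [sub_pos]
        exact_mod_cast not_le.1 h
      have hjk : j < k := by
        rw [← Nat.pow_lt_pow_iff_right (a := 2) (by norm_num)]
        omega
      simp only [wp, growBody, if_pos h', ← mul_two, ← pow_succ]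
      exact h₃.use fun t ht => ⟨rfl, by omega⟩

theorem fn_len (l : List Val) : Fn F 8 (Val.ofList l) (.num l.length) (10 * l.length + 10) := by
  induction l with
  | nil =>
    refine Fn.of_W (hF 8 lenBody rfl) ?_
    simp only [wp, lenBody, ofList_nil]
    exact ⟨by simp, by norm_num⟩
  | cons a l ih =>
    refine Fn.of_W (hF 8 lenBody rfl) ?_
    simp only [wp, lenBody, ofList_cons]
    refine ih.use fun t ht => ?_
    simp only [wp]
    refine ⟨by simp, ?_⟩
    rw [List.length_cons]
    omega

theorem fn_lookup {k i : ℕ} (hi : i < 2 ^ k) (g : ℕ → Val) :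
    Fn F 9 (.pair (treeVal k g) (.pair (.num i) (.num (2 ^ k)))) (g i) (50 * (k + 1)) := by
  induction k generalizing i g with
  | zero =>
    refine Fn.of_W (hF 9 lookupBody rfl) ?_
    simp only [wp, lookupBody, pow_zero, sub_self, lt_irrefl, if_false]
    obtain rfl : i = 0 := by simpa using hi
    exact ⟨rfl, by norm_num⟩
  | succ k ih =>
    refine Fn.of_W (hF 9 lookupBody rfl) ?_
    simp only [wp, lookupBody, if_pos (two_pow_succ_pos k), two_pow_half, treeVal]
    by_cases h : i < 2 ^ k
    · have h' : (0 : ℝ) < 2 ^ k - i := by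
        rw [sub_pos]
        exact_mod_cast h
      simp only [if_pos h']
      exact (ih h _).use fun t ht => ⟨rfl, by omega⟩
    · have h' : ¬ (0 : ℝ) < 2 ^ k - i := by
        rw [sub_pos]
        exact_mod_cast h
      have e : (i : ℝ) - 2 ^ k = ((i - 2 ^ k : ℕ) : ℝ) := by
        rw [Nat.cast_sub (not_lt.1 h)]
        simp
      simp only [if_neg h', e]
      refine (ih (by rw [pow_succ] at hi; omega) _).use fun t ht => ⟨?_, by omega⟩
      simp only [Nat.sub_add_cancel (not_lt.1 h)]

theorem fn_zip {α : Type*} (l : List α) (f g : α → Val) :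
    Fn F 13 (.pair (Val.ofList (l.map f)) (Val.ofList (l.map g)))
      (Val.ofList (l.map fun a => .pair (f a) (g a))) (30 * l.length + 10) := by
  induction l with
  | nil =>
    refine Fn.of_W (hF 13 zipBody rfl) ?_
    simp only [wp, zipBody, List.map_nil, ofList_nil]
    exact ⟨trivial, by norm_num⟩
  | cons a l ih =>
    refine Fn.of_W (hF 13 zipBody rfl) ?_
    simp only [wp, zipBody, List.map_cons, ofList_cons]
    refine ih.use fun t ht => ⟨rfl, ?_⟩
    rw [List.length_cons]
    omega

/-- Each node costs one product, O(k 2 ^ k); summing over the levels gives the second factor k + 1.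
-/
theorem fn_prodTree (k : ℕ) (x : ℕ → ℝ) :
    Fn F 10 (treeVal k fun i => .num (x i)) (prodTreeVal k fun i => (x i : ℂ))
      (10000 * (k + 1) ^ 2 * 2 ^ k) := by
  induction k generalizing x with
  | zero =>
    refine Fn.of_W (hF 10 prodTreeBody rfl) ?_
    simp only [wp, prodTreeBody, treeVal, cconst, prodTreeVal]
    refine ⟨?_, by norm_num⟩
    simp [seqVal_succ, seqVal_zero, revProd, coeff_one, coeff_X]
  | succ k ih =>
    refine Fn.of_W (hF 10 prodTreeBody rfl) ?_
    have hp : (treeVal (k + 1) fun i => Val.num (x i)).isPair = true := rfl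
    obtain ⟨v, hv⟩ := prodTreeVal_eq k fun i => (x i : ℂ)
    obtain ⟨v', hv'⟩ := prodTreeVal_eq k fun i => (x (i + 2 ^ k) : ℂ)
    have hm := fn_mul_poly (extends_seqFuns hF) (natDegree_revProd_lt k fun i => (x i : ℂ))
      (natDegree_revProd_lt k fun i => (x (i + 2 ^ k) : ℂ))
    rw [← revProd_succ k fun i => (x i : ℂ)] at hm
    simp only [wp, prodTreeBody, treeVal]
    refine (ih _).use fun t₁ h₁ => (ih fun i => x (i + 2 ^ k)).use fun t₂ h₂ => ?_
    simp only [hv, hv', wp]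
    refine hm.use fun t₃ h₃ => ⟨?_, ?_⟩
    · rw [prodTreeVal, hv, hv']
    · have := Nat.one_le_two_pow (n := k)
      have e₁ : 10000 * (k + 1) ^ 2 * 2 ^ k =
        10000 * (k ^ 2 * 2 ^ k) + 20000 * (k * 2 ^ k) + 10000 * 2 ^ k := by ring
      have e₂ : 10000 * (k + 1 + 1) ^ 2 * 2 ^ (k + 1) =
        20000 * (k ^ 2 * 2 ^ k) + 80000 * (k * 2 ^ k) + 80000 * 2 ^ k := by ring
      have e₃ : 5000 * (k + 1 + 1) * 2 ^ (k + 1) = 10000 * (k * 2 ^ k) + 20000 * 2 ^ k := by ring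
      rw [e₁] at h₁ h₂
      rw [e₃] at h₃
      rw [e₂]
      omega

/-- A child receives the sequence after the action of the product over the points of its sibling, so
leaf i has met every factor except X - x_i. A product of degree 2 ^ k needs 2 ^ (k + 1) terms to
yield 2 ^ k terms, so the lengths halve with the depth. -/
theorem fn_down (k : ℕ) (x u : ℕ → ℂ) :
    Fn F 11 (.pair (prodTreeVal k x) (seqVal k u))
      (seqVal k fun i => aeval shift (prodExcept (2 ^ k) x i) u 0)
      (20000 * (k + 1) ^ 2 * 2 ^ k) := by
  induction k generalizing x u with
  | zero =>
    refine Fn.of_W (hF 11 downBody rfl) ?_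
    simp only [wp, downBody, prodTreeVal]
    refine ⟨?_, by norm_num⟩
    simp [seqVal_zero, prodExcept]
  | succ k ih =>
    refine Fn.of_W (hF 11 downBody rfl) ?_
    obtain ⟨v, hv⟩ := prodTreeVal_eq k x
    obtain ⟨v', hv'⟩ := prodTreeVal_eq k fun i => x (i + 2 ^ k)
    -- The action is read off as the second quarter of the full product, the indices from 2 ^ k to 2
    -- ^ (k + 1) - 1.
    have hmid : ∀ y : ℕ → ℂ, (seqVal k fun i => (truncPoly (k + 1) (revProd k y).coeff *
        truncPoly (k + 1) u).coeff (i + 2 ^ k)) =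
        seqVal k (aeval shift (∏ i ∈ Finset.range (2 ^ k), (X - C (y i))) u) := fun y =>
      seqVal_congr fun n hn => coeff_revProd_mul hn y u
    have hval : ∀ i, aeval shift (prodExcept (2 ^ (k + 1)) x i) u =
        aeval shift (∏ j ∈ Finset.range (2 ^ k), if j = i then 1 else (X - C (x j)))
          (aeval shift (∏ j ∈ Finset.range (2 ^ k),
            if j + 2 ^ k = i then 1 else (X - C (x (j + 2 ^ k)))) u) := by
      intro i
      rw [prodExcept, prod_range_two_pow_succ, map_mul, Module.End.mul_apply]
    have ih₁ := ih x
    have ih₂ := ih fun i => x (i + 2 ^ k)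
    rw [hv] at ih₁
    rw [hv'] at ih₂
    simp only [wp, downBody, prodTreeVal]
    simp only [hv, hv', wp]
    refine (fn_mul (extends_seqFuns hF) (k + 1) _ _).use fun t₁ h₁ => ?_
    simp only [wp, seqVal_succ, hmid]
    refine (ih₁ _).use fun t₂ h₂ => (fn_mul (extends_seqFuns hF) (k + 1) _ _).use fun t₃ h₃ => ?_
    simp only [wp, seqVal_succ, hmid]
    refine (ih₂ _).use fun t₄ h₄ => ⟨?_, ?_⟩
    · congr 1
      · refine seqVal_congr fun i hi => ?_
        rw [hval, prodExcept]
        have e : (∏ j ∈ Finset.range (2 ^ k),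
            if j + 2 ^ k = i then 1 else (X - C (x (j + 2 ^ k)))) =
            ∏ j ∈ Finset.range (2 ^ k), (X - C (x (j + 2 ^ k))) :=
          Finset.prod_congr rfl fun j _ => if_neg (by omega)
        rw [e]
      · refine seqVal_congr fun i hi => ?_
        have e₁ : (∏ j ∈ Finset.range (2 ^ k), if j = i + 2 ^ k then 1 else (X - C (x j))) =
            ∏ j ∈ Finset.range (2 ^ k), (X - C (x j)) :=
          Finset.prod_congr rfl fun j hj => if_neg (by rw [Finset.mem_range] at hj; omega)
        -- On the right half the program applies the left product first, while `hval` applies it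
        -- last; polynomials in the shift commute.
        rw [hval, e₁, ← Module.End.mul_apply, ← map_mul, mul_comm, map_mul, Module.End.mul_apply,
          prodExcept]
        simp only [Nat.add_right_cancel_iff]
    · have := Nat.one_le_two_pow (n := k)
      have e₁ : 20000 * (k + 1) ^ 2 * 2 ^ k =
        20000 * (k ^ 2 * 2 ^ k) + 40000 * (k * 2 ^ k) + 20000 * 2 ^ k := by ring
      have e₂ : 20000 * (k + 1 + 1) ^ 2 * 2 ^ (k + 1) =
        40000 * (k ^ 2 * 2 ^ k) + 160000 * (k * 2 ^ k) + 160000 * 2 ^ k := by ring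
      have e₃ : 5000 * (k + 1 + 1) * 2 ^ (k + 1) = 10000 * (k * 2 ^ k) + 20000 * 2 ^ k := by ring
      rw [e₁] at h₂ h₄
      rw [e₃] at h₁ h₃
      rw [e₂]
      omega

/-- One inversion at the root and one product start the sequence P acting on `fundSeq`; the descent
then delivers all values. -/
theorem fn_eval (k : ℕ) (x : ℕ → ℂ) {P : ℂ[X]} (hP : P.natDegree < 2 ^ k) :
    Fn F 12 (.pair (prodTreeVal k x) (seqVal k P.coeff)) (seqVal k fun i => P.eval (x i))
      (50000 * (k + 1) ^ 2 * 2 ^ k) := by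
  refine Fn.of_W (hF 12 evalBody rfl) ?_
  obtain ⟨v, hv⟩ := prodTreeVal_eq k x
  have hinv := fn_inv (extends_seqFuns hF) k (revProd k x).coeff (coeff_zero_prod_one_sub _ x)
  have hu : seqVal k (truncPoly k (fun i => P.coeff (2 ^ k - 1 - i)) *
      truncPoly k (invSeq (revProd k x).coeff)).coeff =
      seqVal k (aeval shift P (fundSeq (2 ^ k) x)) :=
    seqVal_congr fun n hn => (aeval_fundSeq_apply x hP hn).symm
  have hd := fn_down hF k x (aeval shift P (fundSeq (2 ^ k) x))
  rw [hv] at hd ⊢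
  simp only [wp, evalBody, seqVal_succ]
  refine (fn_rev (extends_seqFuns hF) k _).use fun t₁ h₁ => hinv.use fun t₂ h₂ =>
    (fn_mul (extends_seqFuns hF) k _ _).use fun t₃ h₃ => ?_
  simp only [wp, seqVal_succ, hu]
  refine hd.use fun t₄ h₄ => ⟨?_, ?_⟩
  · exact seqVal_congr fun i hi => aeval_prodExcept_fundSeq x hi P
  · have := Nat.one_le_two_pow (n := k)
    have e₁ : 5000 * (k + 1) * 2 ^ k = 5000 * (k * 2 ^ k) + 5000 * 2 ^ k := by ring
    have e₂ : 20000 * (k + 1) * 2 ^ k = 20000 * (k * 2 ^ k) + 20000 * 2 ^ k := by ring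
    have e₃ : 20000 * (k + 1) ^ 2 * 2 ^ k =
        20000 * (k ^ 2 * 2 ^ k) + 40000 * (k * 2 ^ k) + 20000 * 2 ^ k := by ring
    have e₄ : 50000 * (k + 1) ^ 2 * 2 ^ k =
        50000 * (k ^ 2 * 2 ^ k) + 100000 * (k * 2 ^ k) + 50000 * 2 ^ k := by ring
    rw [e₁] at h₃
    rw [e₂] at h₂
    rw [e₃] at h₄
    rw [e₄]
    omega

end

/-! ### Sums of fractions -/

/-- Straight-line programs evaluate polynomials. -/
theorem exists_expr_eval (r : ℝ[X]) : ∃ (e : Expr) (c : ℕ), ∀ (F : List Expr) (y v : ℝ),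
    Eval F [.pair (.num y) (.num v)] e (.num (r.eval y)) c := by
  induction r using Polynomial.induction_on' with
  | add p q hp hq =>
    obtain ⟨e₁, c₁, h₁⟩ := hp
    obtain ⟨e₂, c₂, h₂⟩ := hq
    refine ⟨.add e₁ e₂, c₁ + c₂ + 1, fun F y v => ?_⟩
    rw [eval_add]
    exact .add (h₁ F y v) (h₂ F y v)
  | monomial n a =>
    induction n with
    | zero =>
      refine ⟨.const a, 1, fun F y v => ?_⟩
      rw [monomial_zero_left, eval_C]
      exact .const
    | succ n ih =>
      obtain ⟨e, c, h⟩ := ih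
      refine ⟨.mul e (.fst (.var 0)), c + (1 + 1) + 1, fun F y v => ?_⟩
      rw [← monomial_mul_X, eval_mul_X]
      exact .mul (h F y v) (.fst (.var rfl))

theorem exists_expr_seqVal (k : ℕ) (g : ℕ → ℝ → ℝ → ℝ)
    (hg : ∀ i, ∃ (e : Expr) (c : ℕ), ∀ (F : List Expr) (y v : ℝ),
      Eval F [.pair (.num y) (.num v)] e (.num (g i y v)) c) :
    ∃ (e : Expr) (c : ℕ), ∀ (F : List Expr) (y v : ℝ),
      Eval F [.pair (.num y) (.num v)] e (seqVal k fun i => (g i y v : ℂ)) c := by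
  induction k generalizing g with
  | zero =>
    obtain ⟨e, c, h⟩ := hg 0
    exact ⟨.pair e (.const 0), _, fun F y v => .pair (h F y v) .const⟩
  | succ k ih =>
    obtain ⟨e₁, c₁, h₁⟩ := ih g hg
    obtain ⟨e₂, c₂, h₂⟩ := ih (fun i => g (i + 2 ^ k)) fun i => hg (i + 2 ^ k)
    exact ⟨.pair e₁ e₂, _, fun F y v => .pair (h₁ F y v) (h₂ F y v)⟩

/-- A real polynomial with degree below `2 ^ k` as data. -/
noncomputable def polyVal (k : ℕ) (A : ℝ[X]) : Val := seqVal k fun i => (A.coeff i : ℂ)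

theorem polyVal_eq (k : ℕ) (A : ℝ[X]) : polyVal k A = seqVal k (A.map (algebraMap ℝ ℂ)).coeff := by
  rw [polyVal]
  congr 1
  ext i
  rw [coeff_map]
  rfl

/-- The coefficients of p(X + y) are Hasse derivatives of p at y. They are finitely many fixed
polynomials in y, so a leaf costs a constant number c of steps. -/
theorem exists_leaf_expr (p q : ℝ[X]) (e : ℕ) : ∃ (L : Expr) (c : ℕ), ∀ (F : List Expr) (y v : ℝ),
    Eval F [.pair (.num y) (.num v)] L
      (.pair (polyVal e (C v * taylor y p)) (polyVal e (taylor y q))) c := by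
  obtain ⟨e₁, c₁, h₁⟩ := exists_expr_seqVal e (fun i y v => (C v * taylor y p).coeff i) fun i => by
    obtain ⟨e, c, h⟩ := exists_expr_eval (hasseDeriv i p)
    refine ⟨.mul (.snd (.var 0)) e, 1 + 1 + c + 1, fun F y v => ?_⟩
    rw [coeff_C_mul, taylor_coeff]
    exact .mul (.snd (.var rfl)) (h F y v)
  obtain ⟨e₂, c₂, h₂⟩ := exists_expr_seqVal e (fun i y _ => (taylor y q).coeff i) fun i => by
    obtain ⟨e, c, h⟩ := exists_expr_eval (hasseDeriv i q)
    refine ⟨e, c, fun F y v => ?_⟩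
    rw [taylor_coeff]
    exact h F y v
  exact ⟨.pair e₁ e₂, _, fun F y v => .pair (h₁ F y v) (h₂ F y v)⟩

section
variable (p q : ℝ[X])

/-- The denominator of `∑ i < 2 ^ k, v i * p (X + y i) / q (X + y i)`. -/
noncomputable def fracDen : ℕ → (ℕ → ℝ) → ℝ[X]
  | 0, y => taylor (y 0) q
  | k + 1, y => fracDen k y * fracDen k fun i => y (i + 2 ^ k)

/-- The numerator of `∑ i < 2 ^ k, v i * p (X + y i) / q (X + y i)`. -/
noncomputable def fracNum : ℕ → (ℕ → ℝ) → (ℕ → ℝ) → ℝ[X]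
  | 0, y, v => C (v 0) * taylor (y 0) p
  | k + 1, y, v => fracNum k y v * fracDen q k (fun i => y (i + 2 ^ k)) +
      fracNum k (fun i => y (i + 2 ^ k)) (fun i => v (i + 2 ^ k)) * fracDen q k y

variable {p q}

theorem natDegree_fracDen_lt {e : ℕ} (hq : q.natDegree < 2 ^ e) (k : ℕ) (y : ℕ → ℝ) :
    (fracDen q k y).natDegree < 2 ^ (k + e) := by
  induction k generalizing y with
  | zero => simpa [fracDen] using hq
  | succ k ih =>
    refine natDegree_mul_le.trans_lt ?_
    have h₁ := ih y
    have h₂ := ih fun i => y (i + 2 ^ k)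
    rw [add_right_comm, pow_succ]
    omega

theorem natDegree_fracNum_lt {e : ℕ} (hp : p.natDegree < 2 ^ e) (hq : q.natDegree < 2 ^ e) (k : ℕ)
    (y v : ℕ → ℝ) : (fracNum p q k y v).natDegree < 2 ^ (k + e) := by
  induction k generalizing y v with
  | zero =>
    refine (natDegree_C_mul_le _ _).trans_lt ?_
    simpa using hp
  | succ k ih =>
    have h₁ := natDegree_fracDen_lt hq k y
    have h₂ := natDegree_fracDen_lt hq k fun i => y (i + 2 ^ k)
    have h₃ := ih y v
    have h₄ := ih (fun i => y (i + 2 ^ k)) (fun i => v (i + 2 ^ k))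
    rw [add_right_comm, pow_succ]
    refine (natDegree_add_le _ _).trans_lt (max_lt ?_ ?_)
    · refine natDegree_mul_le.trans_lt ?_
      omega
    · refine natDegree_mul_le.trans_lt ?_
      omega

theorem eval_fracDen_ne_zero {x : ℝ} (k : ℕ) (y : ℕ → ℝ) (H : ∀ i, q.eval (x + y i) ≠ 0) :
    (fracDen q k y).eval x ≠ 0 := by
  induction k generalizing y with
  | zero =>
    rw [fracDen, taylor_eval]
    exact H 0
  | succ k ih =>
    rw [fracDen, eval_mul]
    exact mul_ne_zero (ih y H) (ih _ fun i => H _)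

theorem eval_fracNum_div {x : ℝ} (k : ℕ) (y v : ℕ → ℝ) (H : ∀ i, q.eval (x + y i) ≠ 0) :
    (fracNum p q k y v).eval x / (fracDen q k y).eval x =
      ∑ i ∈ Finset.range (2 ^ k), v i * (p.eval (x + y i) / q.eval (x + y i)) := by
  induction k generalizing y v with
  | zero => simp [fracNum, fracDen, taylor_eval, mul_div_assoc]
  | succ k ih =>
    have h₁ := eval_fracDen_ne_zero k y H
    have h₂ := eval_fracDen_ne_zero k (fun i => y (i + 2 ^ k)) fun i => H _
    rw [pow_succ, mul_two, Finset.sum_range_add, ← ih y v H]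
    simp only [add_comm (2 ^ k)]
    rw [← ih (fun i => y (i + 2 ^ k)) (fun i => v (i + 2 ^ k)) fun i => H _, fracNum, fracDen,
      eval_add, eval_mul, eval_mul, eval_mul]
    field_simp

end

/-! ### Programs for sums of fractions and matrix-vector products -/

namespace Expr

/-- The sum of the fractions belonging to the leaves of a tree. -/
noncomputable def fracSumBody : Expr :=
  ifPair (fst arg)
    (letIn (call 15 (fst arg)) (letIn (call 15 (snd (var 1)))
      (pair (lin (cconst 1) (cconst 1) (call 3 (pair (fst (var 1)) (snd (var 0))))
          (call 3 (pair (fst (var 0)) (snd (var 1)))))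
        (call 3 (pair (snd (var 1)) (snd (var 0)))))))
    (call 14 arg)

/-- `(l, (i, (s, (P, Q))))` is mapped to the list of the quotients of the leaves of `P` and `Q`
with the indices `i, …, i + |l| - 1`. -/
noncomputable def quotBody : Expr :=
  ifPair (fst arg)
    (pair
      (div (fst (call 9 (pair (fst (snd (snd (snd arg))))
          (pair (fst (snd arg)) (fst (snd (snd arg)))))))
        (fst (call 9 (pair (snd (snd (snd (snd arg))))
          (pair (fst (snd arg)) (fst (snd (snd arg))))))))
      (call 16 (pair (snd (fst arg)) (pair (add (fst (snd arg)) (const 1)) (snd (snd arg))))))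
    (const 0)

/-- The product of the matrix `[p (x i + y j) / q (x i + y j)]` and a vector. -/
noncomputable def cordialBody (e : ℕ) : Expr :=
  letIn (call 7 (pair (add (call 8 (fst arg)) (call 8 (fst (snd arg)))) (const 1)))
    (letIn (call 10 (fst (call 6 (pair (fst (var 1))
        (pair (mul (var 0) (const (2 ^ e))) (const 0))))))
      (letIn (call 15 (fst (call 6 (pair (call 13 (snd (var 2)))
          (pair (var 1) (pair (fst (fst (snd (var 2)))) (const 0)))))))
        (call 16 (pair (fst (var 3)) (pair (const 0) (pair (mul (var 2) (const (2 ^ e)))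
          (pair (call 12 (pair (var 1) (fst (var 0)))) (call 12 (pair (var 1) (snd (var 0)))))))))))

/-- The functions for the multiplication of a matrix and a vector. -/
noncomputable def cordialFuns (L : Expr) (e : ℕ) : List Expr :=
  treeFuns ++ [L, fracSumBody, quotBody, cordialBody e]

end Expr

theorem extends_treeFuns {F : List Expr} {L : Expr} {e : ℕ} (hF : Extends (cordialFuns L e) F) :
    Extends treeFuns F :=
  fun i b h => hF i b (by
    rw [cordialFuns, List.getElem?_append_left (List.getElem?_eq_some_iff.1 h).1]
    exact h)

/-- Separates the fixed degree bound 2 ^ e from the varying number 2 ^ k of points in the time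
bounds. -/
theorem add_add_one_le_mul (k e : ℕ) : k + e + 1 ≤ (k + 1) * (e + 1) := by
  have : (k + 1) * (e + 1) = k * e + k + e + 1 := by ring
  omega

theorem sum_range_getD {α : Type*} (l : List α) (d : α) (g : α → ℝ) (hd : g d = 0) {N : ℕ}
    (hN : l.length ≤ N) : ∑ i ∈ Finset.range N, g (l.getD i d) = (l.map g).sum := by
  induction l generalizing N with
  | nil => simp [hd]
  | cons a l ih =>
    obtain ⟨N, rfl⟩ := Nat.exists_eq_add_of_lt (Nat.lt_of_lt_of_le (Nat.succ_pos _) hN)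
    rw [zero_add, Finset.sum_range_succ']
    simp only [List.getD_cons_succ, List.getD_cons_zero, List.map_cons, List.sum_cons]
    rw [ih (by simpa using hN), add_comm]

/-! ### Correctness and cost of the matrix-vector product -/

section
variable {p q : ℝ[X]} {e c : ℕ} {L : Expr} (hp : p.natDegree < 2 ^ e) (hq : q.natDegree < 2 ^ e)
  (hL : ∀ (F : List Expr) (y v : ℝ), Eval F [.pair (.num y) (.num v)] L
    (.pair (polyVal e (C v * taylor y p)) (polyVal e (taylor y q))) c)
  {F : List Expr} (hF : Extends (cordialFuns L e) F)

include hF in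
-- Division is performed only at the indices of actual entries; at padding points the denominator
-- may vanish. Taking the first component of a leaf extracts the real part.
theorem fn_quot {k : ℕ} (P Q : ℕ → ℂ) (l : List Val) (i : ℕ) (hi : i + l.length ≤ 2 ^ k)
    (hQ : ∀ j < i + l.length, (Q j).re ≠ 0) :
    Fn F 16 (.pair (Val.ofList l) (.pair (.num i) (.pair (.num (2 ^ k))
        (.pair (seqVal k P) (seqVal k Q)))))
      (Val.ofList ((List.range' i l.length).map fun j => .num ((P j).re / (Q j).re)))
      (200 * (k + 1) * l.length + 20) := by
  induction l generalizing i with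
  | nil =>
    refine Fn.of_W (hF 16 quotBody rfl) ?_
    simp only [wp, quotBody, ofList_nil]
    exact ⟨by simp [ofList_nil], by norm_num⟩
  | cons a l ih =>
    rw [List.length_cons] at hi hQ
    have ih' := ih (i + 1) (by omega) fun j hj => hQ j (by omega)
    rw [Nat.cast_succ] at ih'
    refine Fn.of_W (hF 16 quotBody rfl) ?_
    simp only [wp, quotBody, ofList_cons]
    refine (fn_lookup (extends_treeFuns hF) (show i < 2 ^ k by omega) _).use fun t₁ h₁ => ?_
    simp only [wp, cVal]
    refine (fn_lookup (extends_treeFuns hF) (show i < 2 ^ k by omega) _).use fun t₂ h₂ => ?_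
    simp only [wp, cVal]
    refine ⟨hQ i (by omega), ih'.use fun t₃ h₃ => ⟨rfl, ?_⟩⟩
    rw [List.length_cons]
    have e₁ : 200 * (k + 1) * (l.length + 1) = 200 * (k + 1) * l.length + 200 * k + 200 := by ring
    rw [e₁]
    omega

include hp hq hL hF

/-- A node with 2 ^ k leaves carries polynomials of length 2 ^ (k + e), and needs three products and
one sum; each level thus costs O(k 2 ^ k) for fixed p and q. -/
theorem fn_fracSum (k : ℕ) (y v : ℕ → ℝ) :
    Fn F 15 (treeVal k fun i => .pair (.num (y i)) (.num (v i)))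
      (.pair (polyVal (k + e) (fracNum p q k y v)) (polyVal (k + e) (fracDen q k y)))
      ((c + 20000 * (2 ^ e * (e + 1) ^ 2)) * ((k + 1) ^ 2 * 2 ^ k)) := by
  induction k generalizing y v with
  | zero =>
    refine Fn.of_W (hF 15 fracSumBody rfl) ?_
    simp only [wp, fracSumBody, treeVal]
    rw [zero_add]
    refine ⟨_, c, ⟨_, hF 14 L rfl, hL F (y 0) (v 0)⟩, rfl, ?_⟩
    have : 0 < 2 ^ e * (e + 1) ^ 2 := by positivity
    rw [zero_add, one_pow, one_mul, pow_zero, mul_one]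
    omega
  | succ k ih =>
    have hS := extends_seqFuns (extends_treeFuns hF)
    have hleaf : ∃ a b, (treeVal k fun i => Val.pair (.num (y i)) (.num (v i))) = .pair a b := by
      cases k <;> exact ⟨_, _, rfl⟩
    have hmul : ∀ A B : ℝ[X], A.natDegree < 2 ^ (k + e) → B.natDegree < 2 ^ (k + e) →
        Fn F 3 (.pair (polyVal (k + e) A) (polyVal (k + e) B)) (polyVal (k + e + 1) (A * B))
          (5000 * ((2 ^ e * (e + 1) ^ 2) * ((k + 1) * 2 ^ k))) := by
      intro A B hA hB
      have := fn_mul_poly hS (A := A.map (algebraMap ℝ ℂ)) (B := B.map (algebraMap ℝ ℂ))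
        (natDegree_map_le.trans_lt hA) (natDegree_map_le.trans_lt hB)
      rw [← Polynomial.map_mul] at this
      rw [polyVal_eq, polyVal_eq, polyVal_eq]
      refine this.mono ?_
      calc 5000 * (k + e + 1) * 2 ^ (k + e)
          ≤ 5000 * ((k + 1) * (e + 1)) * 2 ^ (k + e) := by gcongr; exact add_add_one_le_mul k e
        _ = 5000 * ((2 ^ e * (e + 1) ^ 1) * ((k + 1) * 2 ^ k)) := by ring
        _ ≤ _ := by
          gcongr
          · omega
          · norm_num
    have hDy := natDegree_fracDen_lt hq k y
    have hDy' := natDegree_fracDen_lt hq k fun i => y (i + 2 ^ k)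
    have hNy := natDegree_fracNum_lt hp hq k y v
    have hNy' := natDegree_fracNum_lt hp hq k (fun i => y (i + 2 ^ k)) fun i => v (i + 2 ^ k)
    have ih₁ := ih y v
    refine Fn.of_W (hF 15 fracSumBody rfl) ?_
    obtain ⟨a, b, hab⟩ := hleaf
    rw [treeVal, hab]
    rw [hab] at ih₁
    simp only [wp, fracSumBody]
    refine ih₁.use fun t₁ h₁ =>
      (ih (fun i => y (i + 2 ^ k)) fun i => v (i + 2 ^ k)).use fun t₂ h₂ => ?_
    simp only [wp, lin, cconst]
    refine (hmul _ _ hNy hDy').use fun t₃ h₃ => (hmul _ _ hNy' hDy).use fun t₄ h₄ =>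
      (fn_lin hS (k + e + 1) 1 1 _ _).use fun t₅ h₅ => (hmul _ _ hDy hDy').use fun t₆ h₆ => ⟨?_, ?_⟩
    · rw [add_right_comm k 1 e, fracNum, fracDen]
      congr 1
      refine seqVal_congr fun i _ => ?_
      rw [coeff_add, Complex.ofReal_add, one_mul, one_mul]
    · have h5 : t₅ ≤ 600 * ((2 ^ e * (e + 1) ^ 2) * ((k + 1) * 2 ^ k)) := by
        refine h₅.trans ((Nat.sub_le _ _).trans ?_)
        calc 300 * 2 ^ (k + e + 1) = 600 * ((2 ^ e * 1) * (1 * 2 ^ k)) := by ring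
          _ ≤ _ := by
            gcongr
            · exact Nat.one_le_pow _ _ (by omega)
            · omega
      have hpos : 0 < (2 ^ e * (e + 1) ^ 2) * ((k + 1) * 2 ^ k) :=
        Nat.mul_pos (Nat.mul_pos (Nat.pow_pos two_pos) (Nat.pow_pos (Nat.succ_pos e)))
          (Nat.mul_pos (Nat.succ_pos k) (Nat.pow_pos two_pos))
      have e₁ : (c + 20000 * (2 ^ e * (e + 1) ^ 2)) * ((k + 1 + 1) ^ 2 * 2 ^ (k + 1)) =
        2 * ((c + 20000 * (2 ^ e * (e + 1) ^ 2)) * ((k + 1) ^ 2 * 2 ^ k)) +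
        80000 * ((2 ^ e * (e + 1) ^ 2) * ((k + 1) * 2 ^ k)) +
        (c * (2 * k + 3) * 2 ^ (k + 1) + 40000 * (2 ^ e * (e + 1) ^ 2) * 2 ^ k) := by
        ring
      rw [e₁]
      omega

/-- The x are padded by 0 to 2 ^ (k + e) points, as many as the polynomials have coefficients. The y
are padded by the first y with weight 0, which keeps the denominators nonzero at the x. The bound K
is free, so that a recursion can charge all its calls with one and the same logarithm. -/
theorem fn_cordial (xs : List ℝ) (zs : List (ℝ × ℝ)) (hz : zs ≠ [])
    (H : ∀ x ∈ xs, ∀ z ∈ zs, q.eval (x + z.1) ≠ 0) {K : ℕ} (hK : xs.length + zs.length ≤ 2 ^ K) :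
    Fn F 17 (.pair (Val.ofList (xs.map .num)) (.pair (Val.ofList (zs.map fun z => .num z.1))
        (Val.ofList (zs.map fun z => .num z.2))))
      (Val.ofList (xs.map fun x =>
        .num (zs.map fun z => z.2 * (p.eval (x + z.1) / q.eval (x + z.1))).sum))
      (8 * (c + 200000 * (2 ^ e * (e + 1) ^ 2)) * ((xs.length + zs.length) * (K + 1) ^ 2)) := by
  have hT := extends_treeFuns hF
  obtain ⟨z₀, zs', hzs⟩ := List.exists_cons_of_ne_nil hz
  obtain ⟨k, hk₁, hk₂, hgrow⟩ := fn_grow hT (n := xs.length + zs.length) 0 (by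
    have := List.length_pos_iff.2 hz
    rw [pow_zero]
    omega)
  have hpow : ((2 : ℝ) ^ k * 2 ^ e) = 2 ^ (k + e) := (pow_add _ _ _).symm
  set x : ℕ → ℝ := fun i => xs.getD i 0
  set z : ℕ → ℝ × ℝ := fun i => zs.getD i (z₀.1, 0)
  have hx : (treeVal (k + e) fun i => (xs.map Val.num).getD i (.num 0)) =
      treeVal (k + e) fun i => .num (x i) := by
    congr 1
    ext i
    exact List.getD_map ..
  have hzt : (treeVal k fun i => (zs.map fun z => Val.pair (.num z.1) (.num z.2)).getD i
      (.pair (.num z₀.1) (.num 0))) = treeVal k fun i => .pair (.num (z i).1) (.num (z i).2) := by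
    congr 1
    ext i
    exact List.getD_map (d := (z₀.1, (0 : ℝ))) (l := zs)
      (f := fun z : ℝ × ℝ => Val.pair (.num z.1) (.num z.2))
  set N := fracNum p q k (fun i => (z i).1) fun i => (z i).2
  set D := fracDen q k fun i => (z i).1
  have hbx := fn_build hT (k + e) (xs.map Val.num) (.num 0)
  rw [hx] at hbx
  have hbz := fn_build hT k (zs.map fun z => Val.pair (.num z.1) (.num z.2))
    (.pair (.num z₀.1) (.num 0))
  rw [hzt] at hbz
  have hzip := fn_zip hT zs (fun z => .num z.1) fun z => .num z.2
  have hev : ∀ A : ℝ[X], A.natDegree < 2 ^ (k + e) → Fn F 12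
      (.pair (prodTreeVal (k + e) fun i => (x i : ℂ)) (polyVal (k + e) A))
      (seqVal (k + e) fun i => ((A.eval (x i) : ℝ) : ℂ)) (50000 * (k + e + 1) ^ 2 * 2 ^ (k + e)) := by
    intro A hA
    have := fn_eval hT (k + e) (fun i => (x i : ℂ)) (P := A.map (algebraMap ℝ ℂ))
      (natDegree_map_le.trans_lt hA)
    rw [← polyVal_eq] at this
    convert this using 3 with i
    rw [eval_map]
    exact (eval₂_at_apply (algebraMap ℝ ℂ) (x i)).symm
  have hlen : xs.length ≤ 2 ^ (k + e) := by
    rw [pow_add]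
    exact (show xs.length ≤ 2 ^ k by omega).trans (Nat.le_mul_of_pos_right _ (by positivity))
  have hne : ∀ j < xs.length, ∀ i, q.eval (x j + (z i).1) ≠ 0 := by
    intro j hj i
    have h₁ : x j ∈ xs := by
      simp only [x, List.getD_eq_getElem?_getD, List.getElem?_eq_getElem hj, Option.getD_some]
      exact List.getElem_mem _
    by_cases hi : i < zs.length
    · have h₂ : z i ∈ zs := by
        simp only [z, List.getD_eq_getElem?_getD, List.getElem?_eq_getElem hi, Option.getD_some]
        exact List.getElem_mem _
      exact H _ h₁ _ h₂
    -- A padding index repeats the first y, so it adds no new condition on the denominator.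
    · have h₂ : z i = (z₀.1, 0) := by
        simp only [z, List.getD_eq_getElem?_getD, List.getElem?_eq_none (not_lt.1 hi),
          Option.getD_none]
      rw [h₂]
      exact H _ h₁ z₀ (by simp [hzs])
  have hquot := fn_quot hF (k := k + e) (fun i => ((N.eval (x i) : ℝ) : ℂ))
    (fun i => ((D.eval (x i) : ℝ) : ℂ))
    (xs.map Val.num) 0 (by simpa using hlen) (by
      intro j hj
      rw [zero_add, List.length_map] at hj
      rw [Complex.ofReal_re]
      exact eval_fracDen_ne_zero k _ (hne j hj))
  have hres : ((List.range' 0 xs.length).map fun j => Val.num (N.eval (x j) / D.eval (x j))) =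
      xs.map fun x => Val.num (zs.map fun z => z.2 * (p.eval (x + z.1) / q.eval (x + z.1))).sum := by
    refine List.ext_getElem (by simp) fun j h₁ h₂ => ?_
    rw [List.length_map] at h₂
    have hxj : x j = xs[j] := by
      simp only [x, List.getD_eq_getElem?_getD, List.getElem?_eq_getElem h₂, Option.getD_some]
    simp only [List.getElem_map, List.getElem_range', zero_add, one_mul]
    rw [eval_fracNum_div k _ _ (hne j h₂), ← hxj]
    congr 1
    exact sum_range_getD zs (z₀.1, 0)
      (fun z => z.2 * (p.eval (x j + z.1) / q.eval (x j + z.1))) (zero_mul _) (by omega)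
  simp only [List.length_map, Complex.ofReal_re, hres, Nat.cast_zero] at hquot
  obtain ⟨w, hhead⟩ : ∃ w, Val.ofList (zs.map fun z => .num z.1) = .pair (.num z₀.1) w := by
    rw [hzs]
    exact ⟨_, rfl⟩
  refine Fn.of_W (hF 17 (cordialBody e) rfl) ?_
  simp only [wp, cordialBody]
  refine (fn_len hT _).use fun t₁ h₁ => ?_
  simp only [wp]
  refine (fn_len hT _).use fun t₂ h₂ => ?_
  simp only [wp, List.length_map]
  rw [Nat.cast_add, pow_zero] at hgrow
  refine hgrow.use fun t₃ h₃ => ?_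
  simp only [wp, hpow]
  refine hbx.use fun t₄ h₄ => ?_
  simp only [wp]
  refine (fn_prodTree hT _ _).use fun t₅ h₅ => ?_
  refine hzip.use fun t₆ h₆ => ?_
  simp only [hhead, wp]
  refine hbz.use fun t₇ h₇ => ?_
  simp only [wp]
  refine (fn_fracSum hp hq hL hF k (fun i => (z i).1) fun i => (z i).2).use fun t₈ h₈ => ?_
  simp only [wp]
  refine (hev _ (natDegree_fracNum_lt hp hq k _ _)).use fun t₉ h₉ =>
    (hev _ (natDegree_fracDen_lt hq k _)).use fun t₁₀ h₁₀ => hquot.use fun t₁₁ h₁₁ => ⟨rfl, ?_⟩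
  rw [List.length_map] at h₁ h₂
  set n := xs.length + zs.length
  set B := 2 ^ e * (e + 1) ^ 2
  set Y := (k + 1) ^ 2 * 2 ^ k
  have hBY : (k + e + 1) ^ 2 * 2 ^ (k + e) ≤ B * Y := by
    calc (k + e + 1) ^ 2 * 2 ^ (k + e) ≤ ((k + 1) * (e + 1)) ^ 2 * 2 ^ (k + e) := by
          gcongr
          exact add_add_one_le_mul k e
      _ = B * Y := by ring
  have hB : 1 ≤ B := Nat.mul_pos (Nat.pow_pos two_pos) (Nat.pow_pos (Nat.succ_pos e))
  have hYk : 2 ^ k ≤ Y := Nat.le_mul_of_pos_left _ (Nat.pow_pos (Nat.succ_pos k))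
  have hkY : k + 1 ≤ Y := (Nat.lt_two_pow_self (n := k)).trans_le hYk
  have hY : Y ≤ B * Y := Nat.le_mul_of_pos_left _ hB
  have hxs : xs.length ≤ n := Nat.le_add_right _ _
  have hzl : zs.length ≤ n := Nat.le_add_left _ _
  have h4' : 2 ^ (k + e) ≤ B * Y :=
    (Nat.le_mul_of_pos_left _ (Nat.pow_pos (Nat.succ_pos _))).trans hBY
  have h11' : (k + e + 1) * xs.length ≤ B * Y := by
    refine (Nat.mul_le_mul ?_ hlen).trans hBY
    exact Nat.le_self_pow two_ne_zero _
  -- From 2 ^ k ≤ 2n ≤ 2 ^ (K + 1).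
  have hkK : k ≤ K + 1 := by
    rw [← Nat.pow_le_pow_iff_right (a := 2) (by norm_num), pow_succ]
    omega
  have hYK : Y ≤ 8 * (n * (K + 1) ^ 2) := by
    calc Y ≤ (2 * (K + 1)) ^ 2 * (2 * n) := by
          refine Nat.mul_le_mul (Nat.pow_le_pow_left ?_ 2) hk₂
          omega
      _ = 8 * (n * (K + 1) ^ 2) := by ring
  have hfin : (c + 200000 * B) * Y ≤ 8 * (c + 200000 * B) * (n * (K + 1) ^ 2) := by
    calc (c + 200000 * B) * Y ≤ (c + 200000 * B) * (8 * (n * (K + 1) ^ 2)) :=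
          Nat.mul_le_mul_left _ hYK
      _ = 8 * (c + 200000 * B) * (n * (K + 1) ^ 2) := by ring
  refine le_trans ?_ hfin
  rw [add_mul, mul_assoc] at h₈ ⊢
  rw [mul_assoc] at h₅ h₉ h₁₀ h₁₁
  omega

end

/-! ### Cordiality of rational functions -/

/-- The binary logarithm is comparable with log n for n ≥ 2; the extra factor (log n / log 2) ^ ε is
at least 1. -/
theorem exists_clog_pow_le (d : ℕ) {ε : ℝ} (hε : 0 < ε) : ∃ C : ℝ, 0 ≤ C ∧ ∀ n : ℕ, 2 ≤ n →
    ((Nat.clog 2 n : ℝ) + 1) ^ d ≤ C * Real.log n ^ ((d : ℝ) + ε) := by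
  have h2 : 0 < Real.log 2 := Real.log_pos one_lt_two
  refine ⟨(3 / Real.log 2) ^ d / Real.log 2 ^ ε, by positivity, fun n hn => ?_⟩
  have hn' : (2 : ℝ) ≤ n := by exact_mod_cast hn
  have hlog : Real.log 2 ≤ Real.log n := Real.log_le_log two_pos hn'
  have h0 : 0 < Real.log n := h2.trans_le hlog
  have hK : (Nat.clog 2 n : ℝ) + 1 ≤ 3 / Real.log 2 * Real.log n := by
    rw [← Real.natCeil_logb_natCast]
    have h₁ := Nat.ceil_lt_add_one (a := Real.logb (2 : ℕ) n)
      (Real.logb_nonneg (by norm_num) (by linarith))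
    have h₂ : 1 ≤ Real.log n / Real.log 2 := by rwa [one_le_div h2]
    have h₃ : Real.logb (2 : ℕ) n = Real.log n / Real.log 2 := by simp [Real.logb]
    rw [h₃] at h₁ ⊢
    rw [div_mul_eq_mul_div, mul_div_assoc]
    linarith
  calc ((Nat.clog 2 n : ℝ) + 1) ^ d ≤ (3 / Real.log 2 * Real.log n) ^ d := by gcongr
    _ = (3 / Real.log 2) ^ d * Real.log n ^ d * 1 := by rw [mul_pow, mul_one]
    _ ≤ (3 / Real.log 2) ^ d * Real.log n ^ d * (Real.log n ^ ε / Real.log 2 ^ ε) := by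
        gcongr
        rw [one_le_div (by positivity)]
        gcongr
    _ = (3 / Real.log 2) ^ d / Real.log 2 ^ ε * Real.log n ^ ((d : ℝ) + ε) := by
        rw [Real.rpow_add h0, Real.rpow_natCast]
        ring

theorem exists_two_pow_bound (p q : ℝ[X]) : ∃ e, p.natDegree < 2 ^ e ∧ q.natDegree < 2 ^ e :=
  ⟨max p.natDegree q.natDegree,
    (le_max_left _ _).trans_lt Nat.lt_two_pow_self, (le_max_right _ _).trans_lt Nat.lt_two_pow_self⟩

theorem Val.vec_eq {n : ℕ} (x : Fin n → ℝ) : Val.vec x = Val.ofList ((List.ofFn x).map .num) := by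
  rw [Val.vec, Val.ofFn, List.map_ofFn]
  rfl

theorem isCordialOn_rational (p q : ℝ[X]) {ε : ℝ} (hε : 0 < ε) :
    IsCordialOn (fun x => p.eval x / q.eval x) {x | q.eval x ≠ 0} (2 + ε) := by
  obtain ⟨e, hp, hq⟩ := exists_two_pow_bound p q
  obtain ⟨L, c, hL⟩ := exists_leaf_expr p q e
  obtain ⟨C, hC, hlog⟩ := exists_clog_pow_le 2 hε
  set A := 8 * (c + 200000 * (2 ^ e * (e + 1) ^ 2)) with hA
  refine ⟨⟨cordialFuns L e, .call 17 (.var 0)⟩, (A + 2) * C, fun a b ha hb x y v H => ?_⟩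
  set zs := List.ofFn fun i => (y i, v i) with hzs
  have hfn := fn_cordial hp hq hL (F := cordialFuns L e) (fun _ _ h => h) (List.ofFn x) zs
    (by rw [hzs, ne_eq, List.ofFn_eq_nil_iff]; omega) (by
      intro s hs z hz
      rw [List.mem_ofFn'] at hs hz
      obtain ⟨i, rfl⟩ := hs
      obtain ⟨j, rfl⟩ := hz
      exact H i j) (K := Nat.clog 2 (a + b)) (by
      rw [hzs, List.length_ofFn, List.length_ofFn]
      exact Nat.le_pow_clog one_lt_two _)
  obtain ⟨t, ht, body, hb₁, hb₂⟩ := hfn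
  refine ⟨1 + t + 1, ?_, ?_⟩
  · have hy : Val.vec y = Val.ofList (zs.map fun z => .num z.1) := by
      rw [Val.vec_eq, hzs, List.map_ofFn, List.map_ofFn]
      rfl
    have hv : Val.vec v = Val.ofList (zs.map fun z => .num z.2) := by
      rw [Val.vec_eq, hzs, List.map_ofFn, List.map_ofFn]
      rfl
    have hr : Val.vec (Matrix.mulVec (Matrix.of fun i j => p.eval (x i + y j) / q.eval (x i + y j)) v)
        = Val.ofList ((List.ofFn x).map fun s =>
          .num (zs.map fun z => z.2 * (p.eval (s + z.1) / q.eval (s + z.1))).sum) := by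
      rw [Val.vec_eq, List.map_ofFn, List.map_ofFn]
      congr 2
      ext i
      simp [hzs, List.map_ofFn, List.sum_ofFn, Matrix.mulVec, dotProduct, Function.comp_def,
        mul_comm]
    rw [hy, hv, hr, Val.vec_eq]
    exact .call hb₁ (.var rfl) hb₂
  · rw [hzs, List.length_ofFn, List.length_ofFn, ← hA] at ht
    have hn : 2 ≤ a + b := by omega
    have h := hlog (a + b) hn
    -- Lets the constant 2 in A + 2 absorb the two steps that the main expression spends on its
    -- variable and the call.
    have hpos : 1 ≤ (a + b) * (Nat.clog 2 (a + b) + 1) ^ 2 :=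
      Nat.mul_pos (by omega) (Nat.pow_pos (Nat.succ_pos _))
    have ht' : 1 + t + 1 ≤ (A + 2) * ((a + b) * (Nat.clog 2 (a + b) + 1) ^ 2) := by
      rw [add_mul]
      omega
    have ht'' : ((1 + t + 1 : ℕ) : ℝ) ≤
        ((A + 2) * ((a + b) * (Nat.clog 2 (a + b) + 1) ^ 2) : ℕ) := by
      exact_mod_cast ht'
    refine ht''.trans ?_
    push_cast at h ⊢
    calc ((A : ℝ) + 2) * ((a + b) * ((Nat.clog 2 (a + b) : ℝ) + 1) ^ 2)
        ≤ (A + 2) * ((a + b) * (C * Real.log (a + b) ^ (2 + ε))) := by gcongr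
      _ = _ := by ring

/-! ### Weighted forests -/

/-- A forest hanging from a point: in `cons c w C R` the vertex `c` hangs from the point by an edge
of weight `w`, the forest `C` hangs from `c`, and the forest `R` hangs from the point. -/
inductive Forest (V : Type) : Type
  | nil : Forest V
  | cons : V → ℝ → Forest V → Forest V → Forest V

namespace Forest

variable {V : Type}

/-- The number of vertices. -/
def size : Forest V → ℕ
  | nil => 0
  | cons _ _ C R => C.size + R.size + 1

/-- The vertices with their distances from a point at distance `d` from the root point. -/
noncomputable def entries : Forest V → ℝ → List (V × ℝ)
  | nil, _ => []
  | cons c w C R, d => (c, w + d) :: (C.entries (w + d) ++ R.entries d)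

theorem length_entries (F : Forest V) (d : ℝ) : (F.entries d).length = F.size := by
  induction F generalizing d with
  | nil => rfl
  | cons c w C R hC hR => simp [entries, size, hC, hR]

/-- Adding a constant to all distances. -/
noncomputable def shiftBy (d : ℝ) (A : Multiset (V × ℝ)) : Multiset (V × ℝ) :=
  A.map fun a => (a.1, a.2 + d)

theorem entries_eq_shiftBy (F : Forest V) (d : ℝ) :
    (F.entries d : Multiset (V × ℝ)) = shiftBy d (F.entries 0) := by
  induction F generalizing d with
  | nil => rfl
  | cons c w C R hC hR =>
    rw [entries, entries, ← Multiset.cons_coe, ← Multiset.cons_coe, ← Multiset.coe_add,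
      ← Multiset.coe_add, hC, hR, shiftBy, shiftBy, shiftBy, Multiset.map_cons, Multiset.map_add,
      hC (w + 0), shiftBy, Multiset.map_map]
    simp [add_assoc]

/-- The pairs of a vertex of `A` and a vertex of `B`, with their distances. -/
noncomputable def cross (A B : Multiset (V × ℝ)) : Multiset ((V × V) × ℝ) :=
  A.bind fun a => B.map fun b => ((a.1, b.1), a.2 + b.2)

/-- The pairs of vertices of different sets, with their distances. -/
noncomputable def cross₂ (A B : Multiset (V × ℝ)) : Multiset ((V × V) × ℝ) := cross A B + cross B A

theorem cross_add_left (A B C : Multiset (V × ℝ)) : cross (A + B) C = cross A C + cross B C :=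
  Multiset.add_bind ..

theorem cross_add_right (A B C : Multiset (V × ℝ)) : cross A (B + C) = cross A B + cross A C := by
  simp [cross, Multiset.map_add, Multiset.bind_add]

/-- Only sums of two distances matter, so an offset can be moved from one side to the other. -/
theorem cross_shiftBy (A B : Multiset (V × ℝ)) (d : ℝ) :
    cross (shiftBy d A) B = cross A (shiftBy d B) := by
  simp [cross, shiftBy, Multiset.bind_map, Multiset.map_map, add_assoc, add_comm d]

theorem cross₂_comm (A B : Multiset (V × ℝ)) : cross₂ A B = cross₂ B A := add_comm _ _

theorem cross₂_add_left (A B C : Multiset (V × ℝ)) :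
    cross₂ (A + B) C = cross₂ A C + cross₂ B C := by
  rw [cross₂, cross₂, cross₂, cross_add_left, cross_add_right]
  abel

theorem cross₂_add_right (A B C : Multiset (V × ℝ)) :
    cross₂ A (B + C) = cross₂ A B + cross₂ A C := by
  rw [cross₂_comm, cross₂_add_left, cross₂_comm B, cross₂_comm C]

theorem cross₂_shiftBy (A B : Multiset (V × ℝ)) (d : ℝ) :
    cross₂ (shiftBy d A) B = cross₂ A (shiftBy d B) := by
  rw [cross₂, cross₂, cross_shiftBy, ← cross_shiftBy B]

/-- The pairs of vertices of a forest, with their distances. -/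
noncomputable def pairs : Forest V → Multiset ((V × V) × ℝ)
  | nil => 0
  | cons c w C R => {((c, c), 0)} + C.pairs + R.pairs +
      cross₂ ({(c, 0)} : Multiset (V × ℝ)) (C.entries 0) +
      cross₂ (({(c, w)} : Multiset (V × ℝ)) + (C.entries w : Multiset (V × ℝ))) (R.entries 0)

/-- A subforest of at most `2 / 3 * n` vertices on the path of the larger subforests, the remaining
forest, the vertices of the latter with their distances from the root point of the subforest,
and the distance of the two root points. -/
noncomputable def split (n : ℕ) : Forest V → Forest V × Forest V × List (V × ℝ) × ℝ
  | nil => (nil, nil, [], 0)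
  | cons c w C R =>
    if 2 * n < 3 * (cons c w C R).size then
      if C.size < R.size then
        ((R.split n).1, cons c w C (R.split n).2.1,
          (c, (R.split n).2.2.2 + w) :: (C.entries ((R.split n).2.2.2 + w) ++ (R.split n).2.2.1),
          (R.split n).2.2.2)
      else
        ((C.split n).1, cons c w (C.split n).2.1 R,
          (c, (C.split n).2.2.2) :: (R.entries ((C.split n).2.2.2 + w) ++ (C.split n).2.2.1),
          (C.split n).2.2.2 + w)
    else (cons c w C R, nil, [], 0)

theorem split_eq_self {n : ℕ} {F : Forest V} (h : ¬ 2 * n < 3 * F.size) :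
    F.split n = (F, nil, [], 0) := by
  cases F with
  | nil => rfl
  | cons c w C R => rw [split, if_neg h]

/-- The subforest hangs at distance `(F.split n).2.2.2` from the old root point, and its vertices
are further away by just this amount. -/
theorem entries_split (n : ℕ) (F : Forest V) (d : ℝ) : (F.entries d : Multiset (V × ℝ)) =
    (F.split n).2.1.entries d + (F.split n).1.entries ((F.split n).2.2.2 + d) := by
  induction F generalizing d with
  | nil => rfl
  | cons c w C R hC hR =>
    rw [split]
    split_ifs
    · simp only [entries, ← Multiset.cons_coe, ← Multiset.coe_add, hR, Multiset.cons_add]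
      rw [add_assoc]
    · simp only [entries, ← Multiset.cons_coe, ← Multiset.coe_add, hC, Multiset.cons_add]
      rw [add_assoc, add_assoc, add_comm (R.entries d : Multiset (V × ℝ)), add_assoc]
    · simp [entries]

theorem shiftBy_entries (F : Forest V) (d h : ℝ) :
    shiftBy h (F.entries d : Multiset (V × ℝ)) = F.entries (h + d) := by
  rw [entries_eq_shiftBy F d, entries_eq_shiftBy F (h + d)]
  simp [shiftBy, Function.comp_def, add_assoc, add_comm h]

theorem cross₂_entries (A : Multiset (V × ℝ)) (F : Forest V) (h : ℝ) :
    cross₂ A (F.entries h) = cross₂ (F.entries 0) (shiftBy h A) := by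
  rw [entries_eq_shiftBy F h, cross₂_comm, cross₂_shiftBy]

/-- The subforest meets the rest only at its root point, so a distance across the cut is the sum of
the two distances from this point, and distances inside each part are unchanged. The root point need
not belong to the subforest, which is why forests rather than trees are split. -/
theorem pairs_split (n : ℕ) (F : Forest V) : F.pairs =
    (F.split n).1.pairs + (F.split n).2.1.pairs +
      cross₂ ((F.split n).1.entries 0) (F.split n).2.2.1 := by
  induction F with
  | nil => simp [pairs, split, cross₂, cross, entries]
  | cons c w C R hC hR =>
    have single : ∀ h e : ℝ, shiftBy h {(c, e)} = ({(c, h + e)} : Multiset (V × ℝ)) := by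
      intro h e
      simp [shiftBy, add_comm]
    rw [split]
    split_ifs
    · have e₁ := entries_split n R 0
      rw [add_zero] at e₁
      rw [pairs, pairs, hR, e₁]
      generalize R.split n = u
      -- The offset of the subforest is moved to the other side, where it turns distances from the
      -- old root point into distances from the new one.
      have key : cross₂ (({(c, w)} : Multiset (V × ℝ)) + (C.entries w : Multiset (V × ℝ)))
            (u.1.entries u.2.2.2) =
          cross₂ (u.1.entries 0)
            (({(c, u.2.2.2 + w)} : Multiset (V × ℝ)) +
              (C.entries (u.2.2.2 + w) : Multiset (V × ℝ))) := by
        rw [cross₂_entries, ← single, ← shiftBy_entries, shiftBy, Multiset.map_add]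
        rfl
      rw [cross₂_add_right _ (u.2.1.entries 0 : Multiset (V × ℝ)), key, ← Multiset.cons_coe,
        ← Multiset.singleton_add, ← Multiset.coe_add, ← add_assoc {_}, cross₂_add_right _ (_ + _)]
      abel
    · have e₁ := entries_split n C 0
      rw [add_zero] at e₁
      rw [pairs, pairs, hC, e₁, entries_split n C w]
      generalize C.split n = u
      have key₁ : cross₂ ({(c, 0)} : Multiset (V × ℝ)) (u.1.entries u.2.2.2) =
          cross₂ (u.1.entries 0) ({(c, u.2.2.2)} : Multiset (V × ℝ)) := by
        rw [cross₂_entries, single, add_zero]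
      have key₂ : cross₂ (u.1.entries (u.2.2.2 + w) : Multiset (V × ℝ)) (R.entries 0) =
          cross₂ (u.1.entries 0 : Multiset (V × ℝ)) (R.entries (u.2.2.2 + w)) := by
        rw [cross₂_comm, cross₂_entries, shiftBy_entries, add_zero]
      rw [cross₂_add_right _ (u.2.1.entries 0 : Multiset (V × ℝ)), key₁,
        ← add_assoc ({(c, w)} : Multiset (V × ℝ)), cross₂_add_left (_ + _), key₂, ← Multiset.cons_coe,
        ← Multiset.singleton_add, ← Multiset.coe_add, cross₂_add_right _ {_},
        cross₂_add_right]
      abel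
    · simp [pairs, cross₂, cross, entries]

theorem size_split (n : ℕ) (F : Forest V) :
    (F.split n).1.size + (F.split n).2.1.size = F.size := by
  have := congrArg Multiset.card (entries_split n F 0)
  rw [Multiset.card_add, Multiset.coe_card, Multiset.coe_card, Multiset.coe_card, length_entries,
    length_entries, length_entries] at this
  omega

theorem length_split (n : ℕ) (F : Forest V) : (F.split n).2.2.1.length = (F.split n).2.1.size := by
  induction F with
  | nil => rfl
  | cons c w C R hC hR =>
    rw [split]
    split_ifs <;> simp [length_entries, size, hC, hR]
    omega

/-- The last forest on the path before the chosen one has more than 2n / 3 vertices. It consists of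
one vertex and two subforests of which the chosen one is the larger, so its size is at most twice
that of the chosen one plus 1. -/
theorem size_split_bounds {n : ℕ} {F : Forest V} (hF : 2 * n < 3 * F.size) :
    3 * (F.split n).1.size ≤ 2 * n ∧ 2 * n < 3 * (2 * (F.split n).1.size + 1) := by
  induction F with
  | nil => simp [size] at hF
  | cons c w C R hC hR =>
    rw [split, if_pos hF]
    rw [size] at hF
    split_ifs with h
    · by_cases h' : 2 * n < 3 * R.size
      · exact hR h'
      · simp only [split_eq_self h']
        exact ⟨by omega, by omega⟩
    · by_cases h' : 2 * n < 3 * C.size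
      · exact hC h'
      · simp only [split_eq_self h']
        exact ⟨by omega, by omega⟩

end Forest

namespace Expr

/-! ### Programs for trees -/

/-- `(t, (i, (s, e)))` is mapped to the tree `t` of lists with `s` leaves, with `e` added to the
list with the index `i`. -/
noncomputable def updBody : Expr :=
  ifPos (sub (fst (snd (snd arg))) (const 1))
    (letIn (mul (fst (snd (snd arg))) (const (1 / 2)))
      (ifPos (sub (var 0) (fst (snd (var 1))))
        (pair (call 18 (pair (fst (fst (var 1)))
            (pair (fst (snd (var 1))) (pair (var 0) (snd (snd (snd (var 1))))))))
          (snd (fst (var 1))))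
        (pair (fst (fst (var 1)))
          (call 18 (pair (snd (fst (var 1)))
            (pair (sub (fst (snd (var 1))) (var 0)) (pair (var 0) (snd (snd (snd (var 1)))))))))))
    (pair (snd (snd (snd arg))) (fst arg))

/-- `(l, (t, s))` is mapped to the tree `t` of lists with `s` leaves, with all the pairs of an index
and an entry in the list `l` added. -/
noncomputable def scatterBody : Expr :=
  ifPair (fst arg)
    (call 18 (pair (call 19 (pair (snd (fst arg)) (snd arg)))
      (pair (fst (fst (fst arg))) (pair (snd (snd arg)) (snd (fst (fst arg)))))))
    (fst (snd arg))

/-- A list of edges is mapped to the list of edges in both directions. -/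
noncomputable def bothBody : Expr :=
  ifPair arg
    (pair (fst arg) (pair
      (pair (fst (snd (fst arg))) (pair (fst (fst arg)) (snd (snd (fst arg)))))
      (call 20 (snd arg))))
    (const 0)

/-- A forest, given by its first vertex and two forests. -/
noncomputable def forest (i C R : Expr) : Expr :=
  pair (add (add (fst C) (fst R)) (const 1)) (pair i (pair C R))

/-- `(l, (a, (b, (A, (X, s)))))` is mapped to the forest with the root vertices `c ≠ a` in the list `l`
of neighbours of `b`, where the trees `A` and `X` with `s` leaves hold the adjacency lists and the
values of the field. -/
noncomputable def dfsBody : Expr :=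
  ifPair (fst arg)
    (letIn (call 21 (pair (snd (fst arg)) (snd arg)))
      (letIn (fst (fst (fst (var 1))))
        (letIn (sub (var 0) (fst (snd (var 2))))
          (ifPos (mul (var 0) (var 0))
            (letIn (call 21 (pair
                (call 9 (pair (fst (snd (snd (snd (var 3)))))
                  (pair (var 1) (snd (snd (snd (snd (snd (var 3)))))))))
                (pair (fst (snd (snd (var 3)))) (pair (var 1) (snd (snd (snd (var 3))))))))
              (forest (pair (var 2)
                  (pair (call 9 (pair (fst (snd (snd (snd (snd (var 4))))))
                      (pair (var 2) (snd (snd (snd (snd (snd (var 4)))))))))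
                    (snd (fst (fst (var 4))))))
                (var 0) (var 3)))
            (var 2)))))
    (pair (const 0) (const 0))

/-- `(F, (d, l))` is mapped to the list of the vertices of the forest `F` with their distances from a
point at distance `d` from the root point, followed by `l`. -/
noncomputable def entriesBody : Expr :=
  ifPair (snd (fst arg))
    (letIn (add (snd (snd (fst (snd (fst arg))))) (fst (snd arg)))
      (pair (pair (fst (fst (snd (fst (var 1)))))
          (pair (fst (snd (fst (snd (fst (var 1)))))) (var 0)))
        (call 22 (pair (fst (snd (snd (fst (var 1))))) (pair (var 0)
          (call 22 (pair (snd (snd (snd (fst (var 1))))) (snd (var 1)))))))))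
    (snd (snd arg))

/-- The splitting of a forest. -/
noncomputable def splitBody : Expr :=
  ifPos (sub (fst (fst arg)) (snd arg))
    (letIn (fst (snd (fst arg)))
      (letIn (fst (snd (snd (fst (var 1)))))
        (letIn (snd (snd (snd (fst (var 2)))))
          (ifPos (sub (fst (var 0)) (fst (var 1)))
            (letIn (call 23 (pair (var 0) (snd (var 3))))
              (letIn (add (snd (snd (var 0))) (snd (snd (var 3))))
                (pair
                  (pair (fst (fst (var 1))) (forest (var 4) (var 3) (snd (fst (var 1)))))
                  (pair
                    (pair (pair (fst (var 4)) (pair (fst (snd (var 4))) (var 0)))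
                      (call 22 (pair (var 3) (pair (var 0) (fst (snd (var 1)))))))
                    (snd (snd (var 1)))))))
            (letIn (call 23 (pair (var 1) (snd (var 3))))
              (letIn (add (snd (snd (var 0))) (snd (snd (var 3))))
                (pair
                  (pair (fst (fst (var 1))) (forest (var 4) (snd (fst (var 1))) (var 2)))
                  (pair
                    (pair (pair (fst (var 4)) (pair (fst (snd (var 4))) (snd (snd (var 1)))))
                      (call 22 (pair (var 2) (pair (var 0) (fst (snd (var 1)))))))
                    (var 0)))))))))
    (pair (pair (fst arg) (pair (const 0) (const 0))) (pair (const 0) (const 0)))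

/-- The distances in a list of vertices. -/
noncomputable def distsBody : Expr :=
  ifPair arg (pair (snd (snd (fst arg))) (call 24 (snd arg))) (const 0)

/-- The values of the field in a list of vertices. -/
noncomputable def valuesBody : Expr :=
  ifPair arg (pair (fst (snd (fst arg))) (call 25 (snd arg))) (const 0)

/-- `(l, (r, l'))` is mapped to the list of pairs of a vertex in the list `l` and a number in the
list `r`, followed by `l'`. -/
noncomputable def labelBody : Expr :=
  ifPair (fst arg)
    (pair (pair (fst (fst (fst arg))) (fst (fst (snd arg))))
      (call 26 (pair (snd (fst arg)) (pair (snd (fst (snd arg))) (snd (snd arg))))))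
    (snd (snd arg))

/-- `(A, (B, l))` is mapped to the list of the contributions of `B` to the vertices of `A`,
followed by `l`. -/
noncomputable def contribBody : Expr :=
  call 26 (pair (fst arg) (pair
    (call 17 (pair (call 24 (fst arg))
      (pair (call 24 (fst (snd arg))) (call 25 (fst (snd arg))))))
    (snd (snd arg))))

/-- `(F, l)` is mapped to the list of all contributions in `F`, followed by `l`, where `f₀` is the
value of the function at `0`. -/
noncomputable def solveBody (f₀ : ℝ) : Expr :=
  ifPos (sub (fst (fst arg)) (const 1))
    (letIn (call 23 (pair (fst arg) (mul (fst (fst arg)) (const (2 / 3)))))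
      (letIn (call 22 (pair (fst (fst (var 0))) (pair (const 0) (const 0))))
        (call 28 (pair (fst (fst (var 1))) (call 28 (pair (snd (fst (var 1)))
          (call 27 (pair (var 0) (pair (fst (snd (var 1)))
            (call 27 (pair (fst (snd (var 1))) (pair (var 0) (snd (var 2))))))))))))))
    (pair (pair (fst (fst (snd (fst arg)))) (mul (fst (snd (fst (snd (fst arg))))) (const f₀)))
      (snd arg))

/-- The sum of a list of numbers. -/
noncomputable def sumBody : Expr :=
  ifPair arg (add (fst arg) (call 29 (snd arg))) (const 0)

/-- `(l, (i, (t, s)))` is mapped to the list of the sums of the lists in the tree `t` with `s` leaves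
with the indices `i, …, i + |l| - 1`. -/
noncomputable def collectBody : Expr :=
  ifPair (fst arg)
    (pair (call 29 (call 9 (pair (fst (snd (snd arg)))
        (pair (fst (snd arg)) (snd (snd (snd arg)))))))
      (call 30 (pair (snd (fst arg)) (pair (add (fst (snd arg)) (const 1)) (snd (snd arg))))))
    (const 0)

/-- The integration of a scalar field. -/
noncomputable def scalarBody : Expr :=
  letIn (call 7 (pair (call 8 (snd arg)) (const 1)))
    (letIn (fst (call 6 (pair (const 0) (pair (var 0) (const 0)))))
      (letIn (call 19 (pair (call 20 (fst (var 2))) (pair (var 0) (var 1))))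
        (letIn (fst (call 6 (pair (snd (var 3)) (pair (var 2) (const 0)))))
          (letIn (call 21 (pair (call 9 (pair (var 1) (pair (const 0) (var 3))))
              (pair (const (-1)) (pair (const 0) (pair (var 1) (pair (var 0) (var 3)))))))
            (letIn (forest (pair (const 0) (pair (fst (snd (var 5))) (const 0))) (var 0)
                (pair (const 0) (const 0)))
              (letIn (call 28 (pair (var 0) (const 0)))
                (call 30 (pair (snd (var 7)) (pair (const 0)
                  (pair (call 19 (pair (var 0) (pair (var 5) (var 6)))) (var 6)))))))))))

/-- The first column of a matrix. -/
noncomputable def headsBody : Expr :=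
  ifPair arg (pair (fst (fst arg)) (call 32 (snd arg))) (const 0)

/-- A matrix without its first column. -/
noncomputable def tailsBody : Expr :=
  ifPair arg (pair (snd (fst arg)) (call 33 (snd arg))) (const 0)

/-- The integration of a field, column by column. -/
noncomputable def integrateBody : Expr :=
  ifPair (fst (snd arg))
    (call 13 (pair (call 31 (pair (fst arg) (call 32 (snd arg))))
      (call 34 (pair (fst arg) (call 33 (snd arg))))))
    (snd arg)

/-- The functions for the integration of fields on trees. -/
noncomputable def treeIntFuns (L : Expr) (e : ℕ) (f₀ : ℝ) : List Expr :=
  cordialFuns L e ++ [updBody, scatterBody, bothBody, dfsBody, entriesBody, splitBody, distsBody,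
    valuesBody, labelBody, contribBody, solveBody f₀, sumBody, collectBody, scalarBody, headsBody,
    tailsBody, integrateBody]

end Expr

theorem extends_cordialFuns {F : List Expr} {L : Expr} {e : ℕ} {f₀ : ℝ}
    (hF : Extends (treeIntFuns L e f₀) F) : Extends (cordialFuns L e) F :=
  fun i b h => hF i b (by
    rw [treeIntFuns, List.getElem?_append_left (List.getElem?_eq_some_iff.1 h).1]
    exact h)

namespace Forest

variable {V : Type} (lab X : V → ℝ)

/-- A vertex with a number, as data. -/
noncomputable def entryVal (a : V × ℝ) : Val :=
  .pair (.num (lab a.1)) (.pair (.num (X a.1)) (.num a.2))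

/-- The first vertex and the two subforests of a forest as data. -/
noncomputable def body : Forest V → Val
  | nil => .num 0
  | cons c w C R => .pair (entryVal lab X (c, w))
      (.pair (.pair (.num C.size) C.body) (.pair (.num R.size) R.body))

/-- A forest as data; the vertices have the names `lab` and the field has the values `X`. -/
noncomputable def val (G : Forest V) : Val := .pair (.num G.size) (G.body lab X)

/-- A contribution to the field at a vertex, as data. -/
noncomputable def contribVal (a : V × ℝ) : Val := .pair (.num (lab a.1)) (.num a.2)

/-- The contributions of `B` to the vertices of `A`. -/
noncomputable def contrib (f : ℝ → ℝ) (A B : List (V × ℝ)) : List (V × ℝ) :=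
  A.map fun a => (a.1, (B.map fun b => X b.1 * f (a.2 + b.2)).sum)

variable {X} in
-- Lists of contributions are compared through sums against an arbitrary φ, which disregards their
-- order and their grouping by vertex; an indicator φ recovers the value at one vertex.
theorem sum_contrib (f : ℝ → ℝ) (φ : V → ℝ) (A B : List (V × ℝ)) :
    ((contrib X f A B).map fun a => φ a.1 * a.2).sum =
      ((cross (A : Multiset (V × ℝ)) B).map fun e => φ e.1.1 * (X e.1.2 * f e.2)).sum := by
  rw [cross, Multiset.map_bind, Multiset.sum_bind, Multiset.map_coe, Multiset.sum_coe, contrib,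
    List.map_map]
  congr 1
  refine List.map_congr_left fun a _ => ?_
  rw [Multiset.map_map, Multiset.map_coe, Multiset.sum_coe]
  exact (List.sum_map_mul_left ..).symm

end Forest

/-! ### Correctness and cost of the programs for forests -/

section
variable {L : Expr} {e : ℕ} {f₀ : ℝ} {F : List Expr}

variable (hF : Extends (treeIntFuns L e f₀) F)
include hF

theorem fn_upd {k i : ℕ} (hi : i < 2 ^ k) (g : ℕ → Val) (v : Val) :
    Fn F 18 (.pair (treeVal k g) (.pair (.num i) (.pair (.num (2 ^ k)) v)))
      (treeVal k (Function.update g i (.pair v (g i)))) (100 * (k + 1)) := by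
  induction k generalizing i g with
  | zero =>
    refine Fn.of_W (hF 18 updBody rfl) ?_
    simp only [wp, updBody, pow_zero, sub_self, lt_irrefl, if_false]
    obtain rfl : i = 0 := by simpa using hi
    exact ⟨by simp [treeVal], by norm_num⟩
  | succ k ih =>
    refine Fn.of_W (hF 18 updBody rfl) ?_
    simp only [wp, updBody, if_pos (two_pow_succ_pos k), two_pow_half, treeVal]
    by_cases h : i < 2 ^ k
    · have h' : (0 : ℝ) < 2 ^ k - i := by
        rw [sub_pos]
        exact_mod_cast h
      simp only [if_pos h']
      refine (ih h _).use fun t ht => ⟨?_, by omega⟩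
      congr 1
      refine treeVal_congr fun j hj => ?_
      rw [Function.update_of_ne (by omega)]
    · have h' : ¬ (0 : ℝ) < 2 ^ k - i := by
        rw [sub_pos]
        exact_mod_cast h
      have e : (i : ℝ) - 2 ^ k = ((i - 2 ^ k : ℕ) : ℝ) := by
        rw [Nat.cast_sub (not_lt.1 h)]
        simp
      simp only [if_neg h', e]
      refine (ih (by rw [pow_succ] at hi; omega) _).use fun t ht => ⟨?_, by omega⟩
      congr 1
      · refine treeVal_congr fun j hj => ?_
        rw [Function.update_of_ne (by omega)]
      · refine treeVal_congr fun j hj => ?_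
        rw [Nat.sub_add_cancel (not_lt.1 h)]
        by_cases hji : j = i - 2 ^ k
        · subst hji
          rw [Function.update_self, Nat.sub_add_cancel (not_lt.1 h), Function.update_self]
        · rw [Function.update_of_ne hji, Function.update_of_ne (by omega)]

theorem fn_scatter {k : ℕ} (l : List (ℕ × Val)) (hl : ∀ a ∈ l, a.1 < 2 ^ k) :
    Fn F 19 (.pair (Val.ofList (l.map fun a => .pair (.num a.1) a.2))
        (.pair (treeVal k fun _ => .num 0) (.num (2 ^ k))))
      (treeVal k fun i => Val.ofList ((l.filter (·.1 = i)).map (·.2)))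
      (200 * (k + 1) * l.length + 20) := by
  induction l with
  | nil =>
    refine Fn.of_W (hF 19 scatterBody rfl) ?_
    simp only [wp, scatterBody, List.map_nil, ofList_nil, List.filter_nil]
    exact ⟨trivial, by norm_num⟩
  | cons a l ih =>
    refine Fn.of_W (hF 19 scatterBody rfl) ?_
    simp only [wp, scatterBody, List.map_cons, ofList_cons]
    refine (ih fun b hb => hl b (List.mem_cons_of_mem _ hb)).use fun t₁ h₁ =>
      (fn_upd hF (hl a List.mem_cons_self) _ _).use fun t₂ h₂ => ⟨?_, ?_⟩
    · congr 1
      ext i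
      by_cases hi : i = a.1
      · subst hi
        simp [ofList_cons]
      · rw [Function.update_of_ne hi, List.filter_cons_of_neg (by simpa using Ne.symm hi)]
    · rw [List.length_cons]
      have e₁ : 200 * (k + 1) * (l.length + 1) = 200 * (k + 1) * l.length + 200 * k + 200 := by ring
      rw [e₁]
      omega

theorem fn_both {α : Type*} (l : List α) (u v w : α → ℝ) :
    Fn F 20 (Val.ofList (l.map fun a => .pair (.num (u a)) (.pair (.num (v a)) (.num (w a)))))
      (Val.ofList (l.flatMap fun a => [.pair (.num (u a)) (.pair (.num (v a)) (.num (w a))),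
        .pair (.num (v a)) (.pair (.num (u a)) (.num (w a)))])) (50 * l.length + 10) := by
  induction l with
  | nil =>
    refine Fn.of_W (hF 20 bothBody rfl) ?_
    simp only [wp, bothBody, List.map_nil, ofList_nil, List.flatMap_nil]
    exact ⟨trivial, by norm_num⟩
  | cons a l ih =>
    refine Fn.of_W (hF 20 bothBody rfl) ?_
    simp only [wp, bothBody, List.map_cons, ofList_cons]
    refine ih.use fun t ht => ⟨rfl, ?_⟩
    rw [List.length_cons]
    omega

section
variable {V : Type} {lab X : V → ℝ}

open Forest

/-- The accumulator `l` makes concatenation free, so the cost is linear in the size. -/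
theorem fn_entries (G : Forest V) (d : ℝ) (l : List Val) :
    Fn F 22 (.pair (G.val lab X) (.pair (.num d) (Val.ofList l)))
      (Val.ofList ((G.entries d).map (entryVal lab X) ++ l)) (100 * G.size + 20) := by
  induction G generalizing d l with
  | nil =>
    refine Fn.of_W (hF 22 entriesBody rfl) ?_
    simp only [wp, entriesBody, Forest.val, Forest.body]
    exact ⟨rfl, by norm_num⟩
  | cons c w C R hC hR =>
    refine Fn.of_W (hF 22 entriesBody rfl) ?_
    simp only [wp, entriesBody, Forest.val, Forest.body, entryVal]
    refine (hR _ _).use fun t₁ h₁ => (hC _ _).use fun t₂ h₂ => ⟨?_, ?_⟩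
    · simp [entries, ofList_cons, entryVal]
    · rw [Forest.size]
      omega

/-- Each step of the descent lists only the sibling that it leaves behind, so the listed parts are
disjoint and the total cost is linear. -/
theorem fn_split (n : ℕ) (G : Forest V) :
    Fn F 23 (.pair (G.val lab X) (.num (n * (2 / 3))))
      (.pair (.pair ((G.split n).1.val lab X) ((G.split n).2.1.val lab X))
        (.pair (Val.ofList ((G.split n).2.2.1.map (entryVal lab X))) (.num (G.split n).2.2.2)))
      (500 * G.size + 100) := by
  -- The threshold 2n / 3 is passed as a real number; the comparison with it is exact.
  have hpos : ∀ m : ℕ, (0 : ℝ) < m - n * (2 / 3) ↔ 2 * n < 3 * m := by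
    intro m
    rw [← Nat.cast_lt (α := ℝ)]
    push_cast
    constructor <;> intro <;> linarith
  induction G with
  | nil =>
    refine Fn.of_W (hF 23 splitBody rfl) ?_
    simp only [wp, splitBody, Forest.val, hpos, Forest.size]
    rw [if_neg (by omega)]
    exact ⟨by simp [split, Forest.body, Forest.size, Val.ofList], by norm_num⟩
  | cons c w C R hC hR =>
    refine Fn.of_W (hF 23 splitBody rfl) ?_
    have hsub : (0 : ℝ) < R.size - C.size ↔ C.size < R.size := by rw [sub_pos, Nat.cast_lt]
    by_cases h : 2 * n < 3 * (cons c w C R).size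
    · by_cases h' : C.size < R.size
      · rw [split, if_pos h, if_pos h']
        simp only [wp, splitBody, Forest.val, Forest.body, hpos, if_pos h, hsub,
          if_pos h']
        refine hR.use fun t₁ h₁ => ?_
        simp only [wp, entryVal, Forest.val, forest]
        refine (fn_entries hF C _ _).use fun t₂ h₂ => ⟨?_, ?_⟩
        · simp [ofList_cons, Forest.size, entryVal]
        · rw [Forest.size]
          omega
      · rw [split, if_pos h, if_neg h']
        simp only [wp, splitBody, Forest.val, Forest.body, hpos, if_pos h, hsub,
          if_neg h']
        refine hC.use fun t₁ h₁ => ?_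
        simp only [wp, entryVal, Forest.val, forest]
        refine (fn_entries hF R _ _).use fun t₂ h₂ => ⟨?_, ?_⟩
        · simp [ofList_cons, Forest.size, entryVal]
        · rw [Forest.size]
          omega
    · rw [split, if_neg h]
      simp only [wp, splitBody, Forest.val, hpos, if_neg h]
      exact ⟨by simp [Forest.body, Forest.size, Val.ofList], by omega⟩

theorem fn_dists (l : List (V × ℝ)) : Fn F 24 (Val.ofList (l.map (entryVal lab X)))
    (Val.ofList (l.map fun a => .num a.2)) (30 * l.length + 10) := by
  induction l with
  | nil =>
    refine Fn.of_W (hF 24 distsBody rfl) ?_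
    simp only [wp, distsBody, List.map_nil, ofList_nil]
    exact ⟨trivial, by norm_num⟩
  | cons a l ih =>
    refine Fn.of_W (hF 24 distsBody rfl) ?_
    simp only [wp, distsBody, List.map_cons, ofList_cons, entryVal]
    refine ih.use fun t ht => ⟨rfl, ?_⟩
    rw [List.length_cons]
    omega

theorem fn_values (l : List (V × ℝ)) : Fn F 25 (Val.ofList (l.map (entryVal lab X)))
    (Val.ofList (l.map fun a => .num (X a.1))) (30 * l.length + 10) := by
  induction l with
  | nil =>
    refine Fn.of_W (hF 25 valuesBody rfl) ?_
    simp only [wp, valuesBody, List.map_nil, ofList_nil]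
    exact ⟨trivial, by norm_num⟩
  | cons a l ih =>
    refine Fn.of_W (hF 25 valuesBody rfl) ?_
    simp only [wp, valuesBody, List.map_cons, ofList_cons, entryVal]
    refine ih.use fun t ht => ⟨rfl, ?_⟩
    rw [List.length_cons]
    omega

theorem fn_label (l : List (V × ℝ)) (g : V × ℝ → ℝ) (l' : List Val) :
    Fn F 26 (.pair (Val.ofList (l.map (entryVal lab X)))
        (.pair (Val.ofList (l.map fun a => .num (g a))) (Val.ofList l')))
      (Val.ofList ((l.map fun a => contribVal lab (a.1, g a)) ++ l')) (50 * l.length + 20) := by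
  induction l with
  | nil =>
    refine Fn.of_W (hF 26 labelBody rfl) ?_
    simp only [wp, labelBody, List.map_nil, ofList_nil, List.nil_append]
    exact ⟨trivial, by norm_num⟩
  | cons a l ih =>
    refine Fn.of_W (hF 26 labelBody rfl) ?_
    simp only [wp, labelBody, List.map_cons, ofList_cons, entryVal, contribVal]
    refine ih.use fun t ht => ⟨rfl, ?_⟩
    rw [List.length_cons]
    omega

section
variable {p q : ℝ[X]} {c : ℕ} (hp : p.natDegree < 2 ^ e) (hq : q.natDegree < 2 ^ e)
  (hL : ∀ (F : List Expr) (y v : ℝ), Eval F [.pair (.num y) (.num v)] L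
    (.pair (polyVal e (C v * taylor y p)) (polyVal e (taylor y q))) c)
include hp hq hL

theorem fn_contrib (A B : List (V × ℝ)) (hB : B ≠ []) (l : List Val)
    (H : ∀ a ∈ A, ∀ b ∈ B, q.eval (a.2 + b.2) ≠ 0) {K : ℕ} (hK : A.length + B.length ≤ 2 ^ K) :
    Fn F 27 (.pair (Val.ofList (A.map (entryVal lab X)))
        (.pair (Val.ofList (B.map (entryVal lab X))) (Val.ofList l)))
      (Val.ofList (((contrib X (fun x => p.eval x / q.eval x) A B).map (contribVal lab)) ++ l))
      ((8 * (c + 200000 * (2 ^ e * (e + 1) ^ 2)) + 300) * ((A.length + B.length) * (K + 1) ^ 2)) := by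
  have hcor := fn_cordial hp hq hL (extends_cordialFuns hF) (A.map (·.2))
    (B.map fun b => (b.2, X b.1)) (by simpa using hB) (by
      intro x hx z hz
      rw [List.mem_map] at hx hz
      obtain ⟨a, ha, rfl⟩ := hx
      obtain ⟨b, hb, rfl⟩ := hz
      exact H a ha b hb) (K := K) (by simpa using hK)
  simp only [List.map_map, List.length_map, Function.comp_def] at hcor
  refine Fn.of_W (hF 27 contribBody rfl) ?_
  simp only [wp, contribBody]
  refine (fn_dists hF _).use fun t₁ h₁ => (fn_dists hF _).use fun t₂ h₂ =>
    (fn_values hF _).use fun t₃ h₃ => hcor.use fun t₄ h₄ =>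
    (fn_label hF A (fun a => (B.map fun b => X b.1 * (p.eval (a.2 + b.2) /
      q.eval (a.2 + b.2))).sum) l).use fun t₅ h₅ => ⟨?_, ?_⟩
  · rw [contrib, List.map_map]
    rfl
  · have hpos : A.length + B.length ≤ (A.length + B.length) * (K + 1) ^ 2 :=
      Nat.le_mul_of_pos_right _ (Nat.pow_pos (Nat.succ_pos K))
    have hB' := List.length_pos_iff.2 hB
    rw [add_mul]
    omega

end

end

end

/-! ### Divide and conquer on a forest -/

open Forest

/-- The subforest has more than n / 3 - 1 / 2 vertices, so the rest has fewer than 2n / 3 + 1 / 2;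
the bound 5n / 6 absorbs the 1 / 2 for every n ≥ 2. -/
theorem Forest.size_split_le {V : Type} {G : Forest V} (hG : 2 ≤ G.size) :
    1 ≤ (G.split G.size).1.size ∧ 6 * (G.split G.size).1.size ≤ 5 * G.size ∧
      1 ≤ (G.split G.size).2.1.size ∧ 6 * (G.split G.size).2.1.size ≤ 5 * G.size := by
  have h₁ := size_split_bounds (n := G.size) (F := G) (by omega)
  have h₂ := size_split G.size G
  omega

theorem mem_cross {V : Type} {A B : List (V × ℝ)} {a b : V × ℝ} (ha : a ∈ A) (hb : b ∈ B) :
    ((a.1, b.1), a.2 + b.2) ∈ cross (A : Multiset (V × ℝ)) B :=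
  Multiset.mem_bind.2 ⟨a, Multiset.mem_coe.2 ha, Multiset.mem_map.2 ⟨b, Multiset.mem_coe.2 hb, rfl⟩⟩

section
variable {L : Expr} {e : ℕ} {p q : ℝ[X]} {c : ℕ} (hp : p.natDegree < 2 ^ e)
  (hq : q.natDegree < 2 ^ e)
  (hL : ∀ (F : List Expr) (y v : ℝ), Eval F [.pair (.num y) (.num v)] L
    (.pair (polyVal e (C v * taylor y p)) (polyVal e (taylor y q))) c)
  {F : List Expr} (hF : Extends (treeIntFuns L e (p.eval 0 / q.eval 0)) F)
  {V : Type} {lab X : V → ℝ}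

include hp hq hL hF

/-- Each split shrinks both parts to at most 5/6 of the size, so |G| ≤ (6/5) ^ j allows at most j
levels. A split adds one contribution per vertex, and two calls of the matrix-vector product, one
for each direction across the cut. Summation over levels gives the factor j + 1. -/
theorem fn_solve {K : ℕ} (j : ℕ) (G : Forest V) (hG : 1 ≤ G.size) (hj : 5 ^ j * G.size ≤ 6 ^ j)
    (hK : G.size ≤ 2 ^ K) (H : ∀ a ∈ G.pairs, q.eval a.2 ≠ 0) :
    ∃ l : List (V × ℝ),
      (∀ φ : V → ℝ, (l.map fun a => φ a.1 * a.2).sum =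
        (G.pairs.map fun a => φ a.1.1 * (X a.1.2 * (p.eval a.2 / q.eval a.2))).sum) ∧
      l.length ≤ 2 * (G.size * (j + 1)) ∧
      ∀ acc : List Val, Fn F 28 (.pair (G.val lab X) (Val.ofList acc))
        (Val.ofList (l.map (contribVal lab) ++ acc))
        ((2 * (8 * (c + 200000 * (2 ^ e * (e + 1) ^ 2)) + 300) + 1000) *
          ((K + 1) ^ 2 * (G.size * (j + 1)))) := by
  -- A single vertex contributes f(0) times its own value. It can occur on any level, hence the
  -- arbitrary j.
  have single : ∀ (G : Forest V) (j : ℕ), G.size = 1 → ∃ l : List (V × ℝ),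
      (∀ φ : V → ℝ, (l.map fun a => φ a.1 * a.2).sum =
        (G.pairs.map fun a => φ a.1.1 * (X a.1.2 * (p.eval a.2 / q.eval a.2))).sum) ∧
      l.length ≤ 2 * (G.size * (j + 1)) ∧
      ∀ acc : List Val, Fn F 28 (.pair (G.val lab X) (Val.ofList acc))
        (Val.ofList (l.map (contribVal lab) ++ acc))
        ((2 * (8 * (c + 200000 * (2 ^ e * (e + 1) ^ 2)) + 300) + 1000) *
          ((K + 1) ^ 2 * (G.size * (j + 1)))) := by
    intro G j h1
    obtain _ | ⟨v, w, G₁, G₂⟩ := G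
    · simp [Forest.size] at h1
    · have h₁ : G₁ = nil := by
        cases G₁ with
        | nil => rfl
        | cons => simp [Forest.size] at h1
      have h₂ : G₂ = nil := by
        cases G₂ with
        | nil => rfl
        | cons => simp [Forest.size] at h1
      subst h₁ h₂
      refine ⟨[(v, X v * (p.eval 0 / q.eval 0))], fun φ => ?_, ?_, fun acc => ?_⟩
      · simp [pairs, cross₂, cross, entries]
      · simp only [List.length_singleton, h1]
        omega
      · refine Fn.of_W (hF 28 (solveBody _) rfl) ?_
        simp only [wp, solveBody, Forest.val, Forest.body, entryVal, h1, Nat.cast_one, sub_self,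
          lt_irrefl, if_false]
        refine ⟨rfl, ?_⟩
        have : 1 * 1 ≤ (K + 1) ^ 2 * (1 * (j + 1)) :=
          Nat.mul_le_mul (Nat.pow_pos (Nat.succ_pos K)) (by omega)
        have h3 := Nat.mul_le_mul
          (Nat.le_add_left 1000 (2 * (8 * (c + 200000 * (2 ^ e * (e + 1) ^ 2)) + 300))) this
        omega
  induction j generalizing G with
  | zero => exact single G 0 (by simp at hj; omega)
  | succ j ih =>
    by_cases h1 : G.size = 1
    · exact single G (j + 1) h1
    · have h2 : 2 ≤ G.size := by omega
      obtain ⟨hS₁, hS₂, hR₁, hR₂⟩ := size_split_le h2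
      have hsplit := size_split G.size G
      have hpairs := pairs_split G.size G
      have hfn := fn_split hF (lab := lab) (X := X) G.size G
      have hlen := length_split G.size G
      generalize G.split G.size = u at *
      obtain ⟨S, R, B, h⟩ := u
      dsimp only at *
      have hpow : ∀ m : ℕ, 6 * m ≤ 5 * G.size → 5 ^ j * m ≤ 6 ^ j := by
        intro m hm
        have e₁ : 6 * (5 ^ j * m) ≤ 6 * 6 ^ j := by
          calc 6 * (5 ^ j * m) = 5 ^ j * (6 * m) := by ring
            _ ≤ 5 ^ j * (5 * G.size) := Nat.mul_le_mul_left _ hm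
            _ = 5 ^ (j + 1) * G.size := by ring
            _ ≤ 6 ^ (j + 1) := hj
            _ = 6 * 6 ^ j := by ring
        omega
      rw [hpairs] at H
      obtain ⟨lS, hlS, hlS', fS⟩ := ih S hS₁ (hpow _ hS₂) (by omega) fun a ha =>
        H a (Multiset.mem_add.2 (.inl (Multiset.mem_add.2 (.inl ha))))
      obtain ⟨lR, hlR, hlR', fR⟩ := ih R hR₁ (hpow _ hR₂) (by omega) fun a ha =>
        H a (Multiset.mem_add.2 (.inl (Multiset.mem_add.2 (.inr ha))))
      have hlA := length_entries S 0
      set A := S.entries 0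
      -- The nesting follows the accumulators of the four calls, of which the innermost runs first.
      refine ⟨lS ++ (lR ++ (contrib X (fun x => p.eval x / q.eval x) A B ++
        contrib X (fun x => p.eval x / q.eval x) B A)), fun φ => ?_, ?_, fun acc => ?_⟩
      · rw [hpairs, List.map_append, List.map_append, List.map_append, List.sum_append,
          List.sum_append, List.sum_append, hlS, hlR, sum_contrib, sum_contrib, cross₂,
          Multiset.map_add, Multiset.map_add, Multiset.map_add, Multiset.sum_add, Multiset.sum_add,
          Multiset.sum_add, add_assoc]
      · rw [List.length_append, List.length_append, List.length_append, contrib, contrib,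
          List.length_map, List.length_map, hlA, hlen, ← hsplit]
        have e₁ : (S.size + R.size) * (j + 1 + 1) =
          S.size * (j + 1) + R.size * (j + 1) + S.size + R.size := by ring
        rw [e₁]
        omega
      · have hBA := fn_contrib hF (lab := lab) (X := X) hp hq hL B A
          (by rw [← List.length_pos_iff]; omega) acc (fun b hb a ha =>
            H _ (Multiset.mem_add.2 (.inr (Multiset.mem_add.2 (.inr (mem_cross hb ha))))))
          (K := K) (by omega)
        have hAB := fn_contrib hF (lab := lab) (X := X) hp hq hL A B
          (by rw [← List.length_pos_iff]; omega)
          ((contrib X (fun x => p.eval x / q.eval x) B A).map (contribVal lab) ++ acc)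
          (fun a ha b hb =>
            H _ (Multiset.mem_add.2 (.inr (Multiset.mem_add.2 (.inl (mem_cross ha hb))))))
          (K := K) (by omega)
        have hent := fn_entries hF (lab := lab) (X := X) S 0 []
        rw [List.append_nil] at hent
        rw [hlA, hlen] at hAB
        rw [hlA, hlen, add_comm R.size] at hBA
        rw [hsplit] at hAB hBA
        refine Fn.of_W (hF 28 (solveBody _) rfl) ?_
        have hpos : (0 : ℝ) < G.size - 1 := by
          rw [sub_pos]
          exact_mod_cast h2
        simp only [wp, solveBody, Forest.val, if_pos hpos]
        refine hfn.use fun t₁ h₁ => ?_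
        simp only [wp]
        refine hent.use fun t₂ h₂ => hBA.use fun t₃ h₃ => hAB.use fun t₄ h₄ =>
          (fR _).use fun t₅ h₅ => (fS _).use fun t₆ h₆ => ⟨?_, ?_⟩
        · simp only [List.map_append, List.append_assoc]
        · generalize 8 * (c + 200000 * (2 ^ e * (e + 1) ^ 2)) + 300 = D at *
          -- One level more adds |S| + |R| = |G| to the count, which pays for both products and the
          -- linear work of the split.
          have e₁ : (2 * D + 1000) * ((K + 1) ^ 2 * (G.size * (j + 1 + 1))) =
              (2 * D + 1000) * ((K + 1) ^ 2 * (S.size * (j + 1))) +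
              (2 * D + 1000) * ((K + 1) ^ 2 * (R.size * (j + 1))) +
              2 * (D * (G.size * (K + 1) ^ 2)) + 1000 * (G.size * (K + 1) ^ 2) := by
            rw [← hsplit]
            ring
          have e₂ : G.size ≤ G.size * (K + 1) ^ 2 :=
            Nat.le_mul_of_pos_right _ (Nat.pow_pos (Nat.succ_pos K))
          rw [e₁]
          omega

end

/-! ### Rooted forests in graphs -/

section
variable {V : Type}

/-- `IsRooted adj w a b l G`: the forest `G` hangs from the vertex `b`, its root vertices are the
vertices of the list `l` except `a`, and the children of each vertex are its neighbours, as
given by the lists `adj`, except for its parent. -/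
inductive IsRooted (adj : V → List V) (w : Sym2 V → ℝ) : Option V → V → List V → Forest V → Prop
  | nil (a : Option V) (b : V) : IsRooted adj w a b [] .nil
  | skip {a : Option V} {b c : V} {l : List V} {G : Forest V} :
      some c = a → IsRooted adj w a b l G → IsRooted adj w a b (c :: l) G
  | cons {a : Option V} {b c : V} {l : List V} {C R : Forest V} :
      some c ≠ a → IsRooted adj w (some b) c (adj c) C → IsRooted adj w a b l R →
      IsRooted adj w a b (c :: l) (.cons c (w s(b, c)) C R)

variable {G : SimpleGraph V} {adj : V → List V} {w : Sym2 V → ℝ}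

/-- The total weight of a walk. -/
def walkWeight (w : Sym2 V → ℝ) {u v : V} (p : G.Walk u v) : ℝ := (p.edges.map w).sum

/-- In an acyclic graph a walk without immediate backtracking is a path, and paths are unique. The
infimum runs over one element, so negative weights do no harm. -/
theorem weightedDist_eq (hG : G.IsAcyclic) {u v : V} (p : G.Walk u v)
    (hp : p.edges.IsChain (· ≠ ·)) : weightedDist G w u v = walkWeight w p := by
  have hp' := (hG.isPath_iff_isChain p).2 hp
  have : Nonempty (G.Path u v) := ⟨⟨p, hp'⟩⟩
  have h : ∀ q : G.Path u v, ((q : G.Walk u v).edges.map w).sum = walkWeight w p := by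
    intro q
    rw [(hG.subsingleton_path _ _).elim q ⟨p, hp'⟩]
    rfl
  rw [weightedDist]
  simp only [h]
  exact ciInf_const

/-- Both walks are paths with the same ends, so they coincide and have the same second vertex. -/
theorem eq_of_isChain_cons (hG : G.IsAcyclic) {b c c' v : V} {h : G.Adj b c} {h' : G.Adj b c'}
    {p : G.Walk c v} {p' : G.Walk c' v} (hp : (s(b, c) :: p.edges).IsChain (· ≠ ·))
    (hp' : (s(b, c') :: p'.edges).IsChain (· ≠ ·)) : c = c' := by
  have h₁ := (hG.isPath_iff_isChain (p.cons h)).2 hp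
  have h₂ := (hG.isPath_iff_isChain (p'.cons h')).2 hp'
  have := congrArg Subtype.val ((hG.subsingleton_path _ _).elim ⟨_, h₁⟩ ⟨_, h₂⟩)
  simp only [SimpleGraph.Walk.cons.injEq] at this
  exact this.1

theorem not_isChain_cons_self (hG : G.IsAcyclic) {b c : V} {h : G.Adj b c} {p : G.Walk c b} :
    ¬ (s(b, c) :: p.edges).IsChain (· ≠ ·) := by
  intro hp
  have h₁ := (hG.isPath_iff_isChain (p.cons h)).2 hp
  have := congrArg Subtype.val ((hG.subsingleton_path _ _).elim ⟨_, h₁⟩ ⟨.nil, .nil⟩)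
  simp at this

/-- The vertex `v` is reached from `b` by a walk without backtracking of total weight `d`, whose
second vertex is `c`. -/
def Reach (G : SimpleGraph V) (w : Sym2 V → ℝ) (b c v : V) (d : ℝ) : Prop :=
  ∃ (h : G.Adj b c) (p : G.Walk c v), (s(b, c) :: p.edges).IsChain (· ≠ ·) ∧
    walkWeight w (p.cons h) = d

theorem Reach.self {b c : V} (h : G.Adj b c) : Reach G w b c c (w s(b, c)) :=
  ⟨h, .nil, by simp, by simp [walkWeight]⟩

theorem Reach.cons {a b c v : V} {d : ℝ} (h : G.Adj a b) (hac : c ≠ a) (H : Reach G w b c v d) :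
    Reach G w a b v (w s(a, b) + d) := by
  obtain ⟨h', p, hp, rfl⟩ := H
  refine ⟨h, p.cons h', ?_, ?_⟩
  · rw [SimpleGraph.Walk.edges_cons, List.isChain_cons_cons]
    refine ⟨fun he => ?_, hp⟩
    rw [Sym2.eq_iff] at he
    rcases he with ⟨h₁, h₂⟩ | ⟨h₁, h₂⟩
    · exact h.ne h₁
    · exact hac h₁.symm
  · simp [walkWeight]

theorem Reach.exists_walk {b c v : V} {d : ℝ} (H : Reach G w b c v d) :
    ∃ p : G.Walk b v, p.edges.IsChain (· ≠ ·) ∧ walkWeight w p = d := by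
  obtain ⟨h, p, hp, hd⟩ := H
  exact ⟨p.cons h, hp, hd⟩

theorem walkWeight_reverse {u v : V} (p : G.Walk u v) :
    walkWeight w p.reverse = walkWeight w p := by
  rw [walkWeight, walkWeight, SimpleGraph.Walk.edges_reverse, List.map_reverse, List.sum_reverse]

theorem isChain_reverse {u v : V} {p : G.Walk u v} (hp : p.edges.IsChain (· ≠ ·)) :
    p.reverse.edges.IsChain (· ≠ ·) := by
  rw [SimpleGraph.Walk.edges_reverse, List.isChain_reverse]
  exact hp.imp fun _ _ h => h.symm

/-- The first walk is reversed and followed by the second. There is no backtracking at b, because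
the adjacent edges lead to different vertices c and c'. -/
theorem Reach.join {b c c' u v : V} {d d' : ℝ} (hcc : c ≠ c') (H : Reach G w b c u d)
    (H' : Reach G w b c' v d') :
    ∃ p : G.Walk u v, p.edges.IsChain (· ≠ ·) ∧ walkWeight w p = d + d' := by
  obtain ⟨h, p, hp, rfl⟩ := H
  obtain ⟨h', p', hp', rfl⟩ := H'
  refine ⟨(p.cons h).reverse.append (p'.cons h'), ?_, ?_⟩
  · rw [SimpleGraph.Walk.edges_append, List.isChain_append]
    refine ⟨isChain_reverse hp, hp', fun x hx y hy => ?_⟩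
    rw [SimpleGraph.Walk.edges_reverse, SimpleGraph.Walk.edges_cons, List.getLast?_reverse,
      List.head?_cons, Option.mem_some_iff] at hx
    rw [SimpleGraph.Walk.edges_cons, List.head?_cons, Option.mem_some_iff] at hy
    subst hx hy
    intro he
    rw [Sym2.congr_right] at he
    exact hcc he
  · rw [walkWeight, SimpleGraph.Walk.edges_append, List.map_append, List.sum_append]
    congr 1
    exact walkWeight_reverse _

/-- The vertices of a forest. -/
noncomputable def Forest.labels (T : Forest V) : Multiset V :=
  (T.entries 0 : Multiset (V × ℝ)).map (·.1)

theorem Forest.map_fst_entries (T : Forest V) (d : ℝ) :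
    (T.entries d : Multiset (V × ℝ)).map (·.1) = T.labels := by
  rw [labels, entries_eq_shiftBy, shiftBy, Multiset.map_map]
  rfl

theorem Forest.labels_cons (c : V) (x : ℝ) (C R : Forest V) :
    (Forest.cons c x C R).labels = {c} + (C.labels + R.labels) := by
  rw [labels, entries, ← Multiset.cons_coe, ← Multiset.coe_add, Multiset.map_cons, Multiset.map_add,
    map_fst_entries, map_fst_entries, Multiset.singleton_add]

theorem map_fst_cross (A B : Multiset (V × ℝ)) :
    (cross A B).map (·.1) = A.map (·.1) ×ˢ B.map (·.1) := by
  rw [cross, Multiset.map_bind]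
  simp [SProd.sprod, Multiset.product, Multiset.bind_map, Multiset.map_map]

/-- Without distances, the recursion for `pairs` is the expansion of the square of {c} + C + R, with
every ordered pair counted once. -/
theorem Forest.map_fst_pairs (T : Forest V) : T.pairs.map (·.1) = T.labels ×ˢ T.labels := by
  induction T with
  | nil => simp [pairs, labels, entries]
  | cons c x C R hC hR =>
    have h : ({c} : Multiset V) ×ˢ ({c} : Multiset V) = {(c, c)} := rfl
    rw [labels_cons, pairs]
    simp only [cross₂, Multiset.map_add, map_fst_cross, hC, hR, map_fst_entries,
      Multiset.map_singleton, Multiset.add_product, Multiset.product_add,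
      h]
    abel

theorem IsRooted.reach (hadj : ∀ v c, c ∈ adj v ↔ G.Adj v c)
    {a : Option V} {b : V} {l : List V} {T : Forest V} (H : IsRooted adj w a b l T)
    (hl : ∀ c ∈ l, G.Adj b c) (d : ℝ) (x : V × ℝ)
    (hx : x ∈ T.entries d) : ∃ c ∈ l, some c ≠ a ∧ Reach G w b c x.1 (x.2 - d) := by
  induction H generalizing d with
  | nil => simp [entries] at hx
  | skip _ _ ih =>
    obtain ⟨c, hc, h⟩ := ih (fun c hc => hl c (List.mem_cons_of_mem _ hc)) d hx
    exact ⟨c, List.mem_cons_of_mem _ hc, h⟩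
  | @cons a b c l C R hca _ _ ihC ihR =>
    rw [entries, List.mem_cons, List.mem_append] at hx
    have hbc := hl c List.mem_cons_self
    rcases hx with rfl | hx | hx
    · refine ⟨c, List.mem_cons_self, hca, ?_⟩
      rw [add_sub_cancel_right]
      exact .self hbc
    · refine ⟨c, List.mem_cons_self, hca, ?_⟩
      obtain ⟨c', _, hc', h'⟩ := ihC (fun c' hc' => (hadj _ _).1 hc') _ hx
      have := h'.cons hbc fun h => hc' (by rw [h])
      convert this using 1
      ring
    · obtain ⟨c', hc, h⟩ := ihR (fun c hc => hl c (List.mem_cons_of_mem _ hc)) d hx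
      exact ⟨c', List.mem_cons_of_mem _ hc, h⟩

/-- The cases are the summands of `pairs`: pairs of c and a vertex of C come from descending walks,
and pairs across R from two descending walks joined at b. -/
theorem IsRooted.walk_of_mem_pairs (hadj : ∀ v c, c ∈ adj v ↔ G.Adj v c) (hnd : ∀ v, (adj v).Nodup)
    {a : Option V} {b : V} {l : List V} {T : Forest V} (H : IsRooted adj w a b l T)
    (hl : ∀ c ∈ l, G.Adj b c) (hln : l.Nodup) (x : (V × V) × ℝ)
    (hx : x ∈ T.pairs) :
    ∃ p : G.Walk x.1.1 x.1.2, p.edges.IsChain (· ≠ ·) ∧ walkWeight w p = x.2 := by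
  induction H with
  | nil => simp [pairs] at hx
  | skip _ _ ih =>
    exact ih (fun c hc => hl c (List.mem_cons_of_mem _ hc)) (List.nodup_cons.1 hln).2 hx
  | @cons a b c l C R hca hC hR ihC ihR =>
    have hrev : ∀ {u v : V} {d : ℝ},
        (∃ p : G.Walk u v, p.edges.IsChain (· ≠ ·) ∧ walkWeight w p = d) →
        ∃ p : G.Walk v u, p.edges.IsChain (· ≠ ·) ∧ walkWeight w p = d := by
      rintro u v d ⟨p, hp, hd⟩
      exact ⟨p.reverse, isChain_reverse hp, by rw [walkWeight_reverse, hd]⟩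
    have hbc := hl c List.mem_cons_self
    have hadj' : ∀ v, ∀ c ∈ adj v, G.Adj v c := fun v c h => (hadj v c).1 h
    have hl' : ∀ c' ∈ l, G.Adj b c' := fun c' h => hl c' (List.mem_cons_of_mem _ h)
    have hroot : ∀ y ∈ C.entries 0,
        ∃ p : G.Walk c y.1, p.edges.IsChain (· ≠ ·) ∧ walkWeight w p = y.2 := by
      intro y hy
      obtain ⟨c', _, _, h⟩ := hC.reach hadj (hadj' c) 0 y hy
      rw [sub_zero] at h
      exact h.exists_walk
    have hjoin : ∀ y ∈ ({(c, w s(b, c))} : Multiset (V × ℝ)) +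
        (C.entries (w s(b, c)) : Multiset (V × ℝ)), ∀ z ∈ R.entries 0,
        ∃ p : G.Walk y.1 z.1, p.edges.IsChain (· ≠ ·) ∧ walkWeight w p = y.2 + z.2 := by
      intro y hy z hz
      obtain ⟨c', hc', _, h⟩ := hR.reach hadj hl' 0 z hz
      rw [sub_zero] at h
      have hcc : c ≠ c' := fun h => (List.nodup_cons.1 hln).1 (h ▸ hc')
      refine Reach.join hcc ?_ h
      rw [Multiset.mem_add, Multiset.mem_singleton, Multiset.mem_coe] at hy
      rcases hy with rfl | hy
      · exact .self hbc
      · obtain ⟨c'', _, hc'', h''⟩ := hC.reach hadj (hadj' c) _ y hy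
        have := h''.cons hbc fun h => hc'' (by rw [h])
        rwa [add_sub_cancel] at this
    have hcross : ∀ {A B : Multiset (V × ℝ)}, x ∈ cross₂ A B →
        (∀ y ∈ A, ∀ z ∈ B,
          ∃ p : G.Walk y.1 z.1, p.edges.IsChain (· ≠ ·) ∧ walkWeight w p = y.2 + z.2) →
        ∃ p : G.Walk x.1.1 x.1.2, p.edges.IsChain (· ≠ ·) ∧ walkWeight w p = x.2 := by
      intro A B hx hAB
      simp only [cross₂, cross, Multiset.mem_add, Multiset.mem_bind, Multiset.mem_map] at hx
      rcases hx with ⟨y, hy, z, hz, rfl⟩ | ⟨z, hz, y, hy, rfl⟩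
      · exact hAB y hy z hz
      · have := hrev (hAB y hy z hz)
        rwa [add_comm] at this
    rw [pairs] at hx
    simp only [Multiset.mem_add, Multiset.mem_singleton] at hx
    rcases hx with (((rfl | hx) | hx) | hx) | hx
    · exact ⟨.nil, by simp, by simp [walkWeight]⟩
    · exact ihC (hadj' c) (hnd c) hx
    · exact ihR hl' (List.nodup_cons.1 hln).2 hx
    · refine hcross hx fun y hy z hz => ?_
      rw [Multiset.mem_singleton] at hy
      subst hy
      rw [zero_add]
      exact hroot z hz
    · exact hcross hx hjoin

/-- A repetition would give a closed walk without backtracking, or two such walks from b to one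
vertex with different second vertices. -/
theorem IsRooted.nodup_labels (hG : G.IsAcyclic) (hadj : ∀ v c, c ∈ adj v ↔ G.Adj v c)
    (hnd : ∀ v, (adj v).Nodup) {a : Option V} {b : V} {l : List V} {T : Forest V}
    (H : IsRooted adj w a b l T) (hl : ∀ c ∈ l, G.Adj b c) (hln : l.Nodup) : T.labels.Nodup := by
  induction H with
  | nil => simp [labels, entries]
  | skip _ _ ih =>
    exact ih (fun c hc => hl c (List.mem_cons_of_mem _ hc)) (List.nodup_cons.1 hln).2
  | @cons a b c l C R hca hC hR ihC ihR =>
    have hadj' : ∀ v, ∀ c ∈ adj v, G.Adj v c := fun v c h => (hadj v c).1 h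
    have hl' : ∀ c' ∈ l, G.Adj b c' := fun c' h => hl c' (List.mem_cons_of_mem _ h)
    have hbc := hl c List.mem_cons_self
    have hRr : ∀ v ∈ R.labels, ∃ c' d, c ≠ c' ∧ Reach G w b c' v d := by
      intro v hv
      obtain ⟨y, hy, rfl⟩ := Multiset.mem_map.1 hv
      obtain ⟨c', hc', _, h⟩ := hR.reach hadj hl' 0 y hy
      exact ⟨c', _, fun h => (List.nodup_cons.1 hln).1 (h ▸ hc'), h⟩
    have hCr : ∀ v ∈ C.labels, ∃ c' d, c' ≠ b ∧ Reach G w c c' v d := by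
      intro v hv
      obtain ⟨y, hy, rfl⟩ := Multiset.mem_map.1 hv
      obtain ⟨c', hc', h', h⟩ := hC.reach hadj (hadj' c) 0 y hy
      exact ⟨c', _, fun h => h' (by rw [h]), h⟩
    rw [labels_cons, Multiset.singleton_add, Multiset.nodup_cons, Multiset.mem_add,
      Multiset.nodup_add]
    refine ⟨?_, ihC (hadj' c) (hnd c), ihR hl' (List.nodup_cons.1 hln).2, ?_⟩
    · rintro (h | h)
      · obtain ⟨c', d, _, h', p, hp, _⟩ := hCr c h
        exact not_isChain_cons_self hG (h := h') hp
      · obtain ⟨c', d, hc, h', p, hp, _⟩ := hRr c h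
        exact hc (eq_of_isChain_cons hG (h := hbc) (h' := h') (p := .nil) (by simp) hp)
    · rw [Multiset.disjoint_left]
      intro v hv hv'
      obtain ⟨c', d, hc', h⟩ := hCr v hv
      obtain ⟨h₁, p, hp, _⟩ := h.cons hbc hc'
      obtain ⟨c'', d', hc, h', p', hp', _⟩ := hRr v hv'
      exact hc (eq_of_isChain_cons hG (h := hbc) (h' := h') hp hp')

/-- Follows the walk downwards: not backtracking means that it never turns to the parent, the only
neighbour omitted by the forest. -/
theorem IsRooted.mem_labels (hadj : ∀ v c, c ∈ adj v ↔ G.Adj v c)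
    {a : Option V} {b : V} {l : List V} {T : Forest V}
    (H : IsRooted adj w a b l T) {c v : V} (hc : c ∈ l) (hca : some c ≠ a)
    (p : G.Walk c v) (hp : (s(b, c) :: p.edges).IsChain (· ≠ ·)) : v ∈ T.labels := by
  induction H generalizing c with
  | nil => simp at hc
  | skip h _ ih =>
    rcases List.mem_cons.1 hc with rfl | hc
    · exact (hca h).elim
    · exact ih hc hca p hp
  | @cons a b c' l C R hca' hC hR ihC ihR =>
    rw [labels_cons, Multiset.mem_add, Multiset.mem_add, Multiset.mem_singleton]
    rcases List.mem_cons.1 hc with rfl | hc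
    · cases p with
      | nil => exact .inl rfl
      | @cons _ d _ h' p' =>
        rw [SimpleGraph.Walk.edges_cons, List.isChain_cons_cons] at hp
        refine .inr (.inl (ihC ((hadj _ _).2 h') (fun h => ?_) p' hp.2))
        rw [Option.some.injEq] at h
        subst h
        exact hp.1 Sym2.eq_swap
    · exact .inr (.inr (ihR hc hca p hp))

/-- The walk q leads from the root to b and its last edge comes from the parent, so going on to
another neighbour does not backtrack. Thus q remains a path, shorter than the number of vertices,
and n bounds the remaining depth. -/
theorem exists_isRooted [Fintype V] (hG : G.IsAcyclic) (hadj : ∀ v c, c ∈ adj v ↔ G.Adj v c)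
    (n : ℕ) {r : V} (a : Option V) (b : V) (q : G.Walk r b)
    (hq : q.edges.IsChain (· ≠ ·)) (hqa : ∀ x ∈ q.edges.getLast?, ∃ y, a = some y ∧ x = s(y, b))
    (hn : Fintype.card V ≤ n + q.length) (l : List V) (hl : ∀ c ∈ l, G.Adj b c) :
    ∃ T, IsRooted adj w a b l T := by
  induction n generalizing a b l with
  | zero =>
    have := ((hG.isPath_iff_isChain q).2 hq).length_lt
    omega
  | succ n ih =>
    induction l with
    | nil => exact ⟨_, .nil a b⟩
    | cons c l ihl =>
      obtain ⟨R, hR⟩ := ihl fun c' h => hl c' (List.mem_cons_of_mem _ h)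
      by_cases hca : some c = a
      · exact ⟨R, .skip hca hR⟩
      · have hbc := hl c List.mem_cons_self
        obtain ⟨C, hC⟩ := ih (some b) c (q.concat hbc) (by
          rw [SimpleGraph.Walk.edges_concat, List.concat_eq_append, List.isChain_append]
          refine ⟨hq, by simp, fun x hx y hy => ?_⟩
          obtain ⟨z, rfl, rfl⟩ := hqa x hx
          rw [List.head?_cons, Option.mem_some_iff] at hy
          subst hy
          intro he
          rw [Sym2.eq_iff] at he
          rcases he with ⟨h₁, h₂⟩ | ⟨h₁, h₂⟩
          · exact hbc.ne h₂
          · exact hca (by rw [h₁])) (by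
          intro x hx
          rw [SimpleGraph.Walk.edges_concat, List.concat_eq_append, List.getLast?_append_cons] at hx
          simp at hx
          exact ⟨b, rfl, hx.symm⟩) (by
          rw [SimpleGraph.Walk.length_concat]
          omega) (adj c) fun c' h => (hadj c c').1 h
        exact ⟨_, .cons hca hC hR⟩

/-- The root itself is hung by an edge of weight 0 from an artificial point that is no vertex.
Labels occur exactly once, hence so do ordered pairs, and every recorded number is the weight of a
walk without backtracking, which is the distance. -/
theorem exists_pairs_eq [Fintype V] [DecidableEq V] (hG : G.IsTree)
    (hadj : ∀ v c, c ∈ adj v ↔ G.Adj v c) (hnd : ∀ v, (adj v).Nodup) (r : V) :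
    ∃ T : Forest V, IsRooted adj w none r (adj r) T ∧
      (Forest.cons r 0 T .nil).size = Fintype.card V ∧
      (Forest.cons r 0 T .nil).pairs =
        (Finset.univ : Finset (V × V)).val.map fun a => (a, weightedDist G w a.1 a.2) := by
  have hl : ∀ c ∈ adj r, G.Adj r c := fun c => (hadj r c).1
  obtain ⟨T, hT⟩ := exists_isRooted (w := w) hG.isAcyclic hadj (Fintype.card V) (r := r) none r .nil
    (by simp) (by simp) (by simp) (adj r) hl
  have hreach : ∀ y ∈ T.entries 0, ∃ c, Reach G w r c y.1 y.2 := by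
    intro y hy
    obtain ⟨c, _, _, h⟩ := hT.reach hadj hl 0 y hy
    rw [sub_zero] at h
    exact ⟨c, h⟩
  have hlab : (Forest.cons r 0 T .nil).labels = Finset.univ.val := by
    have h₁ : (Forest.cons r 0 T .nil).labels.Nodup := by
      rw [labels_cons, Multiset.singleton_add, Multiset.nodup_cons, Multiset.mem_add,
        Multiset.nodup_add]
      refine ⟨?_, hT.nodup_labels hG.isAcyclic hadj hnd hl (hnd r), by simp [labels, entries],
        disjoint_bot_right⟩
      rintro (h | h)
      · obtain ⟨y, hy, rfl⟩ := Multiset.mem_map.1 h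
        obtain ⟨c, h', p, hp, _⟩ := hreach y hy
        exact not_isChain_cons_self hG.isAcyclic (h := h') hp
      · simp [labels, entries] at h
    refine Multiset.Nodup.ext h₁ Finset.univ.nodup |>.2 fun v => ?_
    refine iff_of_true ?_ (Finset.mem_univ v)
    obtain ⟨p, hp⟩ := hG.connected.exists_isPath r v
    rw [hG.isAcyclic.isPath_iff_isChain] at hp
    rw [labels_cons, Multiset.mem_add, Multiset.mem_add, Multiset.mem_singleton]
    cases p with
    | nil => exact .inl rfl
    | cons h p =>
      exact .inr (.inl (hT.mem_labels hadj ((hadj _ _).2 h) (by simp) p (by simpa using hp)))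
  refine ⟨T, hT, ?_, ?_⟩
  · have := congrArg Multiset.card hlab
    rw [labels, Multiset.card_map, Multiset.coe_card, length_entries] at this
    exact this
  · have h₁ : ∀ a ∈ (Forest.cons r 0 T .nil).pairs, a.2 = weightedDist G w a.1.1 a.1.2 := by
      intro a ha
      rw [pairs] at ha
      simp only [pairs, cross₂, cross, entries, Multiset.mem_add, Multiset.mem_singleton,
        Multiset.coe_nil, Multiset.map_zero, Multiset.bind_zero, Multiset.zero_bind,
        Multiset.singleton_bind, Multiset.mem_map,
        Multiset.mem_bind, zero_add, add_zero, Multiset.map_singleton] at ha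
      suffices ∃ p : G.Walk a.1.1 a.1.2, p.edges.IsChain (· ≠ ·) ∧ walkWeight w p = a.2 by
        obtain ⟨p, hp, h⟩ := this
        rw [weightedDist_eq hG.isAcyclic p hp, h]
      rcases ha with (rfl | ha) | ⟨y, hy, rfl⟩ | ⟨y, hy, rfl⟩
      · exact ⟨.nil, by simp, by simp [walkWeight]⟩
      · exact hT.walk_of_mem_pairs hadj hnd hl (hnd r) a ha
      · obtain ⟨c, h⟩ := hreach y hy
        exact h.exists_walk
      · obtain ⟨c, h⟩ := hreach y hy
        obtain ⟨p, hp, h⟩ := h.exists_walk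
        exact ⟨p.reverse, isChain_reverse hp, by rw [walkWeight_reverse, h]⟩
    have h₂ := Forest.map_fst_pairs (Forest.cons r 0 T .nil)
    rw [hlab] at h₂
    have h₃ : (Finset.univ : Finset (V × V)).val = Finset.univ.val ×ˢ Finset.univ.val := rfl
    rw [h₃, ← h₂, Multiset.map_map]
    conv_lhs => rw [← Multiset.map_id (Forest.cons r 0 T .nil).pairs]
    refine Multiset.map_congr rfl fun a ha => ?_
    exact Prod.ext rfl (h₁ a ha)

end

section
variable {L : Expr} {e : ℕ} {f₀ : ℝ} {F : List Expr}

variable (hF : Extends (treeIntFuns L e f₀) F)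
include hF

/-! ### Reading the tree -/

/-- In the time bound each vertex counts three units: for its own cell, for the end of its neighbour
list, and for the entry of its parent there, which occurs at most once by `hnd`. Each unit includes
the logarithmic cost of lookups. -/
theorem fn_dfs {N k : ℕ} (hN : N ≤ 2 ^ k) {adj : Fin N → List (Fin N)} {w : Sym2 (Fin N) → ℝ}
    (hnd : ∀ v, (adj v).Nodup) {X : Fin N → ℝ} {A Y : ℕ → Val}
    (hA : ∀ v : Fin N, A v =
      Val.ofList ((adj v).map fun c : Fin N => .pair (.num ((c : ℕ) : ℝ)) (.num (w s(v, c)))))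
    (hY : ∀ v : Fin N, Y v = .num (X v)) {a : Option (Fin N)} {b : Fin N} {l : List (Fin N)}
    {T : Forest (Fin N)} (H : IsRooted adj w a b l T) :
    Fn F 21 (.pair
        (Val.ofList (l.map fun c : Fin N => .pair (.num ((c : ℕ) : ℝ)) (.num (w s(b, c)))))
        (.pair (.num (a.elim (-1) fun v : Fin N => ((v : ℕ) : ℝ))) (.pair (.num ((b : ℕ) : ℝ))
          (.pair (treeVal k A) (.pair (treeVal k Y) (.num (2 ^ k)))))))
      (T.val (fun v : Fin N => ((v : ℕ) : ℝ)) X)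
      (300 * (k + 1) * (3 * T.size + l.countP (some · = a) + 1)) := by
  have hT := extends_treeFuns (extends_cordialFuns hF)
  induction H with
  | nil a b =>
    refine Fn.of_W (hF 21 dfsBody rfl) ?_
    simp only [wp, dfsBody, List.map_nil, ofList_nil]
    refine ⟨by simp [Forest.val, Forest.body, Forest.size], ?_⟩
    simp only [List.countP_nil, Forest.size]
    omega
  | @skip a b c l T hca _ ih =>
    refine Fn.of_W (hF 21 dfsBody rfl) ?_
    subst hca
    simp only [wp, dfsBody, List.map_cons, ofList_cons]
    refine ih.use fun t ht => ?_
    simp only [Option.elim_some, sub_self, mul_zero, lt_irrefl, if_false]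
    refine ⟨trivial, ?_⟩
    rw [List.countP_cons_of_pos (by simp)]
    generalize List.countP _ l = m at *
    have e₁ : 300 * (k + 1) * (3 * T.size + (m + 1) + 1) =
      300 * (k + 1) * (3 * T.size + m + 1) + (300 * k + 300) := by ring
    rw [e₁]
    omega
  | @cons a b c l C R hca _ _ ihC ihR =>
    refine Fn.of_W (hF 21 dfsBody rfl) ?_
    simp only [wp, dfsBody, forest, List.map_cons, ofList_cons]
    have hc : (c : ℕ) < 2 ^ k := c.2.trans_le hN
    refine ihR.use fun t₁ h₁ => ?_
    -- At the root the parent is named -1, which is the name of no vertex.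
    have hne : ((c : ℕ) : ℝ) - (a.elim (-1) fun v : Fin N => ((v : ℕ) : ℝ)) ≠ 0 := by
      cases a with
      | none =>
        simp only [Option.elim_none, sub_neg_eq_add]
        positivity
      | some v =>
        simp only [Option.elim_some, ne_eq, sub_eq_zero, Nat.cast_inj, Fin.val_inj]
        exact fun h => hca (by rw [h])
    -- The language tests only positivity, so inequality of names is tested on the square of their
    -- difference.
    simp only [if_pos (mul_self_pos.2 hne)]
    refine (fn_lookup hT hc A).use fun t₂ h₂ => ?_
    rw [hA]
    refine ihC.use fun t₃ h₃ => ?_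
    refine (fn_lookup hT hc Y).use fun t₄ h₄ => ?_
    rw [hY]
    simp only [Forest.val]
    refine ⟨by simp [Forest.body, Forest.size, entryVal], ?_⟩
    have hcount : (adj c).countP (some · = some b) ≤ 1 := by
      have := List.nodup_iff_count_le_one.1 (hnd c) b
      rwa [List.count, List.countP_congr (q := (some · = some b)) (by simp)] at this
    rw [List.countP_cons_of_neg (by simpa using hca)]
    generalize List.countP _ l = m at *
    have h₅ : 300 * (k + 1) * (3 * C.size + List.countP (some · = some b) (adj c) + 1) ≤
      300 * (k + 1) * (3 * C.size + 1 + 1) := by gcongr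
    have e₁ : 300 * (k + 1) * (3 * (Forest.cons c (w s(b, c)) C R).size + m + 1) =
      300 * (k + 1) * (3 * C.size + 1 + 1) + 300 * (k + 1) * (3 * R.size + m + 1) +
        (300 * k + 300) := by
      rw [Forest.size]
      ring
    rw [e₁]
    omega

/-! ### Collecting the results -/

theorem fn_sum (l : List ℝ) :
    Fn F 29 (Val.ofList (l.map .num)) (.num l.sum) (20 * l.length + 10) := by
  induction l with
  | nil =>
    refine Fn.of_W (hF 29 sumBody rfl) ?_
    simp only [wp, sumBody, List.map_nil, ofList_nil]
    exact ⟨by simp, by norm_num⟩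
  | cons a l ih =>
    refine Fn.of_W (hF 29 sumBody rfl) ?_
    simp only [wp, sumBody, List.map_cons, ofList_cons]
    refine ih.use fun t ht => ?_
    simp only [wp]
    refine ⟨by simp, ?_⟩
    rw [List.length_cons]
    omega

theorem fn_collect {k : ℕ} (g : ℕ → List ℝ) (l : List Val) (i : ℕ) (hi : i + l.length ≤ 2 ^ k) :
    Fn F 30 (.pair (Val.ofList l) (.pair (.num i)
        (.pair (treeVal k fun i => Val.ofList ((g i).map .num)) (.num (2 ^ k)))))
      (Val.ofList ((List.range' i l.length).map fun i => .num (g i).sum))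
      (20 * ((List.range' i l.length).map fun i => (g i).length).sum +
        150 * (k + 1) * l.length + 10) := by
  have hT := extends_treeFuns (extends_cordialFuns hF)
  induction l generalizing i with
  | nil =>
    refine Fn.of_W (hF 30 collectBody rfl) ?_
    simp only [wp, collectBody, ofList_nil]
    exact ⟨by simp [ofList_nil], by simp⟩
  | cons a l ih =>
    refine Fn.of_W (hF 30 collectBody rfl) ?_
    rw [List.length_cons] at hi
    have ih := ih (i + 1) (by omega)
    push_cast at ih
    simp only [wp, collectBody, ofList_cons]
    refine (fn_lookup hT (by omega : i < 2 ^ k) _).use fun t₁ h₁ =>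
      (fn_sum hF _).use fun t₂ h₂ => ih.use fun t₃ h₃ => ⟨?_, ?_⟩
    · rw [List.length_cons, List.range'_succ, List.map_cons, ofList_cons]
    · rw [List.length_cons, List.range'_succ, List.map_cons, List.sum_cons]
      have e₁ : 150 * (k + 1) * (l.length + 1) = 150 * (k + 1) * l.length + 150 * k + 150 := by ring
      rw [e₁]
      omega

theorem fn_heads (l : List (Val × Val)) :
    Fn F 32 (Val.ofList (l.map fun a => .pair a.1 a.2)) (Val.ofList (l.map (·.1)))
      (20 * l.length + 10) := by
  induction l with
  | nil =>
    refine Fn.of_W (hF 32 headsBody rfl) ?_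
    simp only [wp, headsBody, List.map_nil, ofList_nil]
    exact ⟨trivial, by norm_num⟩
  | cons a l ih =>
    refine Fn.of_W (hF 32 headsBody rfl) ?_
    simp only [wp, headsBody, List.map_cons, ofList_cons]
    refine ih.use fun t ht => ⟨rfl, ?_⟩
    rw [List.length_cons]
    omega

theorem fn_tails (l : List (Val × Val)) :
    Fn F 33 (Val.ofList (l.map fun a => .pair a.1 a.2)) (Val.ofList (l.map (·.2)))
      (20 * l.length + 10) := by
  induction l with
  | nil =>
    refine Fn.of_W (hF 33 tailsBody rfl) ?_
    simp only [wp, tailsBody, List.map_nil, ofList_nil]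
    exact ⟨trivial, by norm_num⟩
  | cons a l ih =>
    refine Fn.of_W (hF 33 tailsBody rfl) ?_
    simp only [wp, tailsBody, List.map_cons, ofList_cons]
    refine ih.use fun t ht => ⟨rfl, ?_⟩
    rw [List.length_cons]
    omega

end

/-! ### Adjacency lists -/

section
variable {V : Type} [DecidableEq V] {G : SimpleGraph V} {l : List (V × V)}

/-- The list of the edges in both directions. -/
def bothDirections (l : List (V × V)) : List (V × V) := l.flatMap fun e => [(e.1, e.2), (e.2, e.1)]

/-- The list of the neighbours of a vertex, from a list of edges. -/
def neighbours (l : List (V × V)) (v : V) : List V :=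
  ((bothDirections l).filter (·.1 = v)).map (·.2)

theorem IsEdgeList.mem_neighbours (hl : IsEdgeList G l) (v c : V) :
    c ∈ neighbours l v ↔ G.Adj v c := by
  rw [← SimpleGraph.mem_edgeSet, ← hl.2]
  simp only [neighbours, bothDirections, List.mem_map, List.mem_filter, List.mem_flatMap,
    List.mem_cons, List.not_mem_nil, or_false, decide_eq_true_eq]
  constructor
  · rintro ⟨_, ⟨⟨e, he, rfl | rfl⟩, rfl⟩, rfl⟩
    · exact ⟨e, he, rfl⟩
    · exact ⟨e, he, Sym2.eq_swap⟩
  · rintro ⟨e, he, h⟩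
    rw [Sym2.eq_iff] at h
    rcases h with ⟨rfl, rfl⟩ | ⟨rfl, rfl⟩
    · exact ⟨_, ⟨⟨e, he, .inl rfl⟩, rfl⟩, rfl⟩
    · exact ⟨_, ⟨⟨e, he, .inr rfl⟩, rfl⟩, rfl⟩

theorem IsEdgeList.nodup_neighbours (hl : IsEdgeList G l) (v : V) : (neighbours l v).Nodup := by
  refine List.Nodup.map_on ?_ (List.Nodup.filter _ ?_)
  · intro x hx y hy h
    rw [List.mem_filter, decide_eq_true_eq] at hx hy
    exact Prod.ext (hx.2.trans hy.2.symm) h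
  · rw [bothDirections, List.nodup_flatMap]
    constructor
    · intro e he
      have : G.Adj e.1 e.2 := (hl.2 _).1 (List.mem_map_of_mem he)
      simp [Prod.ext_iff, this.ne]
    · have := hl.1
      rw [List.Nodup, List.pairwise_map] at this
      refine this.imp fun {e e'} h => ?_
      rw [Function.onFun, List.disjoint_left]
      rintro x hx hx'
      simp only [List.mem_cons, List.not_mem_nil, or_false] at hx hx'
      rcases hx with rfl | rfl <;> rcases hx' with hx' | hx' <;> rw [Prod.mk.injEq] at hx' <;>
        exact h (Sym2.eq_iff.2 (by tauto))

theorem IsEdgeList.length_add_one [Fintype V] (hl : IsEdgeList G l) (hG : G.IsTree) :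
    l.length + 1 = Fintype.card V := by
  classical
  rw [← hG.card_edgeFinset, ← List.length_map (fun e : V × V => s(e.1, e.2)),
    ← List.toFinset_card_of_nodup hl.1]
  congr 2
  ext e
  rw [List.mem_toFinset, hl.2, SimpleGraph.mem_edgeFinset]

end

theorem sum_length_filter_le {α : Type*} (l : List α) (f : α → ℕ) (n : ℕ) :
    ((List.range' 0 n).map fun i => (l.filter (f · = i)).length).sum ≤ l.length := by
  rw [← List.range_eq_range']
  change ∑ i ∈ Finset.range n, _ ≤ _
  induction l with
  | nil => simp
  | cons a l ih =>
    have : ∀ i, ((a :: l).filter (f · = i)).length =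
        (l.filter (f · = i)).length + if f a = i then 1 else 0 := by
      intro i
      split_ifs with h <;> simp [h]
    simp only [this, Finset.sum_add_distrib, Finset.sum_ite_eq]
    rw [List.length_cons]
    split_ifs <;> omega

section
variable {L : Expr} {e : ℕ} {f₀ : ℝ} {F : List Expr}

variable (hF : Extends (treeIntFuns L e f₀) F)
include hF

theorem fn_adjacency {N k : ℕ} (hN : N ≤ 2 ^ k) (w : Sym2 (Fin N) → ℝ)
    (l : List (Fin N × Fin N)) :
    ∃ r A, Fn F 20 (Val.edges w l) r (50 * l.length + 10) ∧
      Fn F 19 (.pair r (.pair (treeVal k fun _ => .num 0) (.num (2 ^ k)))) (treeVal k A)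
        (200 * (k + 1) * (2 * l.length) + 20) ∧
      ∀ v : Fin N, A v = Val.ofList ((neighbours l v).map fun c : Fin N =>
        .pair (.num ((c : ℕ) : ℝ)) (.num (w s(v, c)))) := by
  set l' : List (ℕ × Val) := (bothDirections l).map fun x =>
    ((x.1 : ℕ), .pair (.num ((x.2 : ℕ) : ℝ)) (.num (w s(x.1, x.2)))) with hl'
  have h := fn_scatter hF (k := k) l' (by
    intro a ha
    obtain ⟨x, _, rfl⟩ := List.mem_map.1 ha
    exact x.1.2.trans_le hN)
  have hlen : l'.length = 2 * l.length := by
    simp [hl', bothDirections, mul_comm]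
  rw [hlen] at h
  refine ⟨_, fun i => Val.ofList ((l'.filter (·.1 = i)).map (·.2)),
    fn_both hF l (fun a => ((a.1 : ℕ) : ℝ)) (fun a => ((a.2 : ℕ) : ℝ))
    (fun a => w s(a.1, a.2)), ?_, fun v => ?_⟩
  · convert h using 3
    simp only [hl', bothDirections, List.map_flatMap, List.map_cons, List.map_nil]
    simp only [Sym2.eq_swap]
  · simp only [hl', List.filter_map, List.map_map, neighbours]
    congr 1
    have : ((fun a : ℕ × Val => decide (a.1 = (v : ℕ))) ∘ fun x : Fin N × Fin N =>
        ((x.1 : ℕ), Val.pair (.num ((x.2 : ℕ) : ℝ)) (.num (w s(x.1, x.2))))) =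
        fun x => decide (x.1 = v) := by
      ext x
      simp [Fin.ext_iff]
    rw [this]
    refine List.map_congr_left fun x hx => ?_
    rw [List.mem_filter, decide_eq_true_eq] at hx
    simp [hx.2]

end

/-! ### Integration of a scalar field -/

section
variable {L : Expr} {e : ℕ} {f₀ : ℝ} {F : List Expr}

/-- Contributions are sorted into buckets by vertex and each bucket is summed. The list `xs` only
provides the number of outputs. -/
theorem fn_gather (hF : Extends (treeIntFuns L e f₀) F) {N k : ℕ} (hN : N ≤ 2 ^ k)
    (l : List (Fin N × ℝ)) :
    ∃ r, Fn F 19 (.pair (Val.ofList (l.map (contribVal fun v : Fin N => ((v : ℕ) : ℝ))))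
        (.pair (treeVal k fun _ => .num 0) (.num (2 ^ k)))) r
        (200 * (k + 1) * l.length + 20) ∧
      ∀ xs : List Val, xs.length = N →
        Fn F 30 (.pair (Val.ofList xs) (.pair (.num 0) (.pair r (.num (2 ^ k)))))
          (Val.vec fun u => (l.map fun a => (if a.1 = u then 1 else 0) * a.2).sum)
          (20 * l.length + 150 * (k + 1) * N + 10) := by
  have h := fn_scatter hF (k := k) (l.map fun a => ((a.1 : ℕ), Val.num a.2)) (by
    intro a ha
    obtain ⟨x, _, rfl⟩ := List.mem_map.1 ha
    exact x.1.2.trans_le hN)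
  rw [List.map_map, List.length_map] at h
  refine ⟨_, h, fun xs hxs => ?_⟩
  have h₁ := fn_collect hF (k := k)
    (fun i => (l.filter fun a => (a.1 : ℕ) = i).map (·.2)) xs 0 (by omega)
  rw [hxs, Nat.cast_zero] at h₁
  have e₁ : (fun i => Val.ofList (((l.map fun a => ((a.1 : ℕ), Val.num a.2)).filter
      (·.1 = i)).map (·.2))) =
      fun i => Val.ofList (((l.filter fun a => (a.1 : ℕ) = i).map (·.2)).map .num) := by
    ext i
    rw [List.filter_map, List.map_map, List.map_map]
    rfl
  rw [e₁]
  have e₂ : (Val.vec fun u : Fin N => (l.map fun a => (if a.1 = u then 1 else 0) * a.2).sum) =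
      Val.ofList ((List.range' 0 N).map fun i =>
        .num ((l.filter fun a => (a.1 : ℕ) = i).map (·.2)).sum) := by
    rw [Val.vec, Val.ofFn]
    congr 1
    refine List.ext_getElem (by simp) fun i hi _ => ?_
    simp only [List.getElem_ofFn, List.getElem_map, List.getElem_range', one_mul, zero_add]
    congr 1
    clear h h₁ e₁
    induction l with
    | nil => simp
    | cons a l ih =>
      rw [List.map_cons, List.sum_cons, ih (by simpa using hi) (by simpa using hi),
        List.filter_cons]
      simp only [Fin.ext_iff, decide_eq_true_eq]
      split_ifs <;> simp
  rw [e₂]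
  refine h₁.mono ?_
  have := sum_length_filter_le l (fun a => (a.1 : ℕ)) N
  simp only [List.length_map]
  omega

variable {p q : ℝ[X]} {c : ℕ} (hp : p.natDegree < 2 ^ e) (hq : q.natDegree < 2 ^ e)
  (hL : ∀ (F : List Expr) (y v : ℝ), Eval F [.pair (.num y) (.num v)] L
    (.pair (polyVal e (C v * taylor y p)) (polyVal e (taylor y q))) c)
  (hF : Extends (treeIntFuns L e (p.eval 0 / q.eval 0)) F)
include hp hq hL hF

/-- The recursion has at most 4k + 1 levels and costs (k + 1)² per vertex on each, which makes the
cube. Reading the tree and collecting the O(N k) contributions is cheaper. -/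
theorem fn_scalar {N : ℕ} {G : SimpleGraph (Fin N)} (hG : G.IsTree) (w : Sym2 (Fin N) → ℝ)
    (l : List (Fin N × Fin N)) (hl : IsEdgeList G l)
    (H : ∀ u v, q.eval (weightedDist G w u v) ≠ 0) (X : Fin N → ℝ) :
    Fn F 31 (.pair (Val.edges w l) (Val.vec X))
      (Val.vec fun u => ∑ v, p.eval (weightedDist G w u v) / q.eval (weightedDist G w u v) * X v)
      (8 * (4 * (2 * (8 * (c + 200000 * (2 ^ e * (e + 1) ^ 2)) + 300) + 1000) + 10000) *
        (N * (Nat.clog 2 N + 1) ^ 3)) := by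
  have hT := extends_treeFuns (extends_cordialFuns hF)
  have hlen := hl.length_add_one hG
  rw [Fintype.card_fin] at hlen
  obtain ⟨N, rfl⟩ : ∃ n, N = n + 1 := ⟨l.length, hlen.symm⟩
  obtain ⟨k, hNk, hkN, hgrow⟩ := fn_grow hT (n := N + 1) 0 (by omega)
  rw [pow_zero] at hgrow
  obtain ⟨r, A, hboth, hscat, hA⟩ := fn_adjacency hF hNk w l
  obtain ⟨T, hTr, hsize, hpairs⟩ := exists_pairs_eq (w := w) hG hl.mem_neighbours
    hl.nodup_neighbours 0
  rw [Fintype.card_fin] at hsize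
  have hxs : Val.vec X = .pair (.num (X 0)) (Val.vec fun i => X i.succ) := by
    rw [Val.vec, Val.ofFn, List.ofFn_succ, ofList_cons]
    rfl
  set xs := List.ofFn fun i => Val.num (X i) with hxs'
  have hvec : Val.vec X = Val.ofList xs := rfl
  have hxl : xs.length = N + 1 := by rw [hxs', List.length_ofFn]
  -- The depth 4k suffices because N + 1 ≤ 2 ^ k and 5 ^ 4 * 2 = 1250 ≤ 1296 = 6 ^ 4.
  have hj : 5 ^ (4 * k) * (N + 1) ≤ 6 ^ (4 * k) := by
    rw [pow_mul, pow_mul]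
    calc (5 ^ 4) ^ k * (N + 1) ≤ (5 ^ 4) ^ k * 2 ^ k := by gcongr
      _ = (5 ^ 4 * 2) ^ k := (mul_pow ..).symm
      _ ≤ (6 ^ 4) ^ k := by gcongr; norm_num
  obtain ⟨ys, hys, hyl, hsolve⟩ := fn_solve hp hq hL hF (K := k)
    (lab := fun v : Fin (N + 1) => ((v : ℕ) : ℝ)) (X := X) (4 * k) (.cons 0 0 T .nil)
    (by omega) (by rwa [hsize]) (by rwa [hsize]) (by
      rw [hpairs]
      intro a ha
      obtain ⟨a, _, rfl⟩ := Multiset.mem_map.1 ha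
      exact H _ _)
  obtain ⟨r', hscat', hcol⟩ := fn_gather hF hNk ys
  have hres : (Val.vec fun u => ∑ v, p.eval (weightedDist G w u v) /
      q.eval (weightedDist G w u v) * X v) =
      Val.vec fun u => (ys.map fun a => (if a.1 = u then 1 else 0) * a.2).sum := by
    congr 1
    ext u
    -- The indicator of u as φ selects the contributions to u.
    rw [hys fun v => if v = u then 1 else 0, hpairs, Multiset.map_map]
    change _ = ∑ a : Fin (N + 1) × Fin (N + 1), _
    rw [Fintype.sum_prod_type]
    simp [mul_comm]
  have hlen' := fn_len hT xs
  have hempty := fn_build hT k [] (.num 0)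
  have hbuild := fn_build hT k xs (.num 0)
  have hdfs := fn_dfs hF hNk hl.nodup_neighbours (X := X) (Y := fun i => xs.getD i (.num 0)) hA
    (fun v => by rw [hxs', List.getD_eq_getElem _ _ (by rw [List.length_ofFn]; exact v.2),
      List.getElem_ofFn]) hTr
  have hlook := fn_lookup hT (Nat.two_pow_pos k) A
  rw [show A 0 = _ from hA 0] at hlook
  simp only [List.getD_nil, ofList_nil] at hempty
  simp only [Option.elim_none, Fin.val_zero, Nat.cast_zero] at hdfs hlook
  have hcount : (neighbours l 0).countP (fun x => some x = none) = 0 := by simp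
  rw [hcount] at hdfs
  have hsolve := hsolve []
  rw [List.append_nil, ofList_nil] at hsolve
  have hcol := hcol xs hxl
  rw [hxl] at hlen'
  refine Fn.of_W (hF 31 scalarBody rfl) ?_
  rw [hvec, hres]
  simp only [wp, scalarBody, forest]
  refine hlen'.use fun t₁ h₁ => hgrow.use fun t₂ h₂ => hempty.use fun t₃ h₃ => ?_
  simp only [wp]
  refine hboth.use fun t₄ h₄ => hscat.use fun t₅ h₅ => hbuild.use fun t₆ h₆ => ?_
  simp only [wp]
  refine hlook.use fun t₇ h₇ => hdfs.use fun t₈ h₈ => ?_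
  rw [← hvec, hxs]
  simp only [wp, Forest.val]
  rw [← hxs, hvec]
  have hval : (Forest.cons 0 0 T .nil).val (fun v : Fin (N + 1) => ((v : ℕ) : ℝ)) X =
      .pair (.num (T.size + 0 + 1)) (.pair (.pair (.num 0) (.pair (.num (X 0)) (.num 0)))
        (.pair (.pair (.num T.size) (T.body (fun v : Fin (N + 1) => ((v : ℕ) : ℝ)) X))
          (.pair (.num 0) (.num 0)))) := by
    simp [Forest.val, Forest.body, Forest.size, entryVal]
  rw [hval, hsize] at hsolve
  refine hsolve.use fun t₉ h₉ => ?_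
  refine hscat'.use fun t₁₀ h₁₀ => hcol.use fun t₁₁ h₁₁ => ⟨rfl, ?_⟩
  rw [hsize] at hyl
  rw [Forest.size, Forest.size] at hsize
  have hclog : k + 1 ≤ 2 * (Nat.clog 2 (N + 1) + 1) := by
    have : 2 ^ k ≤ 2 ^ (Nat.clog 2 (N + 1) + 1) := by
      rw [pow_succ']
      exact hkN.trans (Nat.mul_le_mul_left 2 (Nat.le_pow_clog one_lt_two _))
    have := (Nat.pow_le_pow_iff_right one_lt_two).1 this
    omega
  have hP : (N + 1) * (k + 1) ^ 3 ≤ 8 * ((N + 1) * (Nat.clog 2 (N + 1) + 1) ^ 3) := by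
    calc (N + 1) * (k + 1) ^ 3 ≤ (N + 1) * (2 * (Nat.clog 2 (N + 1) + 1)) ^ 3 := by gcongr
      _ = _ := by ring
  generalize 8 * (c + 200000 * (2 ^ e * (e + 1) ^ 2)) = D at h₉ ⊢
  rw [mul_assoc 8, mul_left_comm 8]
  refine le_trans ?_ (Nat.mul_le_mul_left _ hP)
  set P := (N + 1) * (k + 1) ^ 3 with hPdef
  have p₁ : (N + 1) * (k + 1) ≤ P := by
    rw [hPdef, pow_succ']
    exact Nat.mul_le_mul_left _ (Nat.le_mul_of_pos_right _ (by positivity))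
  have p₂ : N + 1 ≤ P := (Nat.le_mul_of_pos_right _ (Nat.succ_pos k)).trans p₁
  have p₃ : k + 1 ≤ P := (Nat.le_mul_of_pos_left _ (Nat.succ_pos N)).trans p₁
  have p₄ : (k + 1) * l.length ≤ P := by
    rw [mul_comm]
    exact (Nat.mul_le_mul_right _ (by omega)).trans p₁
  have p₅ : (k + 1) * T.size ≤ P := by
    rw [mul_comm]
    exact (Nat.mul_le_mul_right _ (by omega)).trans p₁
  have p₆ : (k + 1) * ys.length ≤ 8 * P := by
    calc (k + 1) * ys.length ≤ (k + 1) * (2 * ((N + 1) * (4 * (k + 1)))) := by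
          gcongr
          refine hyl.trans ?_
          gcongr
          omega
      _ = 8 * ((N + 1) * (k + 1) ^ 2) := by ring
      _ ≤ 8 * P := by
          rw [hPdef]
          gcongr <;> omega
  have p₇ : ys.length ≤ 8 * P := (Nat.le_mul_of_pos_left _ (Nat.succ_pos k)).trans p₆
  have p₈ : ∀ B, B * ((k + 1) ^ 2 * ((N + 1) * (4 * k + 1))) ≤ 4 * B * P := by
    intro B
    calc B * ((k + 1) ^ 2 * ((N + 1) * (4 * k + 1)))
        ≤ B * ((k + 1) ^ 2 * ((N + 1) * (4 * (k + 1)))) := by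
          gcongr
          omega
      _ = 4 * B * P := by
          rw [hPdef]
          ring
  have e₁ : 200 * (k + 1) * (2 * l.length) = 400 * ((k + 1) * l.length) := by ring
  have e₂ : 300 * (k + 1) * (3 * T.size + 0 + 1) = 900 * ((k + 1) * T.size) + 300 * (k + 1) := by
    ring
  have e₃ : 200 * (k + 1) * ys.length = 200 * ((k + 1) * ys.length) := by ring
  have e₄ : 150 * (k + 1) * (N + 1) = 150 * ((N + 1) * (k + 1)) := by ring
  have h₉ := h₉.trans (p₈ _)
  rw [e₁] at h₅
  rw [e₂] at h₈
  rw [e₃] at h₁₀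
  rw [e₄] at h₁₁
  rw [add_mul]
  omega

end

theorem Val.mat_succ {n m : ℕ} (X : Matrix (Fin n) (Fin (m + 1)) ℝ) :
    Val.mat X = Val.ofList ((List.ofFn fun i => (Val.num (X i 0), Val.vec fun j => X i j.succ)).map
      fun a => .pair a.1 a.2) := by
  rw [Val.mat, Val.ofFn, List.map_ofFn]
  congr 2
  ext i
  rw [Val.vec, Val.ofFn, List.ofFn_succ, ofList_cons]
  rfl

/-! ### Fields with several components -/

section
variable {L : Expr} {e : ℕ} {F : List Expr} {p q : ℝ[X]} {c : ℕ} (hp : p.natDegree < 2 ^ e)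
  (hq : q.natDegree < 2 ^ e)
  (hL : ∀ (F : List Expr) (y v : ℝ), Eval F [.pair (.num y) (.num v)] L
    (.pair (polyVal e (C v * taylor y p)) (polyVal e (taylor y q))) c)
  (hF : Extends (treeIntFuns L e (p.eval 0 / q.eval 0)) F)
include hp hq hL hF

/-- The columns are integrated one after the other, with m + 1 bounding the number of rounds;
splitting off and attaching a column is linear in N. -/
theorem fn_integrate {N m : ℕ} {G : SimpleGraph (Fin N)} (hG : G.IsTree) (w : Sym2 (Fin N) → ℝ)
    (l : List (Fin N × Fin N)) (hl : IsEdgeList G l)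
    (H : ∀ u v, q.eval (weightedDist G w u v) ≠ 0) (X : Matrix (Fin N) (Fin m) ℝ) :
    Fn F 34 (.pair (Val.edges w l) (Val.mat X))
      (Val.mat (distMatrix (fun x => p.eval x / q.eval x) G w * X))
      ((m + 1) * ((8 * (4 * (2 * (8 * (c + 200000 * (2 ^ e * (e + 1) ^ 2)) + 300) + 1000) + 10000) +
        300) * (N * (Nat.clog 2 N + 1) ^ 3))) := by
  have hT := extends_treeFuns (extends_cordialFuns hF)
  have hlen := hl.length_add_one hG
  rw [Fintype.card_fin] at hlen
  have hP : N ≤ N * (Nat.clog 2 N + 1) ^ 3 := Nat.le_mul_of_pos_right _ (by positivity)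
  have hS := fn_scalar hp hq hL hF hG w l hl H
  generalize 8 * (4 * (2 * (8 * (c + 200000 * (2 ^ e * (e + 1) ^ 2)) + 300) + 1000) + 10000) = S
    at hS ⊢
  generalize N * (Nat.clog 2 N + 1) ^ 3 = P at hS hP ⊢
  induction m with
  | zero =>
    -- With no columns every row is the empty list, the number 0; the program sees this in the first
    -- row, which exists since a tree has a vertex, and returns its input.
    have h₀ : ∀ Y : Matrix (Fin N) (Fin 0) ℝ,
        Val.mat Y = Val.ofList (List.replicate N (.num 0)) := by
      intro Y
      rw [Val.mat, Val.ofFn, ← List.ofFn_const]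
      rfl
    obtain ⟨n, hn⟩ : ∃ n, N = n + 1 := ⟨_, hlen.symm⟩
    have hr : Val.ofList (List.replicate N (.num 0)) =
        .pair (.num 0) (Val.ofList (List.replicate n (.num 0))) := by
      rw [hn, List.replicate_succ, ofList_cons]
    rw [h₀, h₀, hr]
    refine Fn.of_W (hF 34 integrateBody rfl) ?_
    simp only [wp, integrateBody]
    refine ⟨trivial, ?_⟩
    rw [zero_add, one_mul, add_mul]
    omega
  | succ m ih =>
    have ih := ih fun i j => X i j.succ
    have hz := fn_zip hT (List.finRange N)
      (fun i => .num ((distMatrix (fun x => p.eval x / q.eval x) G w * X) i 0))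
      (fun i => Val.vec fun j => (distMatrix (fun x => p.eval x / q.eval x) G w * X) i j.succ)
    have hh := fn_heads hF (List.ofFn fun i => (Val.num (X i 0), Val.vec fun j => X i j.succ))
    have ht := fn_tails hF (List.ofFn fun i => (Val.num (X i 0), Val.vec fun j => X i j.succ))
    rw [← Val.mat_succ, List.length_ofFn] at hh ht
    have e₁ : Val.ofList ((List.ofFn fun i => (Val.num (X i 0), Val.vec fun j => X i j.succ)).map
        (·.1)) = Val.vec fun i => X i 0 := by
      rw [List.map_ofFn]
      rfl
    have e₂ : Val.ofList ((List.ofFn fun i => (Val.num (X i 0), Val.vec fun j => X i j.succ)).map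
        (·.2)) = Val.mat fun i j => X i j.succ := by
      rw [List.map_ofFn]
      rfl
    have e₃ : Val.ofList ((List.finRange N).map fun i =>
        .num ((distMatrix (fun x => p.eval x / q.eval x) G w * X) i 0)) =
        Val.vec fun u => ∑ v, p.eval (weightedDist G w u v) /
          q.eval (weightedDist G w u v) * X v 0 := by
      rw [← List.ofFn_eq_map]
      rfl
    have e₄ : Val.ofList ((List.finRange N).map fun i =>
        Val.vec fun j => (distMatrix (fun x => p.eval x / q.eval x) G w * X) i j.succ) =
        Val.mat (distMatrix (fun x => p.eval x / q.eval x) G w *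
          Matrix.of fun i j => X i j.succ) := by
      rw [← List.ofFn_eq_map]
      rfl
    have e₅ : Val.ofList ((List.finRange N).map fun i =>
        .pair (.num ((distMatrix (fun x => p.eval x / q.eval x) G w * X) i 0))
          (Val.vec fun j => (distMatrix (fun x => p.eval x / q.eval x) G w * X) i j.succ)) =
        Val.mat (distMatrix (fun x => p.eval x / q.eval x) G w * X) := by
      rw [Val.mat_succ, List.ofFn_eq_map, List.map_map]
      rfl
    rw [e₁] at hh
    rw [e₂] at ht
    rw [e₃, e₄, e₅, List.length_finRange] at hz
    obtain ⟨a, b, r, hX⟩ : ∃ a b r, Val.mat X = .pair (.pair a b) r := by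
      obtain ⟨x, xs, hx⟩ := List.exists_cons_of_ne_nil (l := List.ofFn fun i =>
        (Val.num (X i 0), Val.vec fun j => X i j.succ)) (by rw [ne_eq, List.ofFn_eq_nil_iff]; omega)
      rw [Val.mat_succ, hx, List.map_cons, ofList_cons]
      exact ⟨_, _, _, rfl⟩
    refine Fn.of_W (hF 34 integrateBody rfl) ?_
    rw [hX] at hh ht ⊢
    simp only [wp, integrateBody]
    refine hh.use fun t₁ h₁ => (hS _).use fun t₂ h₂ => ht.use fun t₃ h₃ => ih.use fun t₄ h₄ =>
      hz.use fun t₅ h₅ => ⟨rfl, ?_⟩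
    rw [add_mul S] at h₄
    rw [add_mul (m + 1), one_mul, add_mul S]
    omega

end

theorem treeIntegrationInTime_rational (p q : ℝ[X]) {ε : ℝ} (hε : 0 < ε) (m : ℕ) :
    TreeIntegrationInTime (fun x => p.eval x / q.eval x) {x | q.eval x ≠ 0} m (3 + ε) := by
  obtain ⟨e, hp, hq⟩ := exists_two_pow_bound p q
  obtain ⟨L, c, hL⟩ := exists_leaf_expr p q e
  obtain ⟨C, hC, hlog⟩ := exists_clog_pow_le 3 hε
  set A := 8 * (4 * (2 * (8 * (c + 200000 * (2 ^ e * (e + 1) ^ 2)) + 300) + 1000) + 10000) + 300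
    with hA
  refine ⟨⟨treeIntFuns L e (p.eval 0 / q.eval 0), .call 34 (.var 0)⟩, ((m + 1) * A + 2) * C,
    fun N G hG w l hl H X => ?_⟩
  obtain ⟨t, ht, body, hb₁, hb₂⟩ := fn_integrate hp hq hL
    (F := treeIntFuns L e (p.eval 0 / q.eval 0)) (fun _ _ h => h) hG w l hl H X
  refine ⟨1 + t + 1, .call hb₁ (.var rfl) hb₂, fun hN => ?_⟩
  rw [← hA] at ht
  have h := hlog N hN
  have hpos : 1 ≤ N * (Nat.clog 2 N + 1) ^ 3 :=
    Nat.mul_pos (by omega) (Nat.pow_pos (Nat.succ_pos _))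
  have ht' : 1 + t + 1 ≤ ((m + 1) * A + 2) * (N * (Nat.clog 2 N + 1) ^ 3) := by
    rw [add_mul, mul_assoc]
    omega
  have ht'' : ((1 + t + 1 : ℕ) : ℝ) ≤
      (((m + 1) * A + 2) * (N * (Nat.clog 2 N + 1) ^ 3) : ℕ) := by
    exact_mod_cast ht'
  refine ht''.trans ?_
  rw [Nat.cast_mul, Nat.cast_mul, Nat.cast_pow, Nat.cast_add (Nat.clog 2 N), Nat.cast_add,
    Nat.cast_mul, Nat.cast_add m]
  push_cast at h ⊢
  calc (((m : ℝ) + 1) * A + 2) * (N * ((Nat.clog 2 N : ℝ) + 1) ^ 3)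
      ≤ ((m + 1) * A + 2) * (N * (C * Real.log N ^ (3 + ε))) := by gcongr
    _ = _ := by ring

theorem mainTheorem4 (p q : Polynomial ℝ) (hq : q ≠ 0) (ε : ℝ) (hε : 0 < ε) :
    IsCordialOn (fun x => p.eval x / q.eval x) {x | q.eval x ≠ 0} (2 + ε) ∧
      ∀ m : ℕ,
        TreeIntegrationInTime (fun x => p.eval x / q.eval x) {x | q.eval x ≠ 0} m (3 + ε) :=
  ⟨isCordialOn_rational p q hε, treeIntegrationInTime_rational p q hε⟩
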